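/- **Conventions.** Linear orders on $[n]$ are words from worst to best; $\alpha=12\cdots n$, $\omega=n\cdots 21$. $\mathrm{Inv}(\sigma)$ is the set of pairs $i<j$ with $j<_\sigma i$. The Bruhat graph on the set of linear orders joins $\sigma$ and $\tau$ when one of $\mathrm{Inv}(\sigma),\mathrm{Inv}(\tau)$ is the other plus exactly one pair. A *Condorcet domain* (CD) on $[n]$ is a set $\mathcal D$ of linear orders containing $\alpha$ and $\omega$ for which there are no alternatives $i,j,k$ and three orders in $\mathcal D$ whose restrictions to $\{i,j,k\}$ are $ijk$, $jki$, $kij$. It is *peak-pit* if for every triple $i<j<k$ either $j$ is never the worst of $i,j,k$ in the orders of $\mathcal D$ (peak condition), or $j$ is never the best (pit condition). It is *connected* if it induces a connected subgraph of the Bruhat graph. *Fishburn's domain* consists of the linear orders on $[n]$ satisfying, for each $i<j<k$, the peak condition if $j$ is even and the pit condition if $j$ is odd; $\Phi(n)$ is its size. A *GR-domain* is the set of all products of initial segments of words in one commutation class (exchanges $s_is_j\to s_js_i$ with $|i-j|>1$) of reduced decompositions of $\omega$. Let $\xi_1,\dots,\xi_n$ be vectors of equal length in the open upper half-plane, in strict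 clockwise order. The zonogon $Z_n$ is $\sum_i[0,\xi_i]$, and a tile is a translate of $[0,\xi_i]+[0,\xi_j]$, $i<j$. A *rhombus tiling* $T$ is a set of tiles with union $Z_n$ such that any two distinct tiles that meet do so in a single common vertex or a single common closed edge. A *snake* of $T$ is a maximal directed path in the graph of vertices and upward directed edges of the tiles; an edge parallel to $\xi_i$ has color $i$. $\Sigma(T)$ is the set of linear orders that are color sequences of snakes, and the sets $\Sigma(T)$ are the *tiling domains*. For $n\ge2$ let $\gamma_n$ be the maximum size of a tiling domain on $[n]$. For each $n$ the vectors $\xi_1,\dots,\xi_n$ are fixed arbitrarily. For orders $\sigma$ on $[n]$ and $\sigma'$ on $[n']$, $\sigma\sigma'$ is the concatenated order on $[n+n']$, with $[n']$ identified with $\{n+1,\dots,n+n'\}$. **Theorem.** 1. (Well-definedness) For $n\ge 2$ the maximum $\gamma_n$ exists. 2. (Stacking) Let $T$ and $T'$ be rhombus tilings of the zonogons of the first $n$ and of the last $n'$ of $n+n'$ such vectors. Then the partial tiling obtained by placing the bottom vertex of $T'$ on the top vertex of $T$ extends to a rhombus tiling $\widehat T$ of the zonogon of all $n+n'$ vectors,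 and $\sigma\sigma'\in\Sigma(\widehat T)$ for all $\sigma\in\Sigma(T)$, $\sigma'\in\Sigma(T')$. 3. (Concatenation) If $\mathcal D,\mathcal D'$ are peak-pit CDs on $[n]$ and $[n']$, then $\{\sigma\sigma':\sigma\in\mathcal D,\sigma'\in\mathcal D'\}\cup\{\omega\}$ is a peak-pit CD on $[n+n']$, and there are exactly $|\mathcal D|\,|\mathcal D'|$ orders $\sigma\sigma'$. 4. $\gamma_n\gamma_{n'}\le\gamma_{n+n'}$ for all $n,n'\ge2$. 5. $\Phi(21)=4443896$, $\Phi(42)=19156227207750$, and $\Phi(21)^2=19748211658816>\Phi(42)$. Moreover $\gamma_{42}>\Phi(42)$. 6. For each $n$ the following are equivalent: every peak-pit CD on $[n]$ has size at most $\Phi(n)$ (Fishburn); every GR-domain on $[n]$ has size at most $\Phi(n)$ (Galambos–Reiner); every connected CD on $[n]$ has size at most $\Phi(n)$ (Monjardet). For $n\ge2$ they are also equivalent to (C): $\gamma_n=\Phi(n)$. 7. All four of these statements are false for $n=42$. -/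

import Mathlib

namespace FishburnTiling

/-! ### Linear orders and the weak Bruhat order

A linear order on the `n` alternatives is the word `σ 0, σ 1, …, σ (n-1)`, from the worst
alternative to the best one, of a permutation `σ` of `Fin n`. The alternative `i` of
`{1, …, n}` is the element of `Fin n` with value `i - 1`. -/

/-- `i` is worse than `j` in the order `σ`: it comes earlier in the word. -/
def Below {n : ℕ} (σ : Equiv.Perm (Fin n)) (i j : Fin n) : Prop :=
  σ.symm i < σ.symm j

/-- The order `1 < 2 < ⋯ < n`. -/
def alphaOrder (n : ℕ) : Equiv.Perm (Fin n) := 1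

/-- The order `n < n - 1 < ⋯ < 1`. -/
def omegaOrder (n : ℕ) : Equiv.Perm (Fin n) := Fin.revPerm

/-- The set of inversions of `σ`. -/
def Inv {n : ℕ} (σ : Equiv.Perm (Fin n)) : Set (Fin n × Fin n) :=
  {p | p.1 < p.2 ∧ Below σ p.2 p.1}

/-- `τ` covers `σ`: its inversions are those of `σ` and exactly one more. -/
def CoveredBy {n : ℕ} (σ τ : Equiv.Perm (Fin n)) : Prop :=
  ∃ p, p ∉ Inv σ ∧ Inv τ = insert p (Inv σ)

/-- The Bruhat graph: the undirected graph of the covering relation. -/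
def bruhatGraph (n : ℕ) : SimpleGraph (Equiv.Perm (Fin n)) :=
  SimpleGraph.fromRel CoveredBy

/-! ### Condorcet domains -/

/-- Three alternatives and three orders of `D` that restrict to them as `ijk`, `jki`, `kij`. -/
def IsCyclic {n : ℕ} (D : Set (Equiv.Perm (Fin n))) : Prop :=
  ∃ i j k : Fin n, ∃ ρ ∈ D, ∃ σ ∈ D, ∃ τ ∈ D,
    (Below ρ i j ∧ Below ρ j k) ∧ (Below σ j k ∧ Below σ k i) ∧ (Below τ k i ∧ Below τ i j)

/-- A Condorcet domain; all domains are understood to contain `α` and `ω`. -/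
def IsCondorcetDomain {n : ℕ} (D : Set (Equiv.Perm (Fin n))) : Prop :=
  alphaOrder n ∈ D ∧ omegaOrder n ∈ D ∧ ¬ IsCyclic D

/-- The peak condition for `i < j < k`: `j` is not the worst of the three. -/
def Peak {n : ℕ} (σ : Equiv.Perm (Fin n)) (i j k : Fin n) : Prop :=
  ¬ (Below σ j i ∧ Below σ j k)

/-- The pit condition for `i < j < k`: `j` is not the best of the three. -/
def Pit {n : ℕ} (σ : Equiv.Perm (Fin n)) (i j k : Fin n) : Prop :=
  ¬ (Below σ i j ∧ Below σ k j)

/-- For each triple, all orders of `D` satisfy the peak condition or all satisfy the pit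
condition. -/
def IsPeakPit {n : ℕ} (D : Set (Equiv.Perm (Fin n))) : Prop :=
  ∀ i j k : Fin n, i < j → j < k → (∀ σ ∈ D, Peak σ i j k) ∨ (∀ σ ∈ D, Pit σ i j k)

/-- `D` induces a connected subgraph of the Bruhat graph. -/
def IsConnectedDomain {n : ℕ} (D : Set (Equiv.Perm (Fin n))) : Prop :=
  ((bruhatGraph n).induce D).Connected

/-- Fishburn's alternating scheme: the peak condition for even `j`, the pit condition for odd
`j`, where the alternatives are numbered from `1` to `n`. -/
def fishburnDomain (n : ℕ) : Set (Equiv.Perm (Fin n)) :=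
  {σ | ∀ i j k : Fin n, i < j → j < k →
    (Even (j.val + 1) → Peak σ i j k) ∧ (Odd (j.val + 1) → Pit σ i j k)}

/-- The size `Φ(n)` of Fishburn's domain. -/
noncomputable def fishburnPhi (n : ℕ) : ℕ := (fishburnDomain n).ncard

/-- The concatenation of the words `σ` and `σ'`, the alternatives of `σ'` being shifted to
`n + 1, …, n + n'`. -/
def concatOrder {n n' : ℕ} (σ : Equiv.Perm (Fin n)) (σ' : Equiv.Perm (Fin n')) :
    Equiv.Perm (Fin (n + n')) :=
  finSumFinEquiv.permCongr (Equiv.Perm.sumCongr σ σ')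

/-- All concatenations of an order of `D` with an order of `D'`. -/
def concatDomain {n n' : ℕ} (D : Set (Equiv.Perm (Fin n))) (D' : Set (Equiv.Perm (Fin n'))) :
    Set (Equiv.Perm (Fin (n + n'))) :=
  {ρ | ∃ σ ∈ D, ∃ σ' ∈ D', ρ = concatOrder σ σ'}

/-! ### Domains of commutation classes of reduced words

A maximal chain of the Bruhat poset is given by a reduced word of `ω`: the chain consists of
the products of the initial segments of the word. Multiplying by `s_k` on the right exchanges
the entries at the positions `k` and `k + 1`. -/

/-- The standard transposition of two neighbouring positions. -/
def adjSwap {n : ℕ} (k : Fin (n - 1)) : Equiv.Perm (Fin n) :=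
  Equiv.swap ⟨k.val, by omega⟩ ⟨k.val + 1, by omega⟩

/-- The product of the transpositions of a word. -/
def wordProd {n : ℕ} (w : List (Fin (n - 1))) : Equiv.Perm (Fin n) :=
  (w.map adjSwap).prod

/-- A reduced decomposition of `ω`. -/
def IsReducedWordOfOmega {n : ℕ} (w : List (Fin (n - 1))) : Prop :=
  wordProd w = omegaOrder n ∧ w.length = n.choose 2

/-- A fragment `s_i s_j` with `|i - j| > 1` is replaced by `s_j s_i`. -/
def CommutationStep {n : ℕ} (w w' : List (Fin (n - 1))) : Prop :=
  ∃ (u v : List (Fin (n - 1))) (i j : Fin (n - 1)),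
    (i.val + 1 < j.val ∨ j.val + 1 < i.val) ∧ w = u ++ i :: j :: v ∧ w' = u ++ j :: i :: v

/-- The union of the maximal chains in the equivalence class of the chain of `w`. -/
def grDomain {n : ℕ} (w : List (Fin (n - 1))) : Set (Equiv.Perm (Fin n)) :=
  {σ | ∃ w', Relation.ReflTransGen CommutationStep w w' ∧ ∃ u, u <+: w' ∧ σ = wordProd u}

/-- A Galambos-Reiner domain. -/
def IsGRDomain {n : ℕ} (D : Set (Equiv.Perm (Fin n))) : Prop :=
  ∃ w : List (Fin (n - 1)), IsReducedWordOfOmega w ∧ D = grDomain w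

/-! ### Rhombus tilings of zonogons -/

/-- Vectors of the same length in the open upper half-plane, in clockwise order. -/
structure IsConfiguration {n : ℕ} (ξ : Fin n → ℂ) : Prop where
  im_pos : ∀ i, 0 < (ξ i).im
  norm_eq : ∀ i j, ‖ξ i‖ = ‖ξ j‖
  clockwise : ∀ i j, i < j → (ξ i).re * (ξ j).im < (ξ j).re * (ξ i).im

/-- The zonogon, the sum of the segments `[0, ξ i]`. -/
def zonogon {n : ℕ} (ξ : Fin n → ℂ) : Set ℂ :=
  {z | ∃ a : Fin n → ℝ, (∀ i, 0 ≤ a i ∧ a i ≤ 1) ∧ z = ∑ i, (a i : ℂ) * ξ i}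

/-- An `ij`-tile, `i < j`, given by its bottom vertex and its two colours. -/
structure Tile (n : ℕ) where
  base : ℂ
  i : Fin n
  j : Fin n
  lt : i < j

/-- The closed rhombus that is the translate by the bottom vertex of `[0, ξ i] + [0, ξ j]`. -/
def Tile.body {n : ℕ} (ξ : Fin n → ℂ) (t : Tile n) : Set ℂ :=
  {z | ∃ a b : ℝ, (0 ≤ a ∧ a ≤ 1) ∧ (0 ≤ b ∧ b ≤ 1) ∧
    z = t.base + (a : ℂ) * ξ t.i + (b : ℂ) * ξ t.j}

/-- `v` is one of the four vertices of `t`. -/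
def Tile.HasVertex {n : ℕ} (ξ : Fin n → ℂ) (t : Tile n) (v : ℂ) : Prop :=
  v = t.base ∨ v = t.base + ξ t.i ∨ v = t.base + ξ t.j ∨ v = t.base + ξ t.i + ξ t.j

/-- The upward directed edge from `v` to `v + ξ k` is one of the four edges of `t`. -/
def Tile.HasEdge {n : ℕ} (ξ : Fin n → ℂ) (t : Tile n) (v : ℂ) (k : Fin n) : Prop :=
  (k = t.i ∧ (v = t.base ∨ v = t.base + ξ t.j)) ∨
  (k = t.j ∧ (v = t.base ∨ v = t.base + ξ t.i))

/-- A rhombus tiling: the tiles of `T` cover exactly the zonogon, and any two of them that meet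
have a single vertex or a single closed edge in common. -/
def IsTiling {n : ℕ} (ξ : Fin n → ℂ) (T : Set (Tile n)) : Prop :=
  (⋃ t ∈ T, t.body ξ) = zonogon ξ ∧
  ∀ s ∈ T, ∀ t ∈ T, s ≠ t →
    s.body ξ ∩ t.body ξ = ∅ ∨
    (∃ v, s.HasVertex ξ v ∧ t.HasVertex ξ v ∧ s.body ξ ∩ t.body ξ = {v}) ∨
    (∃ v k, s.HasEdge ξ v k ∧ t.HasEdge ξ v k ∧ s.body ξ ∩ t.body ξ = segment ℝ v (v + ξ k))

/-- The vertices of the graph of `T`. -/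
def IsVertexOf {n : ℕ} (ξ : Fin n → ℂ) (T : Set (Tile n)) (v : ℂ) : Prop :=
  ∃ t ∈ T, t.HasVertex ξ v

/-- The edges of the graph of `T`: from `v` to `v + ξ k`, of colour `k`. -/
def IsEdgeOf {n : ℕ} (ξ : Fin n → ℂ) (T : Set (Tile n)) (v : ℂ) (k : Fin n) : Prop :=
  ∃ t ∈ T, t.HasEdge ξ v k

/-- The edges that start at `v` and have the listed colours form a directed path. -/
def IsDirectedPath {n : ℕ} (ξ : Fin n → ℂ) (T : Set (Tile n)) : ℂ → List (Fin n) → Prop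
  | v, [] => IsVertexOf ξ T v
  | v, k :: c => IsEdgeOf ξ T v k ∧ IsDirectedPath ξ T (v + ξ k) c

/-- A snake, that is, a maximal directed path: no edge enters its first vertex and no edge
leaves its last one. -/
def IsSnake {n : ℕ} (ξ : Fin n → ℂ) (T : Set (Tile n)) (v : ℂ) (c : List (Fin n)) : Prop :=
  IsDirectedPath ξ T v c ∧
  (∀ u k, IsEdgeOf ξ T u k → u + ξ k ≠ v) ∧
  (∀ k, ¬ IsEdgeOf ξ T (v + (c.map ξ).sum) k)

/-- `Σ(T)`: the linear orders that are the colour sequences of the snakes of `T`. -/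
def snakeDomain {n : ℕ} (ξ : Fin n → ℂ) (T : Set (Tile n)) : Set (Equiv.Perm (Fin n)) :=
  {σ | ∃ v, IsSnake ξ T v (List.ofFn σ)}

/-- A domain of tiling type. -/
def IsTilingDomain {n : ℕ} (ξ : Fin n → ℂ) (D : Set (Equiv.Perm (Fin n))) : Prop :=
  ∃ T, IsTiling ξ T ∧ D = snakeDomain ξ T

/-- The sizes of the domains of tiling type. -/
def tilingSizes {n : ℕ} (ξ : Fin n → ℂ) : Set ℕ :=
  {m | ∃ D, IsTilingDomain ξ D ∧ D.ncard = m}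

/-- The maximum size `γ_n` of a domain of tiling type. -/
noncomputable def tilingGamma {n : ℕ} (ξ : Fin n → ℂ) : ℕ := sSup (tilingSizes ξ)

/-- A tile with colours among the first `n` of `n + n'` colours. -/
def Tile.lower {n : ℕ} (n' : ℕ) (t : Tile n) : Tile (n + n') where
  base := t.base
  i := Fin.castAdd n' t.i
  j := Fin.castAdd n' t.j
  lt := t.lt

/-- A tile translated by `p`, with colours among the last `n'` of `n + n'` colours. -/
def Tile.upper (n : ℕ) {n' : ℕ} (p : ℂ) (t : Tile n') : Tile (n + n') where
  base := p + t.base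
  i := Fin.natAdd n t.i
  j := Fin.natAdd n t.j
  lt := Nat.add_lt_add_left t.lt n

/-- The partial tiling obtained by putting the bottom vertex of `T'` on the top vertex of `T`. -/
def stack {n n' : ℕ} (ξ : Fin (n + n') → ℂ) (T : Set (Tile n)) (T' : Set (Tile n')) :
    Set (Tile (n + n')) :=
  Tile.lower n' '' T ∪ Tile.upper n (∑ i, ξ (Fin.castAdd n' i)) '' T'

/-! ### The conjectures, for a given number of alternatives -/

/-- Fishburn: the size of a peak-pit Condorcet domain does not exceed `Φ(n)`. -/
def FishburnConjecture (n : ℕ) : Prop :=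
  ∀ D : Set (Equiv.Perm (Fin n)), IsCondorcetDomain D → IsPeakPit D → D.ncard ≤ fishburnPhi n

/-- Galambos and Reiner: the size of a Galambos-Reiner domain does not exceed `Φ(n)`. -/
def GalambosReinerConjecture (n : ℕ) : Prop :=
  ∀ D : Set (Equiv.Perm (Fin n)), IsGRDomain D → D.ncard ≤ fishburnPhi n

/-- Monjardet: the size of a connected Condorcet domain does not exceed `Φ(n)`. -/
def MonjardetConjecture (n : ℕ) : Prop :=
  ∀ D : Set (Equiv.Perm (Fin n)), IsCondorcetDomain D → IsConnectedDomain D →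
    D.ncard ≤ fishburnPhi n

end FishburnTiling

open FishburnTiling

/-! A linear order is the chain of its initial segments, and the peak and pit conditions are
conditions on these sets. Two sets cross when an element of only one of them lies between two
elements of only the other. Initial segments of the orders of a peak-pit set never cross
(`separated_segmentSets`), and conversely the orders whose initial segments all belong to a
crossing-free system form a peak-pit set (`isPeakPit_chainDomain`). So a peak-pit domain may be
enlarged to the set of all chains of a maximal crossing-free system.

In a maximal system, every order but ω has an ascent whose exchange stays in the system
(`exists_ascent_mem_chainDomain`), and every order but α has such a descent. Two different ascents
of this kind are never at neighbouring positions, so their exchanges commute. A diamond argument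
makes all ascending words from α to ω equivalent under commutations (`commutation_of_ascendsIn`);
hence every peak-pit domain lies in a GR-domain. Conversely, GR-domains are peak-pit and connected,
and connected Condorcet domains are peak-pit (`IsConnectedDomain.isPeakPit`). The three conjectures
therefore bound the same maximum.

Geometrically, an order is an upward path through the zonogon, and the exchange of an ascent pushes
the path to the right across one rhombus. A reduced word of ω thus sweeps out a tiling
(`isTiling_tilesOf`), which depends only on the commutation class, and every tiling arises in this
way (`IsTiling.exists_word`). Snakes are the orders whose paths run along edges of the tiling.
Vertices of a tiling determine their sets within a crossing-free system, so Σ(T) is peak-pit, and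
every peak-pit set lies in some Σ(T). Hence γ_n is the maximum size of a peak-pit domain, whatever
the vectors are.

Concatenation preserves the peak-pit property and multiplies sizes, so γ is supermultiplicative.
Since Φ ≤ γ, it follows that γ_42 ≥ γ_21² ≥ Φ(21)² > Φ(42). The two values of Φ come from counting
initial segments with multiplicity, one cardinality after the other. -/

namespace FishburnTiling

/-! ### Prefixes of words and neighbouring transpositions -/

/-- The set of the first `m` letters of the word `σ`. -/
def prefixSet {n : ℕ} (σ : Equiv.Perm (Fin n)) (m : ℕ) : Finset (Fin n) :=
  Finset.univ.filter fun x => (σ.symm x).val < m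

theorem mem_prefixSet {n : ℕ} {σ : Equiv.Perm (Fin n)} {m : ℕ} {x : Fin n} :
    x ∈ prefixSet σ m ↔ (σ.symm x).val < m := by
  simp [prefixSet]

/-- The left one of the two positions exchanged by `adjSwap k`. -/
def lo {n : ℕ} (k : Fin (n - 1)) : Fin n := ⟨k.val, by omega⟩

/-- The right one of the two positions exchanged by `adjSwap k`. -/
def hi {n : ℕ} (k : Fin (n - 1)) : Fin n := ⟨k.val + 1, by omega⟩

@[simp] theorem lo_val {n : ℕ} (k : Fin (n - 1)) : (lo k).val = k.val := rfl
@[simp] theorem hi_val {n : ℕ} (k : Fin (n - 1)) : (hi k).val = k.val + 1 := rfl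

theorem lo_ne_hi {n : ℕ} (k : Fin (n - 1)) : lo k ≠ hi k := by
  intro h; have := congrArg Fin.val h; simp at this

theorem adjSwap_eq {n : ℕ} (k : Fin (n - 1)) : adjSwap k = Equiv.swap (lo k) (hi k) := rfl

theorem adjSwap_val {n : ℕ} (k : Fin (n - 1)) (p : Fin n) :
    (adjSwap k p).val =
      if p.val = k.val then k.val + 1 else if p.val = k.val + 1 then k.val else p.val := by
  rw [adjSwap_eq, Equiv.swap_apply_def]
  simp only [Fin.ext_iff, lo_val, hi_val]
  split_ifs <;> simp

@[simp] theorem adjSwap_lo {n : ℕ} (k : Fin (n - 1)) : adjSwap k (lo k) = hi k := by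
  simp [adjSwap_eq]

@[simp] theorem adjSwap_hi {n : ℕ} (k : Fin (n - 1)) : adjSwap k (hi k) = lo k := by
  simp [adjSwap_eq]

theorem adjSwap_of_ne {n : ℕ} {k : Fin (n - 1)} {p : Fin n} (h₁ : p.val ≠ k.val)
    (h₂ : p.val ≠ k.val + 1) : adjSwap k p = p := by
  apply Fin.ext; rw [adjSwap_val]; simp [h₁, h₂]

theorem adjSwap_mul_self {n : ℕ} (k : Fin (n - 1)) : adjSwap k * adjSwap k = 1 := by
  simp [adjSwap_eq]

theorem mul_adjSwap_mul_adjSwap {n : ℕ} (σ : Equiv.Perm (Fin n)) (k : Fin (n - 1)) :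
    σ * adjSwap k * adjSwap k = σ := by
  rw [mul_assoc, adjSwap_mul_self, mul_one]

theorem mul_adjSwap_symm_apply {n : ℕ} (σ : Equiv.Perm (Fin n)) (k : Fin (n - 1)) (x : Fin n) :
    (σ * adjSwap k).symm x = adjSwap k (σ.symm x) := by
  rw [Equiv.symm_apply_eq, Equiv.Perm.mul_apply, ← Equiv.Perm.mul_apply (adjSwap k),
    adjSwap_mul_self]
  simp

theorem adjSwap_comm {n : ℕ} {a b : Fin (n - 1)}
    (h : a.val + 1 < b.val ∨ b.val + 1 < a.val) :
    adjSwap a * adjSwap b = adjSwap b * adjSwap a := by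
  ext p
  simp only [Equiv.Perm.mul_apply, adjSwap_val]
  split_ifs <;> omega

theorem prefixSet_mul_adjSwap {n : ℕ} (σ : Equiv.Perm (Fin n)) {k : Fin (n - 1)} {m : ℕ}
    (h : m ≠ k.val + 1) : prefixSet (σ * adjSwap k) m = prefixSet σ m := by
  ext x
  rw [mem_prefixSet, mem_prefixSet, mul_adjSwap_symm_apply, adjSwap_val]
  split_ifs <;> omega

theorem prefixSet_succ {n : ℕ} (σ : Equiv.Perm (Fin n)) (p : Fin n) :
    prefixSet σ (p.val + 1) = insert (σ p) (prefixSet σ p.val) := by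
  ext x
  rw [Finset.mem_insert, mem_prefixSet, mem_prefixSet]
  constructor
  · intro h
    rcases Nat.lt_succ_iff_lt_or_eq.1 h with h | h
    · exact Or.inr h
    · left; rw [← Equiv.symm_apply_eq]; exact Fin.ext h
  · rintro (rfl | h)
    · simp
    · omega

theorem apply_notMem_prefixSet {n : ℕ} (σ : Equiv.Perm (Fin n)) (p : Fin n) :
    σ p ∉ prefixSet σ p.val := by
  simp [mem_prefixSet]

theorem prefixSet_zero {n : ℕ} (σ : Equiv.Perm (Fin n)) : prefixSet σ 0 = ∅ := by
  ext x; simp [mem_prefixSet]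

theorem prefixSet_of_le {n : ℕ} (σ : Equiv.Perm (Fin n)) {m : ℕ} (h : n ≤ m) :
    prefixSet σ m = Finset.univ := by
  ext x; simp only [mem_prefixSet, Finset.mem_univ, iff_true]; omega

theorem prefixSet_mono {n : ℕ} (σ : Equiv.Perm (Fin n)) {l m : ℕ} (h : l ≤ m) :
    prefixSet σ l ⊆ prefixSet σ m := by
  intro x; rw [mem_prefixSet, mem_prefixSet]; omega

theorem prefixSet_mul_adjSwap_succ {n : ℕ} (σ : Equiv.Perm (Fin n)) (k : Fin (n - 1)) :
    prefixSet (σ * adjSwap k) (k.val + 1) = insert (σ (hi k)) (prefixSet σ k.val) := by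
  have h := prefixSet_succ (σ * adjSwap k) (lo k)
  rw [lo_val, prefixSet_mul_adjSwap (m := k.val) σ (by omega)] at h
  simpa using h

theorem mem_Inv {n : ℕ} {σ : Equiv.Perm (Fin n)} {a b : Fin n} :
    (a, b) ∈ Inv σ ↔ a < b ∧ (σ.symm b).val < (σ.symm a).val := Iff.rfl

theorem Inv_mul_adjSwap {n : ℕ} {σ : Equiv.Perm (Fin n)} {k : Fin (n - 1)}
    (h : σ (lo k) < σ (hi k)) :
    Inv (σ * adjSwap k) = insert (σ (lo k), σ (hi k)) (Inv σ) := by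
  ext ⟨a, b⟩
  rw [Set.mem_insert_iff, mem_Inv, mem_Inv, mul_adjSwap_symm_apply, mul_adjSwap_symm_apply,
    Prod.mk.injEq, ← Equiv.symm_apply_eq, ← Equiv.symm_apply_eq, adjSwap_val, adjSwap_val,
    Fin.ext_iff, Fin.ext_iff, lo_val, hi_val]
  have e₁ : (σ.symm a).val = k.val + 1 → (σ.symm b).val = k.val → b < a := by
    intro ha hb
    have ha' : a = σ (hi k) := by rw [← Equiv.symm_apply_eq]; exact Fin.ext ha
    have hb' : b = σ (lo k) := by rw [← Equiv.symm_apply_eq]; exact Fin.ext hb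
    rw [ha', hb']; exact h
  have e₂ : (σ.symm a).val = k.val → (σ.symm b).val = k.val + 1 → a < b := by
    intro ha hb
    have ha' : a = σ (lo k) := by rw [← Equiv.symm_apply_eq]; exact Fin.ext ha
    have hb' : b = σ (hi k) := by rw [← Equiv.symm_apply_eq]; exact Fin.ext hb
    rw [ha', hb']; exact h
  have e₃ : a < b → (σ.symm a).val ≠ (σ.symm b).val := by
    intro hab e
    exact hab.ne (σ.symm.injective (Fin.ext e))
  constructor
  · rintro ⟨hab, h'⟩
    have := e₃ hab
    have : ¬ ((σ.symm a).val = k.val + 1 ∧ (σ.symm b).val = k.val) := fun h' =>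
      (e₁ h'.1 h'.2).asymm hab
    split_ifs at h' <;> first | (exact Or.inr ⟨hab, by omega⟩) | (exact Or.inl (by omega))
  · rintro (⟨ha, hb⟩ | ⟨hab, h'⟩)
    · refine ⟨e₂ ha hb, ?_⟩
      split_ifs <;> omega
    · refine ⟨hab, ?_⟩
      have : ¬ ((σ.symm a).val = k.val + 1 ∧ (σ.symm b).val = k.val) := fun h' =>
        (e₁ h'.1 h'.2).asymm hab
      split_ifs <;> omega

theorem notMem_Inv_of_ascent {n : ℕ} {σ : Equiv.Perm (Fin n)} {k : Fin (n - 1)} :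
    (σ (lo k), σ (hi k)) ∉ Inv σ := by
  rw [mem_Inv]; simp

theorem ncard_Inv_mul_adjSwap {n : ℕ} {σ : Equiv.Perm (Fin n)} {k : Fin (n - 1)}
    (h : σ (lo k) < σ (hi k)) :
    (Inv (σ * adjSwap k)).ncard = (Inv σ).ncard + 1 := by
  rw [Inv_mul_adjSwap h, Set.ncard_insert_of_notMem notMem_Inv_of_ascent (Set.toFinite _)]

theorem Inv_one {n : ℕ} : Inv (1 : Equiv.Perm (Fin n)) = ∅ := by
  ext ⟨a, b⟩
  rw [mem_Inv]
  simp only [Set.mem_empty_iff_false, iff_false, not_and]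
  intro h
  change ¬ (b.val < a.val)
  have := Fin.lt_def.1 h
  omega

theorem omegaOrder_symm_val {n : ℕ} (x : Fin n) : ((omegaOrder n).symm x).val = n - (x.val + 1) := by
  simp [omegaOrder, Fin.val_rev]

theorem omegaOrder_val {n : ℕ} (x : Fin n) : (omegaOrder n x).val = n - (x.val + 1) := by
  simp [omegaOrder, Fin.val_rev]

theorem mem_Inv_omega {n : ℕ} {a b : Fin n} : (a, b) ∈ Inv (omegaOrder n) ↔ a < b := by
  rw [mem_Inv, omegaOrder_symm_val, omegaOrder_symm_val, Fin.lt_def]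
  omega

theorem Inv_subset_omega {n : ℕ} (σ : Equiv.Perm (Fin n)) : Inv σ ⊆ Inv (omegaOrder n) := by
  rintro ⟨a, b⟩ h
  exact mem_Inv_omega.2 h.1

theorem ncard_Inv_omega {n : ℕ} : (Inv (omegaOrder n)).ncard = n.choose 2 := by
  have h : Inv (omegaOrder n) =
      ((Finset.univ.filter fun p : Fin n × Fin n => p.1 < p.2 : Finset _) : Set _) := by
    ext ⟨a, b⟩; rw [mem_Inv_omega]; simp
  rw [h, Set.ncard_coe_finset]
  have e : (Finset.univ.filter fun p : Fin n × Fin n => p.1 < p.2).card =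
      ∑ b : Fin n, (Finset.univ.filter fun a : Fin n => a < b).card := by
    rw [← Finset.card_sigma]
    refine Finset.card_bij (fun p _ => ⟨p.2, p.1⟩) ?_ ?_ ?_
    · rintro ⟨a, b⟩; simp
    · rintro ⟨a, b⟩ _ ⟨c, d⟩ _ h; simp at h; simp [h]
    · rintro ⟨b, a⟩ h; exact ⟨(a, b), by simpa using h, rfl⟩
  rw [e]
  have e' : ∀ b : Fin n, (Finset.univ.filter fun a : Fin n => a < b).card = b.val := by
    intro b
    have : (Finset.univ.filter fun a : Fin n => a < b) = Finset.Iio b := by ext; simp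
    rw [this, Fin.card_Iio]
  simp_rw [e']
  rw [Fin.sum_univ_eq_sum_range (fun i => i), Finset.sum_range_id, Nat.choose_two_right]

theorem eq_omegaOrder_of_descents {n : ℕ} {σ : Equiv.Perm (Fin n)}
    (h : ∀ k : Fin (n - 1), σ (hi k) < σ (lo k)) : σ = omegaOrder n := by
  cases n with
  | zero => exact Subsingleton.elim _ _
  | succ n =>
    have hm : StrictMono fun p : Fin (n + 1) => Fin.rev (σ p) := by
      rw [Fin.strictMono_iff_lt_succ]
      intro i
      rw [Fin.rev_lt_rev]
      exact h i
    -- A strictly increasing map on a well-order is determined by its range, and here the range is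
    -- everything.
    have he : (fun p : Fin (n + 1) => Fin.rev (σ p)) = id := by
      refine (hm.range_inj strictMono_id).1 ?_
      rw [Set.range_id, Set.range_eq_univ]
      exact Fin.rev_surjective.comp σ.surjective
    ext p
    have := congrFun he p
    simp only [id] at this
    rw [Fin.rev_eq_iff.1 this]
    simp [omegaOrder]

theorem exists_ascent {n : ℕ} {σ : Equiv.Perm (Fin n)} (h : σ ≠ omegaOrder n) :
    ∃ k : Fin (n - 1), σ (lo k) < σ (hi k) := by
  by_contra hc
  push Not at hc
  refine h (eq_omegaOrder_of_descents fun k => lt_of_le_of_ne (hc k) ?_)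
  exact fun e => lo_ne_hi k (σ.injective e).symm

/-! ### Separated set systems -/

/-- Some element of `A \ B` lies between two elements of `B \ A`. -/
def Crosses {n : ℕ} (A B : Finset (Fin n)) : Prop :=
  ∃ i j k : Fin n, i < j ∧ j < k ∧ (j ∈ A ∧ j ∉ B) ∧ (i ∉ A ∧ i ∈ B) ∧ (k ∉ A ∧ k ∈ B)

/-- The sets of `S` are pairwise strongly separated. -/
def Separated {n : ℕ} (S : Set (Finset (Fin n))) : Prop :=
  ∀ A ∈ S, ∀ B ∈ S, ¬ Crosses A B

/-- The orders all of whose initial segments belong to `S`. -/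
def chainDomain {n : ℕ} (S : Set (Finset (Fin n))) : Set (Equiv.Perm (Fin n)) :=
  {σ | ∀ m, prefixSet σ m ∈ S}

/-- All initial segments of the orders of `D`. -/
def segmentSets {n : ℕ} (D : Set (Equiv.Perm (Fin n))) : Set (Finset (Fin n)) :=
  {A | ∃ σ ∈ D, ∃ m, A = prefixSet σ m}

theorem subset_chainDomain_segmentSets {n : ℕ} (D : Set (Equiv.Perm (Fin n))) :
    D ⊆ chainDomain (segmentSets D) := fun σ hσ m => ⟨σ, hσ, m, rfl⟩

theorem chainDomain_mono {n : ℕ} {S S' : Set (Finset (Fin n))} (h : S ⊆ S') :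
    chainDomain S ⊆ chainDomain S' := fun _ hσ m => h (hσ m)

/-- A crossing of an initial segment of `σ` with one of `τ` makes `j` the worst of the three
alternatives in `σ` and the best in `τ`, which violates both conditions for the triple. -/
theorem separated_segmentSets {n : ℕ} {D : Set (Equiv.Perm (Fin n))} (h : IsPeakPit D) :
    Separated (segmentSets D) := by
  rintro _ ⟨σ, hσ, l, rfl⟩ _ ⟨τ, hτ, m, rfl⟩ ⟨i, j, k, hij, hjk, h₁, h₂, h₃⟩
  simp only [mem_prefixSet] at h₁ h₂ h₃
  rcases h i j k hij hjk with h | h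
  · exact h σ hσ ⟨by rw [Below, Fin.lt_def]; omega, by rw [Below, Fin.lt_def]; omega⟩
  · exact h τ hτ ⟨by rw [Below, Fin.lt_def]; omega, by rw [Below, Fin.lt_def]; omega⟩

theorem isPeakPit_of_not_worst_best {n : ℕ} {D : Set (Equiv.Perm (Fin n))}
    (h : ∀ i j k : Fin n, i < j → j < k → ∀ σ ∈ D, ∀ τ ∈ D,
      Below σ j i → Below σ j k → Below τ i j → Below τ k j → False) : IsPeakPit D := by
  intro i j k hij hjk
  by_contra hc
  push Not at hc
  obtain ⟨⟨σ, hσ, h₁⟩, ⟨τ, hτ, h₂⟩⟩ := hc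
  rw [Peak, not_not] at h₁
  rw [Pit, not_not] at h₂
  exact h i j k hij hjk σ hσ τ hτ h₁.1 h₁.2 h₂.1 h₂.2

theorem isPeakPit_chainDomain {n : ℕ} {S : Set (Finset (Fin n))} (h : Separated S) :
    IsPeakPit (chainDomain S) := by
  refine isPeakPit_of_not_worst_best fun i j k hij hjk σ hσ τ hτ h₁ h₂ h₃ h₄ => ?_
  rw [Below, Fin.lt_def] at h₁ h₂ h₃ h₄
  -- `σ` is cut just after `j`, its worst of the three, and `τ` just before `j`, its best: the first
  -- segment contains `j` alone, the second `i` and `k` without `j`.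
  refine h _ (hσ ((σ.symm j).val + 1)) _ (hτ (τ.symm j).val) ⟨i, j, k, hij, hjk, ?_⟩
  simp only [mem_prefixSet]
  omega

theorem IsPeakPit.mono {n : ℕ} {D D' : Set (Equiv.Perm (Fin n))} (h : IsPeakPit D')
    (hD : D ⊆ D') : IsPeakPit D := fun i j k hij hjk =>
  (h i j k hij hjk).imp (fun h σ hσ => h σ (hD hσ)) fun h σ hσ => h σ (hD hσ)

/-- `α` and `ω` may be added to a peak-pit set of orders. -/
theorem IsPeakPit.union_extremes {n : ℕ} {D : Set (Equiv.Perm (Fin n))} (h : IsPeakPit D) :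
    IsPeakPit (D ∪ {alphaOrder n, omegaOrder n}) := by
  have hα : ∀ {a b : Fin n}, Below (alphaOrder n) a b → a < b := fun h => h
  have hω : ∀ {a b : Fin n}, Below (omegaOrder n) a b → b < a := by
    intro a b h
    rw [Below, Fin.lt_def, omegaOrder_symm_val, omegaOrder_symm_val] at h
    rw [Fin.lt_def]; omega
  -- In `α` and `ω` the alternative `j` lies between `i` and `k`, so both conditions hold there.
  intro i j k hij hjk
  refine (h i j k hij hjk).imp (fun h => ?_) fun h => ?_ <;>
  · rintro σ (hσ | rfl | rfl)
    · exact h σ hσ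
    · rintro ⟨h₁, h₂⟩
      first | exact (hα h₁).asymm hij | exact (hα h₂).asymm hjk
    · rintro ⟨h₁, h₂⟩
      first | exact (hω h₂).asymm hjk | exact (hω h₁).asymm hij

/-- A peak-pit set of orders that contains `α` and `ω` is a Condorcet domain. -/
theorem IsPeakPit.isCondorcetDomain {n : ℕ} {D : Set (Equiv.Perm (Fin n))} (h : IsPeakPit D)
    (hα : alphaOrder n ∈ D) (hω : omegaOrder n ∈ D) : IsCondorcetDomain D := by
  refine ⟨hα, hω, ?_⟩
  rintro ⟨i, j, k, ρ, hρ, σ, hσ, τ, hτ, ⟨h₁, h₂⟩, ⟨h₃, h₄⟩, h₅, h₆⟩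
  -- In the orders ijk, jki, kij each alternative is worst once and best once. This applies to the
  -- one that is numerically in the middle.
  have key : ∀ a b c : Fin n, ∀ ρ ∈ D, ∀ σ ∈ D, a < b → b < c →
      Below ρ b a → Below ρ b c → Below σ a b → Below σ c b → False := by
    intro a b c ρ hρ σ hσ hab hbc h₁ h₂ h₃ h₄
    rcases h a b c hab hbc with h | h
    · exact h ρ hρ ⟨h₁, h₂⟩
    · exact h σ hσ ⟨h₃, h₄⟩
  have h₁₂ : Below ρ i k := lt_trans h₁ h₂
  have h₃₄ : Below σ j i := lt_trans h₃ h₄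
  have h₅₆ : Below τ k j := lt_trans h₅ h₆
  have hij : i ≠ j := by rintro rfl; exact lt_irrefl _ h₁
  have hjk : j ≠ k := by rintro rfl; exact lt_irrefl _ h₂
  have hik : i ≠ k := by rintro rfl; exact lt_irrefl _ h₁₂
  rcases lt_or_gt_of_ne hij with hij | hij <;> rcases lt_or_gt_of_ne hjk with hjk | hjk <;>
    rcases lt_or_gt_of_ne hik with hik | hik
  · exact key i j k σ hσ τ hτ hij hjk h₃₄ h₃ h₆ h₅₆
  · exact absurd (hij.trans hjk) hik.asymm
  · exact key i k j τ hτ ρ hρ hik hjk h₅ h₅₆ h₁₂ h₂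
  · exact key k i j ρ hρ σ hσ hik hij h₁₂ h₁ h₄ h₃₄
  · exact key j i k ρ hρ σ hσ hij hik h₁ h₁₂ h₃₄ h₄
  · exact key j k i τ hτ ρ hρ hjk hik h₅₆ h₅ h₂ h₁₂
  · exact absurd (hjk.trans hij) hik.asymm
  · exact key k j i σ hσ τ hτ hjk hij h₃ h₃₄ h₅₆ h₆

/-- Orders with nested inversion sets form a peak-pit set. -/
theorem isPeakPit_of_Inv_nested {n : ℕ} {D : Set (Equiv.Perm (Fin n))}
    (h : ∀ σ ∈ D, ∀ τ ∈ D, Inv σ ⊆ Inv τ ∨ Inv τ ⊆ Inv σ) : IsPeakPit D := by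
  refine isPeakPit_of_not_worst_best fun i j k hij hjk σ hσ τ hτ h₁ h₂ h₃ h₄ => ?_
  -- With `j` worst in `σ`, the pair (i, j) is inverted in `σ` only; with `j` best in `τ`, the pair
  -- (j, k) is inverted in `τ` only. So neither inversion set contains the other.
  rcases h σ hσ τ hτ with h | h
  · exact lt_asymm h₃ (h (show (i, j) ∈ Inv σ from ⟨hij, h₁⟩)).2
  · exact lt_asymm h₂ (h (show (j, k) ∈ Inv τ from ⟨hjk, h₄⟩)).2

/-- Every set that crosses no member of `S` is a member of `S`. -/
def CrossClosed {n : ℕ} (S : Set (Finset (Fin n))) : Prop :=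
  ∀ A, (∀ B ∈ S, ¬ Crosses A B ∧ ¬ Crosses B A) → A ∈ S

/-! ### Maximal separated systems and the exchanges possible in them -/

theorem not_crosses_self {n : ℕ} (A : Finset (Fin n)) : ¬ Crosses A A := by
  rintro ⟨i, j, k, -, -, h, -⟩; exact h.2 h.1

/-- There are finitely many systems, so some maximal separated one contains `S`; a set that crosses
none of its members could be added and hence already belongs to it. -/
theorem exists_crossClosed {n : ℕ} {S : Set (Finset (Fin n))} (h : Separated S) :
    ∃ S', S ⊆ S' ∧ Separated S' ∧ CrossClosed S' := by
  obtain ⟨S', hS', hmax⟩ := Set.Finite.exists_le_maximal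
    (Set.toFinite {S : Set (Finset (Fin n)) | Separated S}) h
  refine ⟨S', hS', hmax.prop, fun A hA => ?_⟩
  have : Separated (insert A S') := by
    rintro B (rfl | hB) C (rfl | hC)
    · exact not_crosses_self _
    · exact (hA C hC).1
    · exact (hA B hB).2
    · exact hmax.prop B hB C hC
  exact hmax.le_of_ge this (Set.subset_insert _ _) (Set.mem_insert _ _)

/-- `B` contains a letter of `σ` that comes after a smaller one not in `B`. -/
def RightOf {n : ℕ} (σ : Equiv.Perm (Fin n)) (B : Finset (Fin n)) : Prop :=
  ∃ p q : Fin n, p < q ∧ σ p ∉ B ∧ σ q ∈ B ∧ σ p < σ q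

/-- A member `B` of the system lies entirely on one side of `σ`: among the pairs of a letter outside
`B` followed by a letter in `B`, either all ascend or all descend. Two such pairs that share a
letter and have opposite directions would make `B` cross an initial segment of `σ`, and any two
pairs are linked through a third that shares a letter with each. -/
theorem RightOf.lt {n : ℕ} {S : Set (Finset (Fin n))} (hS : Separated S)
    {σ : Equiv.Perm (Fin n)} (hσ : σ ∈ chainDomain S) {B : Finset (Fin n)} (hB : B ∈ S)
    (h : RightOf σ B) {p q : Fin n} (hpq : p < q) (hp : σ p ∉ B) (hq : σ q ∈ B) :
    σ p < σ q := by
  have key₁ : ∀ p q q' : Fin n, p < q → p < q' → σ p ∉ B → σ q ∈ B → σ q' ∈ B →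
      σ p < σ q → σ p < σ q' := by
    intro p q q' h₁ h₂ hp hq hq' hlt
    by_contra hc
    have hne : σ p ≠ σ q' := fun e => h₂.ne (σ.injective e)
    refine hS _ (hσ (p.val + 1)) _ hB
      ⟨σ q', σ p, σ q, lt_of_le_of_ne (not_lt.1 hc) hne.symm, hlt, ?_⟩
    simp only [mem_prefixSet, Equiv.symm_apply_apply]
    rw [Fin.lt_def] at h₁ h₂
    exact ⟨⟨by omega, hp⟩, ⟨by omega, hq'⟩, ⟨by omega, hq⟩⟩
  have key₂ : ∀ p p' q : Fin n, p < q → p' < q → σ p ∉ B → σ p' ∉ B → σ q ∈ B →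
      σ p < σ q → σ p' < σ q := by
    intro p p' q h₁ h₂ hp hp' hq hlt
    by_contra hc
    have hne : σ p' ≠ σ q := fun e => h₂.ne (σ.injective e)
    refine hS _ hB _ (hσ q.val)
      ⟨σ p, σ q, σ p', hlt, lt_of_le_of_ne (not_lt.1 hc) hne.symm, ?_⟩
    simp only [mem_prefixSet, Equiv.symm_apply_apply]
    rw [Fin.lt_def] at h₁ h₂
    exact ⟨⟨hq, by omega⟩, ⟨hp, by omega⟩, ⟨hp', by omega⟩⟩
  -- The linking pair takes the later of the two letters in `B`, which comes after both letters
  -- outside `B`.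
  obtain ⟨p₀, q₀, h₀, hp₀, hq₀, hlt⟩ := h
  rcases le_total q₀ q with hq' | hq'
  · exact key₂ p₀ p q (h₀.trans_le hq') hpq hp₀ hp hq
      (key₁ p₀ q₀ q h₀ (h₀.trans_le hq') hp₀ hq₀ hq hlt)
  · exact key₁ p q₀ q (hpq.trans_le hq') hpq hp hq₀ hq
      (key₂ p₀ p q₀ h₀ (hpq.trans_le hq') hp₀ hp hq₀ hlt)

theorem RightOf.exists_adjacent {n : ℕ} {σ : Equiv.Perm (Fin n)} {B : Finset (Fin n)}
    (h : RightOf σ B) : ∃ k : Fin (n - 1), σ (lo k) ∉ B ∧ σ (hi k) ∈ B := by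
  obtain ⟨p, q, hpq, hp, hq, -⟩ := h
  by_contra hc
  push Not at hc
  have : ∀ m (hm : m < n), p.val ≤ m → σ ⟨m, hm⟩ ∉ B := by
    intro m hm hpm
    induction m, hpm using Nat.le_induction with
    | base => exact hp
    | succ m hpm ih => exact hc ⟨m, by omega⟩ (ih (by omega))
  exact this q.val q.isLt hpq.le hq

/-- The exchange of x = `σ (lo k)` with y = `σ (hi k)` creates only one new initial segment, P ∪
{y}, where P consists of the first k letters. A member `C` crosses neither P nor P ∪ {x, y}. Hence a
crossing of `C` with P ∪ {y} must use both x and y, with x in `C` and y outside; its third element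
shows that `C` is to the right of `σ`. -/
theorem blocker {n : ℕ} {S : Set (Finset (Fin n))} (hS : Separated S)
    {σ : Equiv.Perm (Fin n)} (hσ : σ ∈ chainDomain S) {k : Fin (n - 1)}
    (hk : σ (lo k) < σ (hi k)) {C : Finset (Fin n)} (hC : C ∈ S)
    (h : Crosses (insert (σ (hi k)) (prefixSet σ k.val)) C ∨
      Crosses C (insert (σ (hi k)) (prefixSet σ k.val))) :
    RightOf σ C ∧ σ (lo k) ∈ C ∧ σ (hi k) ∉ C := by
  have e₁ := prefixSet_succ σ (lo k)
  have e₂ := prefixSet_succ σ (hi k)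
  rw [lo_val] at e₁
  rw [hi_val, e₁] at e₂
  have c₀ := hσ k.val
  have c₂ := hσ (k.val + 1 + 1)
  rw [e₂] at c₂
  have nlo := apply_notMem_prefixSet σ (lo k)
  have n2 := (lo_ne_hi k)
  have nhi : σ (hi k) ∉ prefixSet σ k.val := by rw [mem_prefixSet]; simp
  rw [lo_val] at nlo
  have hne : σ (lo k) ≠ σ (hi k) := hk.ne
  rcases h with ⟨i, j, l, hij, hjl, ⟨hj, hj'⟩, ⟨hi', hi''⟩, hl, hl'⟩ |
    ⟨i, j, l, hij, hjl, ⟨hj, hj'⟩, ⟨hi', hi''⟩, hl, hl'⟩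
  -- The middle element is y, or else P would cross `C`; the smallest is x, or else P ∪ {x, y}
  -- would. The largest lies beyond position k + 1 and is the later letter for `RightOf`.
  · have hjy : j = σ (hi k) := by
      by_contra hjy
      refine hS _ c₀ _ hC ⟨i, j, l, hij, hjl, ⟨?_, hj'⟩, ⟨?_, hi''⟩, ?_, hl'⟩
      · exact Finset.mem_of_mem_insert_of_ne hj hjy
      · exact fun h => hi' (Finset.mem_insert_of_mem h)
      · exact fun h => hl (Finset.mem_insert_of_mem h)
    subst hjy
    have hix : i = σ (lo k) := by
      by_contra hix
      have hlx : l ≠ σ (lo k) := by rintro rfl; exact hjl.asymm hk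
      refine hS _ c₂ _ hC ⟨i, _, l, hij, hjl, ⟨Finset.mem_insert_self _ _, hj'⟩, ⟨?_, hi''⟩, ?_, hl'⟩
      · rw [Finset.mem_insert, Finset.mem_insert] at *; tauto
      · rw [Finset.mem_insert, Finset.mem_insert] at *; tauto
    subst hix
    refine ⟨⟨hi k, σ.symm l, ?_, hj', by simpa using hl', by simpa using hjl⟩, hi'', hj'⟩
    have hl2 : l ∉ prefixSet σ (k.val + 1 + 1) := by
      rw [e₂, Finset.mem_insert, Finset.mem_insert]
      rintro (rfl | rfl | h)
      · exact lt_irrefl _ hjl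
      · exact hjl.asymm hk
      · exact hl (Finset.mem_insert_of_mem h)
    rw [mem_prefixSet] at hl2
    rw [Fin.lt_def, hi_val]
    have : (σ.symm l).val ≠ k.val + 1 := by
      intro h
      have : l = σ (hi k) := by rw [← Equiv.symm_apply_eq]; exact Fin.ext h
      exact hjl.ne' this
    omega
  -- The middle element is x, or else `C` would cross P ∪ {x, y}; the largest is y, or else `C`
  -- would cross P. The smallest belongs to P and is the earlier letter for `RightOf`.
  · have hjx : j = σ (lo k) := by
      by_contra hjx
      refine hS _ hC _ c₂ ⟨i, j, l, hij, hjl, ⟨hj, ?_⟩, ⟨hi', ?_⟩, hl, ?_⟩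
      · rw [Finset.mem_insert, Finset.mem_insert] at *; tauto
      · rw [Finset.mem_insert, Finset.mem_insert] at *; tauto
      · rw [Finset.mem_insert, Finset.mem_insert] at *; tauto
    subst hjx
    have hly : l = σ (hi k) := by
      by_contra hly
      have hiy : i ≠ σ (hi k) := by rintro rfl; exact hij.asymm hk
      exact hS _ hC _ c₀ ⟨i, _, l, hij, hjl, ⟨hj, nlo⟩,
        ⟨hi', Finset.mem_of_mem_insert_of_ne hi'' hiy⟩, hl, Finset.mem_of_mem_insert_of_ne hl' hly⟩
    subst hly
    have hiy : i ≠ σ (hi k) := by rintro rfl; exact hij.asymm hk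
    have hi2 := Finset.mem_of_mem_insert_of_ne hi'' hiy
    rw [mem_prefixSet] at hi2
    exact ⟨⟨σ.symm i, lo k, by rw [Fin.lt_def, lo_val]; exact hi2, by simpa using hi', hj,
      by simpa using hij⟩, hj, hl⟩

/-- If no member of the system is to the right of `σ`, nothing blocks any ascent. Otherwise, an
ascent that leads towards the colexicographically smallest member to the right of `σ` works: a set
blocking it would be smaller still. -/
theorem exists_ascent_mem_chainDomain {n : ℕ} {S : Set (Finset (Fin n))} (hS : Separated S)
    (hmax : CrossClosed S) {σ : Equiv.Perm (Fin n)} (hσ : σ ∈ chainDomain S)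
    (hne : σ ≠ omegaOrder n) :
    ∃ k : Fin (n - 1), σ (lo k) < σ (hi k) ∧ σ * adjSwap k ∈ chainDomain S := by
  have key : ∃ k : Fin (n - 1), σ (lo k) < σ (hi k) ∧
      ∀ C ∈ S, RightOf σ C → σ (lo k) ∈ C → σ (hi k) ∉ C → False := by
    by_cases h : ∃ B ∈ S, RightOf σ B
    · obtain ⟨B, ⟨hB, hr⟩, hmin⟩ := Set.exists_min_image {B | B ∈ S ∧ RightOf σ B}
        (fun B => toColex B) (Set.toFinite _) h
      obtain ⟨k, hk, hk'⟩ := hr.exists_adjacent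
      have hlt : σ (lo k) < σ (hi k) :=
        hr.lt hS hσ hB (by rw [Fin.lt_def]; simp) hk hk'
      refine ⟨k, hlt, fun C hC hrC h₁ h₂ => ?_⟩
      refine not_lt.2 (hmin C ⟨hC, hrC⟩) ?_
      change toColex C < toColex B
      -- With x, y the letters of the ascent, `B` contains y but not x, while `C` contains x but not
      -- y. An element a > y of `C \ B` would make `B` cross `C` through x < y < a, so y exceeds all
      -- of `C \ B` and `C` precedes `B`.
      rw [Finset.Colex.toColex_lt_toColex]
      refine ⟨fun e => h₂ (e ▸ hk'), fun a ha ha' => ⟨σ (hi k), hk', h₂, ?_⟩⟩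
      by_contra hc
      exact hS B hB C hC ⟨σ (lo k), σ (hi k), a, hlt, not_le.1 hc, ⟨hk', h₂⟩, ⟨hk, h₁⟩, ha', ha⟩
    · obtain ⟨k, hk⟩ := exists_ascent hne
      exact ⟨k, hk, fun C hC hr _ _ => h ⟨C, hC, hr⟩⟩
  obtain ⟨k, hk, hb⟩ := key
  refine ⟨k, hk, fun m => ?_⟩
  by_cases hm : m = k.val + 1
  · rw [hm, prefixSet_mul_adjSwap_succ]
    refine hmax _ fun C hC => ⟨fun h => ?_, fun h => ?_⟩
    · obtain ⟨h₁, h₂, h₃⟩ := blocker hS hσ hk hC (Or.inl h)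
      exact hb C hC h₁ h₂ h₃
    · obtain ⟨h₁, h₂, h₃⟩ := blocker hS hσ hk hC (Or.inr h)
      exact hb C hC h₁ h₂ h₃
  · rw [prefixSet_mul_adjSwap σ hm]; exact hσ m

/-- The mirror image of `exists_ascent_mem_chainDomain`: reversing the numbering of the alternatives
preserves crossings, turns descents into ascents and exchanges `α` with `ω`. -/
theorem exists_descent_mem_chainDomain {n : ℕ} {S : Set (Finset (Fin n))} (hS : Separated S)
    (hmax : CrossClosed S) {σ : Equiv.Perm (Fin n)} (hσ : σ ∈ chainDomain S)
    (hne : σ ≠ 1) :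
    ∃ k : Fin (n - 1), σ (hi k) < σ (lo k) ∧ σ * adjSwap k ∈ chainDomain S := by
  let f : Finset (Fin n) → Finset (Fin n) := fun A => A.image Fin.rev
  have hf : ∀ A x, x ∈ f A ↔ Fin.rev x ∈ A := by
    intro A x
    simp only [f, Finset.mem_image]
    constructor
    · rintro ⟨y, hy, rfl⟩; simpa using hy
    · intro h; exact ⟨_, h, Fin.rev_rev x⟩
  have hff : ∀ A, f (f A) = A := by intro A; ext x; simp [hf]
  have hcr : ∀ A B, Crosses (f A) (f B) → Crosses A B := by
    rintro A B ⟨i, j, k, hij, hjk, h⟩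
    simp only [hf] at h
    exact ⟨k.rev, j.rev, i.rev, Fin.rev_lt_rev.2 hjk, Fin.rev_lt_rev.2 hij, h.1, h.2.2, h.2.1⟩
  have hpre : ∀ (τ : Equiv.Perm (Fin n)) m,
      prefixSet (omegaOrder n * τ) m = f (prefixSet τ m) := by
    intro τ m
    ext x
    rw [mem_prefixSet, hf, mem_prefixSet]
    rfl
  obtain ⟨k, hk, hk'⟩ := exists_ascent_mem_chainDomain (S := {A | f A ∈ S})
    (σ := omegaOrder n * σ)
    (fun A hA B hB h => hS _ hA _ hB (hcr _ _ (by rwa [hff, hff])))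
    (fun A hA => hmax _ fun B hB => by
      have := hA (f B) (by rw [Set.mem_ofPred_eq, hff]; exact hB)
      exact ⟨fun h => this.1 (hcr _ _ (by rwa [hff])), fun h => this.2 (hcr _ _ (by rwa [hff]))⟩)
    (fun m => by rw [hpre, Set.mem_ofPred_eq, hff]; exact hσ m)
    (fun h => hne (by simpa using h))
  refine ⟨k, ?_, fun m => ?_⟩
  · simpa [omegaOrder] using hk
  · have := hk' m
    rw [mul_assoc, hpre, Set.mem_ofPred_eq, hff] at this
    exact this

/-! ### Ascending words -/

/-- Starting from `σ`, the word `w` only exchanges ascents, and it stays in `D`. -/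
def AscendsIn {n : ℕ} (D : Set (Equiv.Perm (Fin n))) :
    Equiv.Perm (Fin n) → List (Fin (n - 1)) → Prop
  | σ, [] => σ ∈ D
  | σ, k :: w => σ ∈ D ∧ σ (lo k) < σ (hi k) ∧ AscendsIn D (σ * adjSwap k) w

theorem wordProd_nil {n : ℕ} : wordProd ([] : List (Fin (n - 1))) = 1 := rfl

theorem wordProd_cons {n : ℕ} (k : Fin (n - 1)) (w : List (Fin (n - 1))) :
    wordProd (k :: w) = adjSwap k * wordProd w := by simp [wordProd]

theorem wordProd_append {n : ℕ} (u v : List (Fin (n - 1))) :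
    wordProd (u ++ v) = wordProd u * wordProd v := by simp [wordProd]

theorem mul_wordProd_cons {n : ℕ} (σ : Equiv.Perm (Fin n)) (k : Fin (n - 1))
    (w : List (Fin (n - 1))) : σ * wordProd (k :: w) = σ * adjSwap k * wordProd w := by
  rw [wordProd_cons, mul_assoc]

theorem AscendsIn.mem {n : ℕ} {D : Set (Equiv.Perm (Fin n))} {σ : Equiv.Perm (Fin n)}
    {w : List (Fin (n - 1))} (h : AscendsIn D σ w) : σ ∈ D := by
  cases w with
  | nil => exact h
  | cons k w => exact h.1

theorem AscendsIn.mono {n : ℕ} {D D' : Set (Equiv.Perm (Fin n))} (hD : D ⊆ D')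
    {σ : Equiv.Perm (Fin n)} {w : List (Fin (n - 1))} (h : AscendsIn D σ w) :
    AscendsIn D' σ w := by
  induction w generalizing σ with
  | nil => exact hD h
  | cons k w ih => exact ⟨hD h.1, h.2.1, ih h.2.2⟩

theorem ascendsIn_append {n : ℕ} {D : Set (Equiv.Perm (Fin n))} {σ : Equiv.Perm (Fin n)}
    {u v : List (Fin (n - 1))} :
    AscendsIn D σ (u ++ v) ↔ AscendsIn D σ u ∧ AscendsIn D (σ * wordProd u) v := by
  induction u generalizing σ with
  | nil =>
    simp only [List.nil_append, wordProd_nil, mul_one]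
    exact ⟨fun h => ⟨h.mem, h⟩, fun h => h.2⟩
  | cons k u ih =>
    simp only [List.cons_append, AscendsIn, ih, mul_wordProd_cons, and_assoc]

theorem AscendsIn.mem_of_prefix {n : ℕ} {D : Set (Equiv.Perm (Fin n))} {σ : Equiv.Perm (Fin n)}
    {u w : List (Fin (n - 1))} (h : AscendsIn D σ w) (hu : u <+: w) : σ * wordProd u ∈ D := by
  obtain ⟨v, rfl⟩ := hu
  exact (ascendsIn_append.1 h).2.mem

theorem AscendsIn.ncard_Inv {n : ℕ} {D : Set (Equiv.Perm (Fin n))} {σ : Equiv.Perm (Fin n)}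
    {w : List (Fin (n - 1))} (h : AscendsIn D σ w) :
    (Inv (σ * wordProd w)).ncard = (Inv σ).ncard + w.length := by
  induction w generalizing σ with
  | nil => simp [wordProd_nil]
  | cons k w ih =>
    rw [mul_wordProd_cons, ih h.2.2, ncard_Inv_mul_adjSwap h.2.1, List.length_cons]
    omega

theorem AscendsIn.Inv_subset {n : ℕ} {D : Set (Equiv.Perm (Fin n))} {σ : Equiv.Perm (Fin n)}
    {w : List (Fin (n - 1))} (h : AscendsIn D σ w) : Inv σ ⊆ Inv (σ * wordProd w) := by
  induction w generalizing σ with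
  | nil => simp [wordProd_nil]
  | cons k w ih =>
    rw [mul_wordProd_cons]
    refine subset_trans ?_ (ih h.2.2)
    rw [Inv_mul_adjSwap h.2.1]
    exact Set.subset_insert _ _

theorem ascendsIn_of_forall_prefix {n : ℕ} {D : Set (Equiv.Perm (Fin n))}
    {σ : Equiv.Perm (Fin n)} {w : List (Fin (n - 1))} (h : AscendsIn Set.univ σ w)
    (hD : ∀ u, u <+: w → σ * wordProd u ∈ D) : AscendsIn D σ w := by
  induction w generalizing σ with
  | nil => simpa [wordProd_nil, AscendsIn] using hD [] (List.prefix_refl _)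
  | cons k w ih =>
    refine ⟨by simpa [wordProd_nil] using hD [] (List.nil_prefix), h.2.1, ih h.2.2 fun u hu => ?_⟩
    rw [← mul_wordProd_cons]
    exact hD _ ((List.prefix_cons_inj k).2 hu)

/-- Every letter changes the number of inversions by one, up or down. The length is therefore
attained only if every letter exchanges an ascent. -/
theorem ncard_Inv_le_of_word {n : ℕ} (σ : Equiv.Perm (Fin n)) (w : List (Fin (n - 1))) :
    (Inv (σ * wordProd w)).ncard ≤ (Inv σ).ncard + w.length ∧
      ((Inv σ).ncard + w.length ≤ (Inv (σ * wordProd w)).ncard → AscendsIn Set.univ σ w) := by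
  induction w generalizing σ with
  | nil => simp [wordProd_nil, AscendsIn]
  | cons k w ih =>
    obtain ⟨h₁, h₂⟩ := ih (σ * adjSwap k)
    rw [mul_wordProd_cons, List.length_cons]
    by_cases hk : σ (lo k) < σ (hi k)
    · rw [ncard_Inv_mul_adjSwap hk] at h₁ h₂
      exact ⟨by omega, fun h => ⟨trivial, hk, h₂ (by omega)⟩⟩
    · have hk' : (σ * adjSwap k) (lo k) < (σ * adjSwap k) (hi k) := by
        simp only [Equiv.Perm.mul_apply, adjSwap_lo, adjSwap_hi]
        exact lt_of_le_of_ne (not_lt.1 hk) fun e => lo_ne_hi k (σ.injective e).symm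
      have := ncard_Inv_mul_adjSwap hk'
      rw [mul_adjSwap_mul_adjSwap] at this
      exact ⟨by omega, fun h => by omega⟩

/-- The reduced decompositions of `ω` are the ascending words from `α` to `ω`. -/
theorem isReducedWordOfOmega_iff {n : ℕ} {w : List (Fin (n - 1))} :
    IsReducedWordOfOmega w ↔ AscendsIn Set.univ 1 w ∧ wordProd w = omegaOrder n := by
  constructor
  · rintro ⟨h₁, h₂⟩
    refine ⟨(ncard_Inv_le_of_word 1 w).2 ?_, h₁⟩
    rw [one_mul, h₁, ncard_Inv_omega, h₂, Inv_one]
    simp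
  · rintro ⟨h₁, h₂⟩
    refine ⟨h₂, ?_⟩
    have := h₁.ncard_Inv
    rw [one_mul, h₂, ncard_Inv_omega, Inv_one] at this
    simpa using this.symm

theorem exists_ascendsIn_to_omega {n : ℕ} {D : Set (Equiv.Perm (Fin n))}
    (hD : ∀ σ ∈ D, σ ≠ omegaOrder n → ∃ k, σ (lo k) < σ (hi k) ∧ σ * adjSwap k ∈ D)
    {σ : Equiv.Perm (Fin n)} (hσ : σ ∈ D) :
    ∃ w, AscendsIn D σ w ∧ σ * wordProd w = omegaOrder n := by
  -- `N` bounds the number of inversions that are still missing; each exchange supplies one of them.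
  obtain ⟨N, hN⟩ : ∃ N, (Inv (omegaOrder n)).ncard ≤ (Inv σ).ncard + N :=
    ⟨_, Nat.le_add_left _ _⟩
  induction N generalizing σ with
  | zero =>
    by_cases hne : σ = omegaOrder n
    · exact ⟨[], hσ, by rw [wordProd_nil, mul_one, hne]⟩
    · obtain ⟨k, hk, -⟩ := hD σ hσ hne
      have h₁ := ncard_Inv_mul_adjSwap hk
      have h₂ := Set.ncard_le_ncard (Inv_subset_omega (σ * adjSwap k)) (Set.toFinite _)
      omega
  | succ N ih =>
    by_cases hne : σ = omegaOrder n
    · exact ⟨[], hσ, by rw [wordProd_nil, mul_one, hne]⟩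
    · obtain ⟨k, hk, hk'⟩ := hD σ hσ hne
      obtain ⟨w, hw, hw'⟩ := ih hk' (by rw [ncard_Inv_mul_adjSwap hk]; omega)
      exact ⟨k :: w, ⟨hσ, hk, hw⟩, by rw [mul_wordProd_cons, hw']⟩

theorem exists_ascendsIn_from_one {n : ℕ} {D : Set (Equiv.Perm (Fin n))}
    (hD : ∀ σ ∈ D, σ ≠ 1 → ∃ k, σ (hi k) < σ (lo k) ∧ σ * adjSwap k ∈ D)
    {σ : Equiv.Perm (Fin n)} (hσ : σ ∈ D) :
    ∃ w, AscendsIn D 1 w ∧ wordProd w = σ := by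
  obtain ⟨N, hN⟩ : ∃ N, N = (Inv σ).ncard := ⟨_, rfl⟩
  induction N using Nat.strong_induction_on generalizing σ with
  | _ N ih =>
    by_cases hne : σ = 1
    · exact ⟨[], hne ▸ hσ, by rw [wordProd_nil, hne]⟩
    · obtain ⟨k, hk, hk'⟩ := hD σ hσ hne
      have hasc : (σ * adjSwap k) (lo k) < (σ * adjSwap k) (hi k) := by simpa using hk
      have hc := ncard_Inv_mul_adjSwap hasc
      rw [mul_adjSwap_mul_adjSwap] at hc
      obtain ⟨w, hw, hw'⟩ := ih _ (by omega) hk' rfl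
      refine ⟨w ++ [k], ascendsIn_append.2 ⟨hw, ?_⟩, ?_⟩
      · rw [one_mul, hw']
        refine ⟨hk', hasc, ?_⟩
        rw [mul_adjSwap_mul_adjSwap]; exact hσ
      · rw [wordProd_append, hw', wordProd_cons, wordProd_nil, mul_one, mul_adjSwap_mul_adjSwap]

/-! ### Commutation classes -/

theorem CommutationStep.symm {n : ℕ} {w w' : List (Fin (n - 1))} (h : CommutationStep w w') :
    CommutationStep w' w := by
  obtain ⟨u, v, i, j, hij, rfl, rfl⟩ := h
  exact ⟨u, v, j, i, hij.symm, rfl, rfl⟩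

theorem CommutationStep.cons {n : ℕ} {w w' : List (Fin (n - 1))} (h : CommutationStep w w')
    (k : Fin (n - 1)) : CommutationStep (k :: w) (k :: w') := by
  obtain ⟨u, v, i, j, hij, rfl, rfl⟩ := h
  exact ⟨k :: u, v, i, j, hij, rfl, rfl⟩

theorem commutation_symm {n : ℕ} {w w' : List (Fin (n - 1))}
    (h : Relation.ReflTransGen CommutationStep w w') :
    Relation.ReflTransGen CommutationStep w' w := by
  induction h with
  | refl => exact .refl
  | tail _ h ih => exact .head h.symm ih

theorem commutation_cons {n : ℕ} {w w' : List (Fin (n - 1))}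
    (h : Relation.ReflTransGen CommutationStep w w') (k : Fin (n - 1)) :
    Relation.ReflTransGen CommutationStep (k :: w) (k :: w') := by
  induction h with
  | refl => exact .refl
  | tail _ h ih => exact .tail ih (h.cons k)

theorem mul_adjSwap_lo_of_far {n : ℕ} {a b : Fin (n - 1)} (σ : Equiv.Perm (Fin n))
    (h : a.val + 1 < b.val ∨ b.val + 1 < a.val) :
    (σ * adjSwap a) (lo b) = σ (lo b) ∧ (σ * adjSwap a) (hi b) = σ (hi b) := by
  simp only [Equiv.Perm.mul_apply]
  constructor <;> rw [adjSwap_of_ne] <;> simp only [lo_val, hi_val] <;> omega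

/-- Exchanges at distant positions change different initial segments, so each initial segment after
both exchanges already occurs after one of them. -/
theorem mul_adjSwap_mem_of_far {n : ℕ} {S : Set (Finset (Fin n))} {σ : Equiv.Perm (Fin n)}
    {a b : Fin (n - 1)} (h : a.val + 1 < b.val ∨ b.val + 1 < a.val)
    (ha : σ * adjSwap a ∈ chainDomain S) (hb : σ * adjSwap b ∈ chainDomain S) :
    σ * adjSwap a * adjSwap b ∈ chainDomain S := by
  intro m
  by_cases hm : m = b.val + 1
  · rw [mul_assoc, adjSwap_comm h, ← mul_assoc, prefixSet_mul_adjSwap _ (by omega)]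
    exact hb m
  · rw [prefixSet_mul_adjSwap _ hm]
    exact ha m

/-- The only new order is the other middle corner of a diamond. Each of its initial segments occurs
at the start or at the end of the diamond, so a whole commutation class stays in `chainDomain S` as
soon as one of its words does. -/
theorem AscendsIn.commutationStep {n : ℕ} {S : Set (Finset (Fin n))} {σ : Equiv.Perm (Fin n)}
    {w w' : List (Fin (n - 1))} (h : AscendsIn (chainDomain S) σ w)
    (hs : CommutationStep w w') :
    AscendsIn (chainDomain S) σ w' ∧ wordProd w' = wordProd w := by
  obtain ⟨u, v, i, j, hij, rfl, rfl⟩ := hs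
  have hp : adjSwap j * adjSwap i = adjSwap i * adjSwap j := adjSwap_comm hij.symm
  constructor
  · rw [ascendsIn_append] at h ⊢
    refine ⟨h.1, ?_⟩
    obtain ⟨-, h₀, h₁, h₂, h₃, h₄⟩ := h
    set τ := σ * wordProd u
    have hf := mul_adjSwap_lo_of_far τ hij
    have hf' := mul_adjSwap_lo_of_far τ hij.symm
    rw [hf.1, hf.2] at h₃
    have e : τ * adjSwap j * adjSwap i = τ * adjSwap i * adjSwap j := by
      rw [mul_assoc, hp, ← mul_assoc]
    refine ⟨h₀, h₃, ?_, by rw [hf'.1, hf'.2]; exact h₁, by rw [e]; exact h₄⟩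
    intro m
    by_cases hm : m = j.val + 1
    · have := h₄.mem m
      rwa [← e, prefixSet_mul_adjSwap _ (by omega)] at this
    · rw [prefixSet_mul_adjSwap _ hm]; exact h₀ m
  · simp only [wordProd_append, wordProd_cons]
    rw [← mul_assoc (adjSwap j), hp, mul_assoc]

theorem AscendsIn.commutation {n : ℕ} {S : Set (Finset (Fin n))} {σ : Equiv.Perm (Fin n)}
    {w w' : List (Fin (n - 1))} (h : AscendsIn (chainDomain S) σ w)
    (hs : Relation.ReflTransGen CommutationStep w w') :
    AscendsIn (chainDomain S) σ w' ∧ wordProd w' = wordProd w := by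
  induction hs with
  | refl => exact ⟨h, rfl⟩
  | tail _ hs ih =>
    obtain ⟨h₁, h₂⟩ := ih.1.commutationStep hs
    exact ⟨h₁, h₂.trans ih.2⟩

/-- Two ascents that can both be exchanged within a separated system are far from each other. -/
theorem far_of_mem_chainDomain {n : ℕ} {S : Set (Finset (Fin n))} (hS : Separated S)
    {σ : Equiv.Perm (Fin n)} {a b : Fin (n - 1)} (hab : a ≠ b)
    (ha : σ (lo a) < σ (hi a)) (hb : σ (lo b) < σ (hi b))
    (ha' : σ * adjSwap a ∈ chainDomain S) (hb' : σ * adjSwap b ∈ chainDomain S) :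
    a.val + 1 < b.val ∨ b.val + 1 < a.val := by
  have key : ∀ {a b : Fin (n - 1)}, σ (lo a) < σ (hi a) → σ (lo b) < σ (hi b) →
      σ * adjSwap a ∈ chainDomain S → σ * adjSwap b ∈ chainDomain S → b.val ≠ a.val + 1 := by
    intro a b ha hb ha' hb' e
    have hlo : lo b = hi a := Fin.ext e
    rw [hlo] at hb
    -- For consecutive letters x < y < z after the initial segment P, the two exchanges produce P ∪
    -- {y} and P ∪ {x, z}, which cross.
    refine hS _ (ha' (a.val + 1)) _ (hb' (b.val + 1)) ⟨_, _, _, ha, hb, ?_⟩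
    simp only [mem_prefixSet, mul_adjSwap_symm_apply, Equiv.symm_apply_apply, adjSwap_val,
      lo_val, hi_val, e]
    simp
    split_ifs <;> omega
  have h₁ := key ha hb ha' hb'
  have h₂ := key hb ha hb' ha'
  have h₃ : a.val ≠ b.val := fun e => hab (Fin.ext e)
  omega

/-- Ascending words from `σ` to `ω` within a maximal separated system are equivalent. -/
theorem commutation_of_ascendsIn {n : ℕ} {S : Set (Finset (Fin n))} (hS : Separated S)
    (hmax : CrossClosed S) {σ : Equiv.Perm (Fin n)} {w v : List (Fin (n - 1))}
    (hw : AscendsIn (chainDomain S) σ w) (hv : AscendsIn (chainDomain S) σ v)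
    (hwω : σ * wordProd w = omegaOrder n) (hvω : σ * wordProd v = omegaOrder n) :
    Relation.ReflTransGen CommutationStep w v := by
  obtain ⟨N, hN⟩ : ∃ N, N = w.length := ⟨_, rfl⟩
  induction N generalizing σ w v with
  | zero =>
    obtain rfl := List.eq_nil_of_length_eq_zero hN.symm
    have h₁ := hw.ncard_Inv
    have h₂ := hv.ncard_Inv
    rw [hwω] at h₁
    rw [hvω] at h₂
    obtain rfl : v = [] := List.eq_nil_of_length_eq_zero (by simp at h₁; omega)
    exact .refl
  | succ N ih =>
    have hlen : v.length = w.length := by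
      have h₁ := hw.ncard_Inv
      have h₂ := hv.ncard_Inv
      rw [hwω] at h₁
      rw [hvω] at h₂
      omega
    cases w with
    | nil => simp at hN
    | cons a w =>
    cases v with
    | nil => simp at hlen
    | cons b v =>
    simp only [List.length_cons, Nat.add_right_cancel_iff] at hN hlen
    rw [mul_wordProd_cons] at hwω hvω
    by_cases hab : a = b
    · subst hab
      exact commutation_cons (ih hw.2.2 hv.2.2 hwω hvω hN) a
    -- The diamond: both exchanges can be made, and some word `u` leads from their common result to
    -- `ω`. By induction aw ~ abu and bv ~ bau, and abu ~ bau is a single commutation.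
    · have hfar := far_of_mem_chainDomain hS hab hw.2.1 hv.2.1 hw.2.2.mem hv.2.2.mem
      have hτ := mul_adjSwap_mem_of_far hfar hw.2.2.mem hv.2.2.mem
      have e : σ * adjSwap b * adjSwap a = σ * adjSwap a * adjSwap b := by
        rw [mul_assoc, adjSwap_comm hfar.symm, ← mul_assoc]
      obtain ⟨u, hu, huω⟩ := exists_ascendsIn_to_omega
        (fun σ hσ hne => exists_ascent_mem_chainDomain hS hmax hσ hne) hτ
      have hfa := mul_adjSwap_lo_of_far σ hfar
      have hfb := mul_adjSwap_lo_of_far σ hfar.symm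
      have h₁ : AscendsIn (chainDomain S) (σ * adjSwap a) (b :: u) :=
        ⟨hw.2.2.mem, by rw [hfa.1, hfa.2]; exact hv.2.1, hu⟩
      have h₂ : AscendsIn (chainDomain S) (σ * adjSwap b) (a :: u) :=
        ⟨hv.2.2.mem, by rw [hfb.1, hfb.2]; exact hw.2.1, by rw [e]; exact hu⟩
      have r₁ := ih hw.2.2 h₁ hwω (by rw [mul_wordProd_cons, huω]) hN
      have r₂ := ih hv.2.2 h₂ hvω (by rw [mul_wordProd_cons, e, huω]) (by omega)
      refine (commutation_cons r₁ a).trans (.trans (.single ?_) (commutation_symm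
        (commutation_cons r₂ b)))
      exact ⟨[], u, a, b, hfar, rfl, rfl⟩

/-- The chains of a maximal separated system form a Galambos-Reiner domain. -/
theorem exists_word_of_crossClosed {n : ℕ} {S : Set (Finset (Fin n))} (hS : Separated S)
    (hmax : CrossClosed S) (h1 : 1 ∈ chainDomain S) :
    ∃ w, AscendsIn (chainDomain S) 1 w ∧ wordProd w = omegaOrder n ∧
      ∀ σ ∈ chainDomain S, ∃ u v, Relation.ReflTransGen CommutationStep w (u ++ v) ∧
        σ = wordProd u := by
  obtain ⟨w, hw, hwω⟩ := exists_ascendsIn_to_omega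
    (fun σ hσ hne => exists_ascent_mem_chainDomain hS hmax hσ hne) h1
  rw [one_mul] at hwω
  refine ⟨w, hw, hwω, fun σ hσ => ?_⟩
  obtain ⟨u, hu, hu'⟩ := exists_ascendsIn_from_one
    (fun σ hσ hne => exists_descent_mem_chainDomain hS hmax hσ hne) hσ
  obtain ⟨v, hv, hv'⟩ := exists_ascendsIn_to_omega
    (fun σ hσ hne => exists_ascent_mem_chainDomain hS hmax hσ hne) hσ
  refine ⟨u, v, ?_, hu'.symm⟩
  refine commutation_of_ascendsIn hS hmax hw (ascendsIn_append.2 ⟨hu, ?_⟩) (by rw [one_mul, hwω]) ?_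
  · rw [one_mul, hu']; exact hv
  · rw [one_mul, wordProd_append, hu', hv']

/-- Every peak-pit Condorcet domain is contained in a maximal separated system. -/
theorem IsPeakPit.exists_word {n : ℕ} {D : Set (Equiv.Perm (Fin n))} (h : IsPeakPit D)
    (hα : alphaOrder n ∈ D) :
    ∃ w, IsReducedWordOfOmega w ∧
      ∀ σ ∈ D, ∃ u v, Relation.ReflTransGen CommutationStep w (u ++ v) ∧ σ = wordProd u := by
  obtain ⟨S, hS, hsep, hmax⟩ := exists_crossClosed (separated_segmentSets h)
  have hD : D ⊆ chainDomain S :=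
    (subset_chainDomain_segmentSets D).trans (chainDomain_mono hS)
  obtain ⟨w, hw, hwω, hall⟩ := exists_word_of_crossClosed hsep hmax (hD hα)
  exact ⟨w, isReducedWordOfOmega_iff.2 ⟨hw.mono (Set.subset_univ _), hwω⟩,
    fun σ hσ => hall σ (hD hσ)⟩

/-! ### Galambos-Reiner domains and connected domains -/

/-- The initial segments of the orders of a reduced word are separated. -/
theorem IsReducedWordOfOmega.exists_separated {n : ℕ} {w : List (Fin (n - 1))}
    (h : IsReducedWordOfOmega w) :
    ∃ S, Separated S ∧ AscendsIn (chainDomain S) (1 : Equiv.Perm (Fin n)) w := by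
  have hw := (isReducedWordOfOmega_iff.1 h).1
  -- Along an ascending word the inversion sets increase, so the orders visited form a peak-pit set
  -- and their initial segments do not cross.
  let D : Set (Equiv.Perm (Fin n)) := {σ | ∃ u, u <+: w ∧ σ = wordProd u}
  have hD : IsPeakPit D := by
    have key : ∀ u v, u <+: v → v <+: w → Inv (wordProd u) ⊆ Inv (wordProd v) := by
      rintro u _ ⟨v, rfl⟩ ⟨x, rfl⟩
      rw [ascendsIn_append, ascendsIn_append, one_mul, one_mul] at hw
      rw [wordProd_append]
      exact hw.1.2.Inv_subset
    refine isPeakPit_of_Inv_nested ?_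
    rintro _ ⟨u, hu, rfl⟩ _ ⟨v, hv, rfl⟩
    exact (List.prefix_or_prefix_of_prefix hu hv).imp (fun h => key _ _ h hv)
      fun h => key _ _ h hu
  refine ⟨segmentSets D, separated_segmentSets hD, ascendsIn_of_forall_prefix hw fun u hu => ?_⟩
  exact subset_chainDomain_segmentSets D ⟨u, hu, one_mul _⟩

theorem grDomain_subset {n : ℕ} {S : Set (Finset (Fin n))} {w : List (Fin (n - 1))}
    (h : AscendsIn (chainDomain S) (1 : Equiv.Perm (Fin n)) w) : grDomain w ⊆ chainDomain S := by
  rintro _ ⟨w', hw', u, hu, rfl⟩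
  have := (h.commutation hw').1.mem_of_prefix hu
  rwa [one_mul] at this

theorem IsGRDomain.isPeakPit {n : ℕ} {D : Set (Equiv.Perm (Fin n))} (h : IsGRDomain D) :
    IsPeakPit D := by
  obtain ⟨w, hw, rfl⟩ := h
  obtain ⟨S, hS, hS'⟩ := hw.exists_separated
  exact (isPeakPit_chainDomain hS).mono (grDomain_subset hS')

theorem IsGRDomain.isCondorcetDomain {n : ℕ} {D : Set (Equiv.Perm (Fin n))} (h : IsGRDomain D) :
    IsCondorcetDomain D := by
  refine h.isPeakPit.isCondorcetDomain ?_ ?_ <;> obtain ⟨w, hw, rfl⟩ := h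
  · exact ⟨w, .refl, [], List.nil_prefix, rfl⟩
  · exact ⟨w, .refl, w, List.prefix_refl _, hw.1.symm⟩

theorem coveredBy_mul_adjSwap {n : ℕ} {σ : Equiv.Perm (Fin n)} {k : Fin (n - 1)}
    (h : σ (lo k) < σ (hi k)) : CoveredBy σ (σ * adjSwap k) :=
  ⟨_, notMem_Inv_of_ascent, Inv_mul_adjSwap h⟩

/-- Each member is the product of an initial segment of a word of the class, and the shorter
segments of that word join it to `α` by covering relations inside the domain. -/
theorem IsGRDomain.isConnectedDomain {n : ℕ} {D : Set (Equiv.Perm (Fin n))} (h : IsGRDomain D) :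
    IsConnectedDomain D := by
  have h1 : (1 : Equiv.Perm (Fin n)) ∈ D := h.isCondorcetDomain.1
  obtain ⟨w, hw, rfl⟩ := h
  obtain ⟨S, hS, hS'⟩ := hw.exists_separated
  have key : ∀ u (hu : wordProd u ∈ grDomain w), (∃ v, Relation.ReflTransGen CommutationStep w v ∧
      u <+: v) → ((bruhatGraph n).induce (grDomain w)).Reachable ⟨1, h1⟩ ⟨wordProd u, hu⟩ := by
    intro u
    induction u using List.reverseRecOn with
    | nil => intro _ _; exact SimpleGraph.Reachable.refl _
    | append_singleton u k ih =>
      rintro hu ⟨v, hv, huv⟩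
      have hpre : u <+: v := (List.prefix_append u [k]).trans huv
      have hmem : wordProd u ∈ grDomain w := ⟨v, hv, u, hpre, rfl⟩
      refine (ih hmem ⟨v, hv, hpre⟩).trans (SimpleGraph.Adj.reachable ?_)
      rw [SimpleGraph.induce_adj]
      change (bruhatGraph n).Adj (wordProd u) (wordProd (u ++ [k]))
      have ha := (hS'.commutation hv).1
      obtain ⟨x, rfl⟩ := huv
      rw [ascendsIn_append, ascendsIn_append, one_mul] at ha
      have hk := ha.1.2.2.1
      rw [wordProd_append, wordProd_cons, wordProd_nil, mul_one, bruhatGraph,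
        SimpleGraph.fromRel_adj]
      refine ⟨fun e => ?_, Or.inl (coveredBy_mul_adjSwap hk)⟩
      have := ncard_Inv_mul_adjSwap hk
      rw [← e] at this
      omega
  refine SimpleGraph.connected_iff_exists_forall_reachable _ |>.2 ⟨⟨1, h1⟩, ?_⟩
  rintro ⟨_, w', hw', u, hu, rfl⟩
  exact key u _ ⟨w', hw', hu⟩

/-- In a connected graph some edge changes a predicate that is not constant. -/
theorem exists_adj_of_reachable {V : Type*} {G : SimpleGraph V} {p : V → Prop} {a b : V}
    (h : G.Reachable a b) (ha : ¬ p a) (hb : p b) : ∃ x y, G.Adj x y ∧ ¬ p x ∧ p y := by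
  obtain ⟨q⟩ := h
  induction q with
  | nil => exact absurd hb ha
  | @cons u v _ huv _ ih =>
    by_cases hv : p v
    · exact ⟨u, v, huv, ha, hv⟩
    · exact ih hv hb

theorem not_isCyclic_of {n : ℕ} {D : Set (Equiv.Perm (Fin n))} (h : ¬ IsCyclic D)
    {i j k : Fin n} {ρ σ τ : Equiv.Perm (Fin n)} (hρ : ρ ∈ D) (hσ : σ ∈ D) (hτ : τ ∈ D)
    (h₁ : Below ρ i j) (h₂ : Below ρ j k) (h₃ : Below σ j k) (h₄ : Below σ k i)
    (h₅ : Below τ k i) (h₆ : Below τ i j) : False :=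
  h ⟨i, j, k, ρ, hρ, σ, hσ, τ, hτ, ⟨h₁, h₂⟩, ⟨h₃, h₄⟩, h₅, h₆⟩

/-- On a walk from `α` to `ω` inside `D` some edge inverts the pair (i, k) and no other pair. Hence
at both of its ends `j` is on the same side of `i` and `k`: the ends restrict either to jik and jki
or to ikj and kij. If `j` is worst there, an order in which `j` is best closes a cycle with one of
the ends and with `α` or `ω`; if `j` is best there, an order in which `j` is worst does. -/
theorem IsConnectedDomain.isPeakPit {n : ℕ} {D : Set (Equiv.Perm (Fin n))}
    (hc : IsCondorcetDomain D) (h : IsConnectedDomain D) : IsPeakPit D := by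
  obtain ⟨hα, hω, hcyc⟩ := hc
  refine isPeakPit_of_not_worst_best fun i j k hij hjk ρ hρ ρ' hρ' h₁ h₂ h₃ h₄ => ?_
  have hik := hij.trans hjk
  have hωb : ∀ {a b : Fin n}, a < b → Below (omegaOrder n) b a := fun hab =>
    (mem_Inv_omega.2 hab).2
  have tot : ∀ (σ : Equiv.Perm (Fin n)) {a b : Fin n}, a < b → (a, b) ∉ Inv σ →
      Below σ a b := by
    intro σ a b hab hn
    refine lt_of_le_of_ne (not_lt.1 fun h => hn ⟨hab, h⟩) fun e => ?_
    exact hab.ne (σ.symm.injective e)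
  obtain ⟨⟨x, hx⟩, ⟨y, hy⟩, hadj, hnx, hpy⟩ := exists_adj_of_reachable
    (p := fun z : D => (i, k) ∈ Inv z.1) (h.preconnected ⟨_, hα⟩ ⟨_, hω⟩)
    (by change _ ∉ Inv (1 : Equiv.Perm (Fin n)); rw [Inv_one]; exact Set.notMem_empty _)
    (mem_Inv_omega.2 hik)
  simp only at hnx hpy
  rw [SimpleGraph.induce_adj] at hadj
  change (bruhatGraph n).Adj x y at hadj
  rw [bruhatGraph, SimpleGraph.fromRel_adj] at hadj
  have hins : Inv y = insert (i, k) (Inv x) := by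
    rcases hadj.2 with ⟨q, -, hq⟩ | ⟨q, -, hq⟩
    · rw [hq] at hpy ⊢
      rcases hpy with rfl | hpy
      · rfl
      · exact absurd hpy hnx
    · rw [hq] at hnx; exact absurd (Set.mem_insert_of_mem _ hpy) hnx
  have hij' : (i, j) ∈ Inv y ↔ (i, j) ∈ Inv x := by
    rw [hins, Set.mem_insert_iff, Prod.mk.injEq]
    exact or_iff_right fun h => hjk.ne h.2
  have hjk' : (j, k) ∈ Inv y ↔ (j, k) ∈ Inv x := by
    rw [hins, Set.mem_insert_iff, Prod.mk.injEq]
    exact or_iff_right fun h => hij.ne' h.1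
  have hxik := tot x hik hnx
  have hyki : Below y k i := hpy.2
  -- Here x, y restrict to jik, jki. An order ikj is cyclic together with kji (`ω`) and jik, an
  -- order kij together with ijk (`α`) and jki. In the other case x, y restrict to ikj, kij and the
  -- roles of best and worst are interchanged.
  by_cases hjx : (i, j) ∈ Inv x
  · have hjxk : (j, k) ∉ Inv x := fun hjk2 =>
      lt_asymm hxik (lt_trans hjk2.2 hjx.2)
    have hy1 := hij'.2 hjx
    have hy2 := tot y hjk fun h => hjxk (hjk'.1 h)
    have hx2 := tot x hjk hjxk
    rcases lt_or_gt_of_ne (show ρ'.symm i ≠ ρ'.symm k from fun e => hik.ne (ρ'.symm.injective e))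
      with hc | hc
    · exact not_isCyclic_of hcyc hω hx hρ' (hωb hjk) (hωb hij) hjx.2 hxik hc h₄
    · exact not_isCyclic_of hcyc hα hy hρ' hij hjk hy2 hyki hc h₃
  · have hxj := tot x hij hjx
    have hjxk : (j, k) ∈ Inv x := by
      by_contra hjk2
      have hyj := tot y hij fun h => hjx (hij'.1 h)
      have hyk := tot y hjk fun h => hjk2 (hjk'.1 h)
      exact lt_asymm hyki (lt_trans hyj hyk)
    have hyj := tot y hij fun h => hjx (hij'.1 h)
    have hyk := hjk'.2 hjxk
    rcases lt_or_gt_of_ne (show ρ.symm i ≠ ρ.symm k from fun e => hik.ne (ρ.symm.injective e))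
      with hc | hc
    · exact not_isCyclic_of hcyc hω hρ hx (hωb hjk) (hωb hij) h₁ hc hxik hjxk.2
    · exact not_isCyclic_of hcyc hα hρ hy hij hjk h₂ hc hyki hyj

/-! ### The equivalence of the conjectures -/

theorem IsPeakPit.exists_grDomain {n : ℕ} {D : Set (Equiv.Perm (Fin n))} (h : IsPeakPit D)
    (hα : alphaOrder n ∈ D) : ∃ E, IsGRDomain E ∧ D ⊆ E := by
  obtain ⟨w, hw, hall⟩ := h.exists_word hα
  refine ⟨grDomain w, ⟨w, hw, rfl⟩, fun σ hσ => ?_⟩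
  obtain ⟨u, v, huv, rfl⟩ := hall σ hσ
  exact ⟨_, huv, u, List.prefix_append _ _, rfl⟩

theorem fishburn_iff_galambosReiner (n : ℕ) :
    FishburnConjecture n ↔ GalambosReinerConjecture n := by
  constructor
  · exact fun h D hD => h D hD.isCondorcetDomain hD.isPeakPit
  · intro h D hD hpp
    obtain ⟨E, hE, hDE⟩ := hpp.exists_grDomain hD.1
    exact (Set.ncard_le_ncard hDE (Set.toFinite _)).trans (h E hE)

theorem fishburn_iff_monjardet (n : ℕ) :
    FishburnConjecture n ↔ MonjardetConjecture n := by
  constructor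
  · exact fun h D hD hc => h D hD (hc.isPeakPit hD)
  · intro h D hD hpp
    obtain ⟨E, hE, hDE⟩ := hpp.exists_grDomain hD.1
    exact (Set.ncard_le_ncard hDE (Set.toFinite _)).trans
      (h E hE.isCondorcetDomain hE.isConnectedDomain)

/-! ### Slopes, heights and the paths of linear orders -/

/-- The inverse slope of a vector. -/
noncomputable def slope {n : ℕ} (ξ : Fin n → ℂ) (i : Fin n) : ℝ := (ξ i).re / (ξ i).im

/-- The real number `s` truncated to the interval `[0, y]`. -/
def clip (s y : ℝ) : ℝ := max 0 (min s y)

/-- The vertex of the path of `σ` after `m` steps. -/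
noncomputable def vertexAt {n : ℕ} (ξ : Fin n → ℂ) (σ : Equiv.Perm (Fin n)) (m : ℕ) : ℂ :=
  ∑ x ∈ prefixSet σ m, ξ x

/-- The abscissa at height `h` of the path of `σ`. -/
noncomputable def pathX {n : ℕ} (ξ : Fin n → ℂ) (σ : Equiv.Perm (Fin n)) (h : ℝ) : ℝ :=
  ∑ x, slope ξ x * clip (h - (vertexAt ξ σ (σ.symm x).val).im) (ξ x).im

/-- The abscissa at height `h` of the left border of a tile. -/
noncomputable def tileL {n : ℕ} (ξ : Fin n → ℂ) (t : Tile n) (h : ℝ) : ℝ :=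
  t.base.re + slope ξ t.i * clip (h - t.base.im) (ξ t.i).im +
    slope ξ t.j * clip (h - t.base.im - (ξ t.i).im) (ξ t.j).im

/-- The abscissa at height `h` of the right border of a tile. -/
noncomputable def tileR {n : ℕ} (ξ : Fin n → ℂ) (t : Tile n) (h : ℝ) : ℝ :=
  t.base.re + slope ξ t.j * clip (h - t.base.im) (ξ t.j).im +
    slope ξ t.i * clip (h - t.base.im - (ξ t.j).im) (ξ t.i).im

theorem clip_of_nonpos {s y : ℝ} (h : s ≤ 0) : clip s y = 0 := by
  rw [clip, max_eq_left]; exact (min_le_left _ _).trans h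

theorem clip_of_le {s y : ℝ} (hy : 0 ≤ y) (h : y ≤ s) : clip s y = y := by
  rw [clip, min_eq_right h, max_eq_right hy]

theorem clip_of_mem {s y : ℝ} (h₀ : 0 ≤ s) (h : s ≤ y) : clip s y = s := by
  rw [clip, min_eq_left h, max_eq_right h₀]

theorem clip_nonneg (s y : ℝ) : 0 ≤ clip s y := le_max_left _ _

theorem clip_le {s y : ℝ} (hy : 0 ≤ y) : clip s y ≤ y := max_le hy (min_le_right _ _)

theorem continuous_pathX {n : ℕ} (ξ : Fin n → ℂ) (σ : Equiv.Perm (Fin n)) :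
    Continuous (pathX ξ σ) := by
  unfold pathX clip; fun_prop

section Configuration

variable {n : ℕ} {ξ : Fin n → ℂ}

theorem IsConfiguration.re_eq (hξ : IsConfiguration ξ) (i : Fin n) :
    (ξ i).re = slope ξ i * (ξ i).im := by
  rw [slope, div_mul_cancel₀ _ (hξ.im_pos i).ne']

theorem IsConfiguration.slope_strictMono (hξ : IsConfiguration ξ) : StrictMono (slope ξ) := by
  intro i j hij
  rw [slope, slope, div_lt_div_iff₀ (hξ.im_pos i) (hξ.im_pos j)]
  exact hξ.clockwise i j hij

theorem vertexAt_zero (σ : Equiv.Perm (Fin n)) : vertexAt ξ σ 0 = 0 := by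
  simp [vertexAt, prefixSet_zero]

theorem vertexAt_succ (σ : Equiv.Perm (Fin n)) (p : Fin n) :
    vertexAt ξ σ (p.val + 1) = vertexAt ξ σ p.val + ξ (σ p) := by
  rw [vertexAt, prefixSet_succ, Finset.sum_insert (apply_notMem_prefixSet σ p), add_comm, vertexAt]

theorem vertexAt_of_le (σ : Equiv.Perm (Fin n)) {m : ℕ} (h : n ≤ m) :
    vertexAt ξ σ m = ∑ x, ξ x := by
  rw [vertexAt, prefixSet_of_le σ h]

theorem vertexAt_mul_adjSwap (σ : Equiv.Perm (Fin n)) {k : Fin (n - 1)} {m : ℕ}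
    (h : m ≠ k.val + 1) : vertexAt ξ (σ * adjSwap k) m = vertexAt ξ σ m := by
  rw [vertexAt, prefixSet_mul_adjSwap σ h, vertexAt]

theorem vertexAt_lo (σ : Equiv.Perm (Fin n)) (k : Fin (n - 1)) :
    vertexAt ξ σ (k.val + 1) = vertexAt ξ σ k.val + ξ (σ (lo k)) := vertexAt_succ σ (lo k)

theorem vertexAt_hi (σ : Equiv.Perm (Fin n)) (k : Fin (n - 1)) :
    vertexAt ξ σ (k.val + 2) = vertexAt ξ σ k.val + ξ (σ (lo k)) + ξ (σ (hi k)) := by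
  rw [← vertexAt_lo]; exact vertexAt_succ σ (hi k)

theorem vertexAt_mul_adjSwap_lo (σ : Equiv.Perm (Fin n)) (k : Fin (n - 1)) :
    vertexAt ξ (σ * adjSwap k) (k.val + 1) = vertexAt ξ σ k.val + ξ (σ (hi k)) := by
  rw [vertexAt_lo, vertexAt_mul_adjSwap σ (by omega)]; simp

theorem vertexAt_im_mono (hξ : IsConfiguration ξ) (σ : Equiv.Perm (Fin n)) {l m : ℕ}
    (h : l ≤ m) : (vertexAt ξ σ l).im ≤ (vertexAt ξ σ m).im := by
  rw [vertexAt, vertexAt, Complex.im_sum, Complex.im_sum]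
  exact Finset.sum_le_sum_of_subset_of_nonneg (prefixSet_mono σ h) fun i _ _ => (hξ.im_pos i).le

theorem clip_of_mem_prefixSet (hξ : IsConfiguration ξ) {σ : Equiv.Perm (Fin n)} {m : ℕ} {h : ℝ}
    (hm : (vertexAt ξ σ m).im ≤ h) {x : Fin n} (hx : x ∈ prefixSet σ m) :
    clip (h - (vertexAt ξ σ (σ.symm x).val).im) (ξ x).im = (ξ x).im := by
  refine clip_of_le (hξ.im_pos x).le ?_
  have h₁ := vertexAt_im_mono hξ σ (mem_prefixSet.1 hx : (σ.symm x).val + 1 ≤ m)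
  rw [vertexAt_succ, Complex.add_im, Equiv.apply_symm_apply] at h₁
  linarith

theorem clip_of_notMem_prefixSet (hξ : IsConfiguration ξ) {σ : Equiv.Perm (Fin n)} {m : ℕ} {h : ℝ}
    (hm : h ≤ (vertexAt ξ σ m).im) {x : Fin n} (hx : x ∉ prefixSet σ m) :
    clip (h - (vertexAt ξ σ (σ.symm x).val).im) (ξ x).im = 0 := by
  refine clip_of_nonpos ?_
  rw [mem_prefixSet, not_lt] at hx
  have h₁ := vertexAt_im_mono hξ σ hx
  linarith

/-- For heights within the edge with number `p`: earlier letters contribute in full, later ones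
nothing, and only the letter `σ p` contributes in part. -/
theorem sum_eq_prefix_add {M : Type*} [AddCommMonoid M] (σ : Equiv.Perm (Fin n)) (p : Fin n)
    {f g : Fin n → M} (h₁ : ∀ x ∈ prefixSet σ p.val, g x = f x)
    (h₂ : ∀ x ∉ prefixSet σ (p.val + 1), g x = 0) :
    ∑ x, g x = ∑ x ∈ prefixSet σ p.val, f x + g (σ p) := by
  rw [← Finset.sum_subset (Finset.subset_univ (prefixSet σ (p.val + 1))) fun x _ hx => h₂ x hx,
    prefixSet_succ, Finset.sum_insert (apply_notMem_prefixSet σ p), add_comm,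
    Finset.sum_congr rfl h₁]

/-- The path of `σ` on its edge with number `p`. -/
theorem pathX_of_mem (hξ : IsConfiguration ξ) (σ : Equiv.Perm (Fin n)) (p : Fin n) {h : ℝ}
    (h₁ : (vertexAt ξ σ p.val).im ≤ h) (h₂ : h ≤ (vertexAt ξ σ (p.val + 1)).im) :
    pathX ξ σ h =
      (vertexAt ξ σ p.val).re + slope ξ (σ p) * (h - (vertexAt ξ σ p.val).im) := by
  rw [pathX, sum_eq_prefix_add σ p (f := fun x => (ξ x).re),
    Equiv.symm_apply_apply, clip_of_mem, ← Complex.re_sum]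
  · rfl
  · linarith
  · rw [vertexAt_succ, Complex.add_im] at h₂; linarith
  · intro x hx
    rw [clip_of_mem_prefixSet hξ h₁ hx, hξ.re_eq]
  · intro x hx
    rw [clip_of_notMem_prefixSet hξ h₂ hx, mul_zero]

theorem exists_level (hn : 0 < n) (σ : Equiv.Perm (Fin n)) {h : ℝ} (h₀ : 0 ≤ h)
    (h₁ : h ≤ (∑ x, ξ x).im) :
    ∃ p : Fin n, (vertexAt ξ σ p.val).im ≤ h ∧ h ≤ (vertexAt ξ σ (p.val + 1)).im := by
  have key : ∀ m, 0 < m → m ≤ n → h ≤ (vertexAt ξ σ m).im →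
      ∃ p : Fin n, (vertexAt ξ σ p.val).im ≤ h ∧ h ≤ (vertexAt ξ σ (p.val + 1)).im := by
    intro m hm
    induction m, hm using Nat.le_induction with
    | base => exact fun hn h => ⟨⟨0, hn⟩, by simpa [vertexAt_zero] using h₀, h⟩
    | succ m hm ih =>
      intro hmn h
      -- `‹ℝ›` is the height, whose name `h` now denotes the upper bound on it.
      by_cases hc : (vertexAt ξ σ m).im ≤ ‹ℝ›
      · exact ⟨⟨m, hmn⟩, hc, h⟩
      · exact ih (by omega) (not_le.1 hc).le
  exact key n hn le_rfl (by rwa [vertexAt_of_le σ le_rfl])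

theorem sum_clip (hξ : IsConfiguration ξ) (hn : 0 < n) (σ : Equiv.Perm (Fin n)) {h : ℝ}
    (h₀ : 0 ≤ h) (h₁ : h ≤ (∑ x, ξ x).im) :
    ∑ x, clip (h - (vertexAt ξ σ (σ.symm x).val).im) (ξ x).im = h := by
  obtain ⟨p, hp, hp'⟩ := exists_level hn σ h₀ h₁
  rw [sum_eq_prefix_add σ p (f := fun x => (ξ x).im)
    (fun x hx => clip_of_mem_prefixSet hξ hp hx) fun x hx => clip_of_notMem_prefixSet hξ hp' hx,
    Equiv.symm_apply_apply, clip_of_mem, ← Complex.im_sum]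
  · change (vertexAt ξ σ p.val).im + _ = _
    ring
  · linarith
  · rw [vertexAt_succ, Complex.add_im] at hp'; linarith

theorem IsConfiguration.ofReal_mul_eq (hξ : IsConfiguration ξ) (a : ℝ) (x : Fin n) :
    ((a : ℂ) * ξ x).re = slope ξ x * (a * (ξ x).im) ∧ ((a : ℂ) * ξ x).im = a * (ξ x).im := by
  rw [Complex.re_ofReal_mul, Complex.im_ofReal_mul, hξ.re_eq]
  exact ⟨by ring, rfl⟩

/-- The point of a path at a given height belongs to the zonogon. -/
theorem path_mem_zonogon (hξ : IsConfiguration ξ) (hn : 0 < n) (σ : Equiv.Perm (Fin n)) {h : ℝ}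
    (h₀ : 0 ≤ h) (h₁ : h ≤ (∑ x, ξ x).im) : (⟨pathX ξ σ h, h⟩ : ℂ) ∈ zonogon ξ := by
  refine ⟨fun x => clip (h - (vertexAt ξ σ (σ.symm x).val).im) (ξ x).im / (ξ x).im,
    fun x => ⟨div_nonneg (clip_nonneg _ _) (hξ.im_pos x).le,
      div_le_one_of_le₀ (clip_le (hξ.im_pos x).le) (hξ.im_pos x).le⟩, ?_⟩
  have e : ∀ x, clip (h - (vertexAt ξ σ (σ.symm x).val).im) (ξ x).im / (ξ x).im * (ξ x).im =
      clip (h - (vertexAt ξ σ (σ.symm x).val).im) (ξ x).im := fun x =>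
    div_mul_cancel₀ _ (hξ.im_pos x).ne'
  apply Complex.ext
  · change pathX ξ σ h = _
    rw [Complex.re_sum, pathX]
    refine Finset.sum_congr rfl fun x _ => ?_
    rw [(hξ.ofReal_mul_eq _ _).1, e]
  · rw [Complex.im_sum]
    refine (sum_clip hξ hn σ h₀ h₁).symm.trans (Finset.sum_congr rfl fun x _ => ?_)
    rw [(hξ.ofReal_mul_eq _ _).2, e]

theorem convex_zonogon : Convex ℝ (zonogon ξ) := by
  rintro z ⟨a, ha, rfl⟩ w ⟨b, hb, rfl⟩ s t hs ht hst
  refine ⟨fun i => s * a i + t * b i, fun i => ⟨?_, ?_⟩, ?_⟩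
  · have := ha i; have := hb i; nlinarith
  · obtain ⟨h₁, h₂⟩ := ha i; obtain ⟨h₃, h₄⟩ := hb i; nlinarith
  · simp only [Complex.real_smul, Finset.mul_sum, ← Finset.sum_add_distrib]
    refine Finset.sum_congr rfl fun i _ => ?_
    push_cast; ring

theorem mem_prefixSet_one {m : ℕ} {x : Fin n} :
    x ∈ prefixSet (1 : Equiv.Perm (Fin n)) m ↔ x.val < m := mem_prefixSet

theorem mem_prefixSet_omega {m : ℕ} {x : Fin n} :
    x ∈ prefixSet (omegaOrder n) m ↔ n - (x.val + 1) < m := by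
  rw [mem_prefixSet, omegaOrder_symm_val]

theorem im_of_mem_zonogon (hξ : IsConfiguration ξ) {z : ℂ} (hz : z ∈ zonogon ξ) :
    0 ≤ z.im ∧ z.im ≤ (∑ x, ξ x).im := by
  obtain ⟨a, ha, rfl⟩ := hz
  rw [Complex.im_sum, Complex.im_sum]
  constructor
  · refine Finset.sum_nonneg fun x _ => ?_
    rw [(hξ.ofReal_mul_eq _ _).2]
    exact mul_nonneg (ha x).1 (hξ.im_pos x).le
  · refine Finset.sum_le_sum fun x _ => ?_
    rw [(hξ.ofReal_mul_eq _ _).2]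
    exact mul_le_of_le_one_left (hξ.im_pos x).le (ha x).2

/-- A point of the zonogon distributes its height among the vectors, each with capacity `(ξ x).im`,
and its abscissa is the sum of the heights weighted by the inverse slopes. The abscissa is least
when small slopes are filled first, which is the path of `1`, and greatest when large slopes are
filled first, which is the path of `ω`. -/
theorem re_of_mem_zonogon (hξ : IsConfiguration ξ) (hn : 0 < n) {z : ℂ} (hz : z ∈ zonogon ξ) :
    pathX ξ 1 z.im ≤ z.re ∧ z.re ≤ pathX ξ (omegaOrder n) z.im := by
  obtain ⟨h₀, h₁⟩ := im_of_mem_zonogon hξ hz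
  obtain ⟨a, ha, hza⟩ := hz
  have hre : z.re = ∑ x, slope ξ x * (a x * (ξ x).im) := by
    rw [hza, Complex.re_sum]
    exact Finset.sum_congr rfl fun x _ => (hξ.ofReal_mul_eq _ _).1
  have him : z.im = ∑ x, a x * (ξ x).im := by
    conv_lhs => rw [hza, Complex.im_sum]
    exact Finset.sum_congr rfl fun x _ => (hξ.ofReal_mul_eq _ _).2
  have hb : ∀ x, 0 ≤ a x * (ξ x).im ∧ a x * (ξ x).im ≤ (ξ x).im := fun x =>
    ⟨mul_nonneg (ha x).1 (hξ.im_pos x).le, mul_le_of_le_one_left (hξ.im_pos x).le (ha x).2⟩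
  set u : Fin n → ℝ := fun x => a x * (ξ x).im
  rw [hre, pathX, pathX]
  -- Both distributions have the same total height, so a constant may be subtracted from all slopes.
  -- With the slope of the edge at this height as constant, every summand has the same sign.
  have key : ∀ σ : Equiv.Perm (Fin n), ∀ c : ℝ,
      ∑ x, (slope ξ x - c) * (u x - clip (z.im - (vertexAt ξ σ (σ.symm x).val).im) (ξ x).im) =
        ∑ x, slope ξ x * u x -
        ∑ x, slope ξ x * clip (z.im - (vertexAt ξ σ (σ.symm x).val).im) (ξ x).im := by
    intro σ c
    have e := sum_clip hξ hn σ h₀ h₁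
    have e' : ∑ x, c * (u x - clip (z.im - (vertexAt ξ σ (σ.symm x).val).im) (ξ x).im) = 0 := by
      rw [← Finset.mul_sum, Finset.sum_sub_distrib, e, ← him, sub_self, mul_zero]
    rw [← Finset.sum_sub_distrib]
    refine Eq.trans ?_ (sub_zero _)
    rw [← e', ← Finset.sum_sub_distrib]
    exact Finset.sum_congr rfl fun x _ => by ring
  constructor
  · obtain ⟨p, hp, hp'⟩ := exists_level hn (1 : Equiv.Perm (Fin n)) h₀ h₁
    rw [← sub_nonneg, ← key 1 (slope ξ p)]
    refine Finset.sum_nonneg fun x _ => ?_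
    rcases lt_trichotomy x p with hx | rfl | hx
    · rw [clip_of_mem_prefixSet hξ hp (mem_prefixSet_one.2 hx)]
      have := hξ.slope_strictMono hx
      exact mul_nonneg_of_nonpos_of_nonpos (by linarith) (by linarith [(hb x).2])
    · simp
    · rw [clip_of_notMem_prefixSet hξ hp' (by rw [mem_prefixSet_one]; rw [Fin.lt_def] at hx; omega)]
      have := hξ.slope_strictMono hx
      exact mul_nonneg (by linarith) (by linarith [(hb x).1])
  · obtain ⟨p, hp, hp'⟩ := exists_level hn (omegaOrder n) h₀ h₁
    rw [← sub_nonpos, ← key _ (slope ξ (omegaOrder n p))]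
    refine Finset.sum_nonpos fun x _ => ?_
    have hv := omegaOrder_val p
    rcases lt_trichotomy x (omegaOrder n p) with hx | rfl | hx
    · rw [clip_of_notMem_prefixSet hξ hp'
        (by rw [mem_prefixSet_omega]; rw [Fin.lt_def] at hx; omega)]
      have := hξ.slope_strictMono hx
      exact mul_nonpos_of_nonpos_of_nonneg (by linarith) (by linarith [(hb x).1])
    · simp
    · rw [clip_of_mem_prefixSet hξ hp
        (by rw [mem_prefixSet_omega]; rw [Fin.lt_def] at hx; omega)]
      have := hξ.slope_strictMono hx
      exact mul_nonpos_of_nonneg_of_nonpos (by linarith) (by linarith [(hb x).2])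

theorem pathX_bounds (hξ : IsConfiguration ξ) (hn : 0 < n) (σ : Equiv.Perm (Fin n)) {h : ℝ}
    (h₀ : 0 ≤ h) (h₁ : h ≤ (∑ x, ξ x).im) :
    pathX ξ 1 h ≤ pathX ξ σ h ∧ pathX ξ σ h ≤ pathX ξ (omegaOrder n) h :=
  re_of_mem_zonogon hξ hn (path_mem_zonogon hξ hn σ h₀ h₁)

/-- The horizontal sections of the zonogon. -/
theorem mem_zonogon_iff (hξ : IsConfiguration ξ) (hn : 0 < n) {z : ℂ} :
    z ∈ zonogon ξ ↔ (0 ≤ z.im ∧ z.im ≤ (∑ x, ξ x).im) ∧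
      pathX ξ 1 z.im ≤ z.re ∧ z.re ≤ pathX ξ (omegaOrder n) z.im := by
  refine ⟨fun h => ⟨im_of_mem_zonogon hξ h, re_of_mem_zonogon hξ hn h⟩, ?_⟩
  rintro ⟨⟨h₀, h₁⟩, h₂, h₃⟩
  have hseg := convex_zonogon.segment_subset (path_mem_zonogon hξ hn 1 h₀ h₁)
    (path_mem_zonogon hξ hn (omegaOrder n) h₀ h₁)
  apply hseg
  rcases eq_or_lt_of_le (h₂.trans h₃) with he | hlt
  · have : z = ⟨pathX ξ 1 z.im, z.im⟩ := Complex.ext (le_antisymm (h₃.trans he.symm.le) h₂) rfl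
    rw [this]; exact left_mem_segment _ _ _
  · rw [segment_eq_image]
    refine ⟨(z.re - pathX ξ 1 z.im) / (pathX ξ (omegaOrder n) z.im - pathX ξ 1 z.im),
      ⟨div_nonneg (by linarith) (by linarith), div_le_one_of_le₀ (by linarith) (by linarith)⟩, ?_⟩
    have hd : pathX ξ (omegaOrder n) z.im - pathX ξ 1 z.im ≠ 0 := by linarith
    apply Complex.ext
    · simp only [Complex.real_smul, Complex.add_re, Complex.re_ofReal_mul]
      field_simp
      ring
    · simp only [Complex.real_smul, Complex.add_im, Complex.im_ofReal_mul]
      ring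

theorem eq_zero_of_mem_zonogon (hξ : IsConfiguration ξ) (hn : 0 < n) {z : ℂ}
    (hz : z ∈ zonogon ξ) (h : z.im = 0) : z = 0 := by
  have hp : ∀ σ : Equiv.Perm (Fin n), pathX ξ σ 0 = 0 := by
    intro σ
    have h0 := vertexAt_im_mono hξ σ (Nat.zero_le 1)
    rw [pathX_of_mem hξ σ ⟨0, hn⟩ (by simp [vertexAt_zero]) (by simpa [vertexAt_zero] using h0)]
    simp [vertexAt_zero]
  have := (mem_zonogon_iff hξ hn).1 hz
  rw [h, hp, hp] at this
  exact Complex.ext (le_antisymm this.2.2 this.2.1) h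

/-- The points of the zonogon on the line through an edge of its left border. -/
theorem mem_left_edge (hξ : IsConfiguration ξ) {z : ℂ} (hz : z ∈ zonogon ξ) (k : Fin n)
    (h : z.re - slope ξ k * z.im =
      (vertexAt ξ 1 k.val).re - slope ξ k * (vertexAt ξ 1 k.val).im) :
    ∃ a : ℝ, 0 ≤ a ∧ a ≤ 1 ∧ z = vertexAt ξ 1 k.val + a * ξ k := by
  obtain ⟨a, ha, rfl⟩ := hz
  have e₁ : (∑ i, (a i : ℂ) * ξ i).re - slope ξ k * (∑ i, (a i : ℂ) * ξ i).im =
      ∑ i, a i * ((ξ i).im * (slope ξ i - slope ξ k)) := by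
    rw [Complex.re_sum, Complex.im_sum, Finset.mul_sum, ← Finset.sum_sub_distrib]
    refine Finset.sum_congr rfl fun i _ => ?_
    rw [(hξ.ofReal_mul_eq _ _).1, (hξ.ofReal_mul_eq _ _).2]; ring
  have e₂ : (vertexAt ξ 1 k.val).re - slope ξ k * (vertexAt ξ 1 k.val).im =
      ∑ i, (if i < k then 1 else 0) * ((ξ i).im * (slope ξ i - slope ξ k)) := by
    rw [vertexAt, Complex.re_sum, Complex.im_sum, Finset.mul_sum, ← Finset.sum_sub_distrib]
    simp only [ite_mul, one_mul, zero_mul, ← Finset.sum_filter]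
    refine Finset.sum_congr ?_ fun i _ => ?_
    · ext i; simp [mem_prefixSet_one]
    · rw [hξ.re_eq]; ring
  -- The functional z ↦ re z − `slope ξ k` · im z attains its minimum over the zonogon on this edge.
  -- The differences of corresponding summands are nonnegative with sum zero, so all vanish, which
  -- forces the coefficients 1 before `k` and 0 after `k`.
  rw [e₁, e₂, ← sub_eq_zero, ← Finset.sum_sub_distrib,
    Finset.sum_eq_zero_iff_of_nonneg ?_] at h
  · refine ⟨a k, (ha k).1, (ha k).2, ?_⟩
    refine sum_eq_prefix_add (1 : Equiv.Perm (Fin n)) k (f := ξ) ?_ ?_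
    · intro x hx
      have hx : x < k := mem_prefixSet_one.1 hx
      have := h x (Finset.mem_univ _)
      rw [if_pos hx, ← sub_mul, mul_eq_zero, mul_eq_zero] at this
      have h₁ := hξ.slope_strictMono hx
      have h₂ := hξ.im_pos x
      have : a x = 1 := by
        rcases this with h | h | h <;> linarith
      rw [this]; simp
    · intro x hx
      have hx : k < x := by rw [mem_prefixSet_one] at hx; rw [Fin.lt_def]; omega
      have := h x (Finset.mem_univ _)
      rw [if_neg hx.asymm, ← sub_mul, mul_eq_zero, mul_eq_zero] at this
      have h₁ := hξ.slope_strictMono hx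
      have h₂ := hξ.im_pos x
      have : a x = 0 := by
        rcases this with h | h | h <;> linarith
      rw [this]; simp
  · intro x _
    rw [← sub_mul]
    have h₂ := (hξ.im_pos x).le
    split_ifs with hx
    · have h₁ := hξ.slope_strictMono hx
      exact mul_nonneg_of_nonpos_of_nonpos (by linarith [(ha x).2])
        (mul_nonpos_of_nonneg_of_nonpos h₂ (by linarith))
    · have h₁ := hξ.slope_strictMono.monotone (not_lt.1 hx)
      exact mul_nonneg (by linarith [(ha x).1]) (mul_nonneg h₂ (by linarith))

/-! ### Horizontal sections of tiles -/

theorem tileL_lt_tileR (hξ : IsConfiguration ξ) (t : Tile n) {h : ℝ} (h₁ : t.base.im < h)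
    (h₂ : h < t.base.im + (ξ t.i).im + (ξ t.j).im) : tileL ξ t h < tileR ξ t h := by
  have hs := hξ.slope_strictMono t.lt
  have hi := hξ.im_pos t.i
  have hj := hξ.im_pos t.j
  unfold tileL tileR
  set s := h - t.base.im
  have hs0 : 0 < s := by simp only [s]; linarith
  have hs1 : s < (ξ t.i).im + (ξ t.j).im := by simp only [s]; linarith
  rcases le_total s (ξ t.i).im with a | a <;> rcases le_total s (ξ t.j).im with b | b
  · rw [clip_of_mem hs0.le a, clip_of_mem hs0.le b, clip_of_nonpos (by linarith),
      clip_of_nonpos (by linarith)]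
    nlinarith
  · rw [clip_of_mem hs0.le a, clip_of_le hj.le b, clip_of_nonpos (by linarith),
      clip_of_mem (by linarith) (by linarith)]
    nlinarith
  · rw [clip_of_le hi.le a, clip_of_mem hs0.le b, clip_of_nonpos (s := s - (ξ t.j).im) (by linarith),
      clip_of_mem (s := s - (ξ t.i).im) (by linarith) (by linarith)]
    nlinarith
  · rw [clip_of_le hi.le a, clip_of_le hj.le b, clip_of_mem (s := s - (ξ t.j).im) (by linarith) (by linarith),
      clip_of_mem (s := s - (ξ t.i).im) (by linarith) (by linarith)]
    nlinarith

theorem tileL_of_le (t : Tile n) {h : ℝ} (h₁ : t.base.im ≤ h)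
    (h₂ : h ≤ t.base.im + (ξ t.i).im) :
    tileL ξ t h = t.base.re + slope ξ t.i * (h - t.base.im) := by
  rw [tileL, clip_of_mem (by linarith) (by linarith), clip_of_nonpos (by linarith)]; ring

theorem tileL_of_ge (hξ : IsConfiguration ξ) (t : Tile n) {h : ℝ} (h₁ : t.base.im + (ξ t.i).im ≤ h)
    (h₂ : h ≤ t.base.im + (ξ t.i).im + (ξ t.j).im) :
    tileL ξ t h = (t.base + ξ t.i).re + slope ξ t.j * (h - (t.base + ξ t.i).im) := by
  rw [tileL, clip_of_le (hξ.im_pos _).le (by linarith), clip_of_mem (by linarith) (by linarith),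
    Complex.add_re, Complex.add_im, hξ.re_eq]; ring

theorem tileR_of_le (t : Tile n) {h : ℝ} (h₁ : t.base.im ≤ h)
    (h₂ : h ≤ t.base.im + (ξ t.j).im) :
    tileR ξ t h = t.base.re + slope ξ t.j * (h - t.base.im) := by
  rw [tileR, clip_of_mem (by linarith) (by linarith), clip_of_nonpos (by linarith)]; ring

theorem tileR_of_ge (hξ : IsConfiguration ξ) (t : Tile n) {h : ℝ} (h₁ : t.base.im + (ξ t.j).im ≤ h)
    (h₂ : h ≤ t.base.im + (ξ t.i).im + (ξ t.j).im) :
    tileR ξ t h = (t.base + ξ t.j).re + slope ξ t.i * (h - (t.base + ξ t.j).im) := by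
  rw [tileR, clip_of_le (hξ.im_pos _).le (by linarith), clip_of_mem (by linarith) (by linarith),
    Complex.add_re, Complex.add_im, hξ.re_eq]; ring

/-- The horizontal sections of a tile. -/
theorem mem_body_iff (hξ : IsConfiguration ξ) (t : Tile n) {z : ℂ} :
    z ∈ t.body ξ ↔ (t.base.im ≤ z.im ∧ z.im ≤ t.base.im + (ξ t.i).im + (ξ t.j).im) ∧
      tileL ξ t z.im ≤ z.re ∧ z.re ≤ tileR ξ t z.im := by
  have hs := hξ.slope_strictMono t.lt
  have hi := hξ.im_pos t.i
  have hj := hξ.im_pos t.j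
  constructor
  · rintro ⟨a, b, ⟨ha₀, ha₁⟩, ⟨hb₀, hb₁⟩, rfl⟩
    have hre : (t.base + a * ξ t.i + b * ξ t.j).re = t.base.re + slope ξ t.i * (a * (ξ t.i).im) +
        slope ξ t.j * (b * (ξ t.j).im) := by
      rw [Complex.add_re, Complex.add_re, (hξ.ofReal_mul_eq _ _).1, (hξ.ofReal_mul_eq _ _).1]
    have him : (t.base + a * ξ t.i + b * ξ t.j).im = t.base.im + a * (ξ t.i).im +
        b * (ξ t.j).im := by
      rw [Complex.add_im, Complex.add_im, (hξ.ofReal_mul_eq _ _).2, (hξ.ofReal_mul_eq _ _).2]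
    have hu₀ : 0 ≤ a * (ξ t.i).im := mul_nonneg ha₀ hi.le
    have hu₁ : a * (ξ t.i).im ≤ (ξ t.i).im := mul_le_of_le_one_left hi.le ha₁
    have hv₀ : 0 ≤ b * (ξ t.j).im := mul_nonneg hb₀ hj.le
    have hv₁ : b * (ξ t.j).im ≤ (ξ t.j).im := mul_le_of_le_one_left hj.le hb₁
    rw [hre, him]
    generalize a * (ξ t.i).im = u at *
    generalize b * (ξ t.j).im = v at *
    refine ⟨⟨by linarith, by linarith⟩, ?_, ?_⟩
    · rcases le_total (u + v) (ξ t.i).im with h | h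
      · rw [tileL_of_le t (by linarith) (by linarith)]; nlinarith
      · rw [tileL_of_ge hξ t (by linarith) (by linarith), Complex.add_re, Complex.add_im, hξ.re_eq]
        nlinarith
    · rcases le_total (u + v) (ξ t.j).im with h | h
      · rw [tileR_of_le t (by linarith) (by linarith)]; nlinarith
      · rw [tileR_of_ge hξ t (by linarith) (by linarith), Complex.add_re, Complex.add_im, hξ.re_eq]
        nlinarith
  · rintro ⟨⟨h₀, h₁⟩, h₂, h₃⟩
    have hd : 0 < slope ξ t.j - slope ξ t.i := by linarith
    -- The heights u and v gained along `ξ t.i` and `ξ t.j` solve u + v = s and `slope ξ t.i` · u +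
    -- `slope ξ t.j` · v = r. The bounds on u and v come from the borders of the tile, and division
    -- by the heights of the vectors gives the coefficients.
    set s := z.im - t.base.im with hs_def
    set r := z.re - t.base.re with hr_def
    have e₁ : (slope ξ t.j - slope ξ t.i) * ((slope ξ t.j * s - r) / (slope ξ t.j - slope ξ t.i)) =
        slope ξ t.j * s - r := mul_div_cancel₀ _ hd.ne'
    have e₂ : (slope ξ t.j - slope ξ t.i) * ((r - slope ξ t.i * s) / (slope ξ t.j - slope ξ t.i)) =
        r - slope ξ t.i * s := mul_div_cancel₀ _ hd.ne'
    have hsum : (slope ξ t.j * s - r) / (slope ξ t.j - slope ξ t.i) +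
        (r - slope ξ t.i * s) / (slope ξ t.j - slope ξ t.i) = s := by
      rw [← add_div, div_eq_iff hd.ne']; ring
    generalize (slope ξ t.j * s - r) / (slope ξ t.j - slope ξ t.i) = u at *
    generalize (r - slope ξ t.i * s) / (slope ξ t.j - slope ξ t.i) = v at *
    have hz : z.im = t.base.im + s := by rw [hs_def]; ring
    have hzr : z.re = t.base.re + r := by rw [hr_def]; ring
    have hv : v = s - u := by linarith
    have hr : r = slope ξ t.i * u + slope ξ t.j * v := by rw [hv]; linarith
    rw [hz, hzr] at h₂ h₃
    rw [hz] at h₀ h₁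
    have hu₀ : 0 ≤ u ∧ v ≤ (ξ t.j).im := by
      rcases le_total s (ξ t.j).im with h | h
      · rw [tileR_of_le t (by linarith) (by linarith)] at h₃
        have : 0 ≤ u := by
          refine nonneg_of_mul_nonneg_right ?_ hd; rw [e₁]; linarith
        exact ⟨this, by linarith⟩
      · rw [tileR_of_ge hξ t (by linarith) (by linarith), Complex.add_re, Complex.add_im,
          hξ.re_eq] at h₃
        have : 0 ≤ (ξ t.j).im - v := by
          refine nonneg_of_mul_nonneg_right ?_ hd
          rw [mul_sub, e₂]; linarith
        exact ⟨by linarith, by linarith⟩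
    have hv₀ : 0 ≤ v ∧ u ≤ (ξ t.i).im := by
      rcases le_total s (ξ t.i).im with h | h
      · rw [tileL_of_le t (by linarith) (by linarith)] at h₂
        have : 0 ≤ v := by
          refine nonneg_of_mul_nonneg_right ?_ hd; rw [e₂]; linarith
        exact ⟨this, by linarith⟩
      · rw [tileL_of_ge hξ t (by linarith) (by linarith), Complex.add_re, Complex.add_im,
          hξ.re_eq] at h₂
        have : 0 ≤ (ξ t.i).im - u := by
          refine nonneg_of_mul_nonneg_right ?_ hd
          rw [mul_sub, e₁]; linarith
        exact ⟨by linarith, by linarith⟩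
    refine ⟨u / (ξ t.i).im, v / (ξ t.j).im,
      ⟨div_nonneg hu₀.1 hi.le, div_le_one_of_le₀ hv₀.2 hi.le⟩,
      ⟨div_nonneg hv₀.1 hj.le, div_le_one_of_le₀ hu₀.2 hj.le⟩, ?_⟩
    apply Complex.ext
    · rw [Complex.add_re, Complex.add_re, (hξ.ofReal_mul_eq _ _).1, (hξ.ofReal_mul_eq _ _).1,
        div_mul_cancel₀ _ hi.ne', div_mul_cancel₀ _ hj.ne', hzr, hr]; ring
    · rw [Complex.add_im, Complex.add_im, (hξ.ofReal_mul_eq _ _).2, (hξ.ofReal_mul_eq _ _).2,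
        div_mul_cancel₀ _ hi.ne', div_mul_cancel₀ _ hj.ne', hz, hv]; ring

end Configuration

/-! ### The tiles swept by an ascending word -/

/-- The tile between the paths of `σ` and of `σ * adjSwap k`. -/
def IsStepTile {n : ℕ} (ξ : Fin n → ℂ) (σ : Equiv.Perm (Fin n)) (k : Fin (n - 1))
    (t : Tile n) : Prop :=
  t.base = vertexAt ξ σ k.val ∧ t.i = σ (lo k) ∧ t.j = σ (hi k)

/-- The tiles swept by the word `w` when it starts from `σ`. -/
def tilesOf {n : ℕ} (ξ : Fin n → ℂ) : Equiv.Perm (Fin n) → List (Fin (n - 1)) → Set (Tile n)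
  | _, [] => ∅
  | σ, k :: w => {t | IsStepTile ξ σ k t} ∪ tilesOf ξ (σ * adjSwap k) w

section Tiles

variable {n : ℕ} {ξ : Fin n → ℂ}

theorem exists_isStepTile {σ : Equiv.Perm (Fin n)} {k : Fin (n - 1)}
    (h : σ (lo k) < σ (hi k)) : ∃ t, IsStepTile ξ σ k t :=
  ⟨⟨vertexAt ξ σ k.val, σ (lo k), σ (hi k), h⟩, rfl, rfl, rfl⟩

theorem IsStepTile.eq {σ : Equiv.Perm (Fin n)} {k : Fin (n - 1)} {s t : Tile n}
    (hs : IsStepTile ξ σ k s) (ht : IsStepTile ξ σ k t) : s = t := by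
  obtain ⟨a, i, j, h⟩ := s
  obtain ⟨b, i', j', h'⟩ := t
  obtain ⟨h₁, h₂, h₃⟩ := hs
  obtain ⟨h₁', h₂', h₃'⟩ := ht
  simp only at h₁ h₂ h₃ h₁' h₂' h₃'
  subst h₁ h₂ h₃ h₁' h₂' h₃'
  rfl

theorem tilesOf_append (σ : Equiv.Perm (Fin n)) (u v : List (Fin (n - 1))) :
    tilesOf ξ σ (u ++ v) = tilesOf ξ σ u ∪ tilesOf ξ (σ * wordProd u) v := by
  induction u generalizing σ with
  | nil => simp [tilesOf, wordProd_nil]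
  | cons k u ih => rw [List.cons_append, tilesOf, tilesOf, ih, mul_wordProd_cons, Set.union_assoc]

theorem isStepTile_far {σ : Equiv.Perm (Fin n)} {a b : Fin (n - 1)}
    (h : a.val + 1 < b.val ∨ b.val + 1 < a.val) (t : Tile n) :
    IsStepTile ξ (σ * adjSwap a) b t ↔ IsStepTile ξ σ b t := by
  rw [IsStepTile, IsStepTile, (mul_adjSwap_lo_of_far σ h).1, (mul_adjSwap_lo_of_far σ h).2,
    vertexAt_mul_adjSwap σ (by omega)]

/-- Distant exchanges move disjoint parts of the path, so each sweeps the same tile whichever comes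
first. The swept set depends only on the commutation class. -/
theorem tilesOf_commutationStep {w w' : List (Fin (n - 1))} (h : CommutationStep w w')
    (σ : Equiv.Perm (Fin n)) : tilesOf ξ σ w = tilesOf ξ σ w' := by
  obtain ⟨u, v, i, j, hij, rfl, rfl⟩ := h
  rw [tilesOf_append, tilesOf_append]
  congr 1
  simp only [tilesOf, isStepTile_far hij, isStepTile_far hij.symm]
  rw [mul_assoc _ (adjSwap i), mul_assoc _ (adjSwap j), adjSwap_comm hij, Set.union_left_comm]

theorem tilesOf_commutation {w w' : List (Fin (n - 1))}
    (h : Relation.ReflTransGen CommutationStep w w') (σ : Equiv.Perm (Fin n)) :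
    tilesOf ξ σ w = tilesOf ξ σ w' := by
  induction h with
  | refl => rfl
  | tail _ h ih => rw [ih, tilesOf_commutationStep h]

/-! ### Edges and vertices of tiles -/

theorem mem_segment_iff (v : ℂ) (k : Fin n) (z : ℂ) :
    z ∈ segment ℝ v (v + ξ k) ↔ ∃ a : ℝ, 0 ≤ a ∧ a ≤ 1 ∧ z = v + a * ξ k := by
  rw [segment_eq_image']
  simp only [add_sub_cancel_left, Set.mem_image, Set.mem_Icc, Complex.real_smul]
  constructor
  · rintro ⟨a, ⟨h₀, h₁⟩, rfl⟩; exact ⟨a, h₀, h₁, rfl⟩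
  · rintro ⟨a, h₀, h₁, rfl⟩; exact ⟨a, ⟨h₀, h₁⟩, rfl⟩

theorem Tile.convex_body (t : Tile n) : Convex ℝ (t.body ξ) := by
  rintro _ ⟨a, b, ⟨ha, ha'⟩, ⟨hb, hb'⟩, rfl⟩ _ ⟨c, d, ⟨hc, hc'⟩, ⟨hd, hd'⟩, rfl⟩ r s hr hs hrs
  refine ⟨r * a + s * c, r * b + s * d, ⟨?_, ?_⟩, ⟨?_, ?_⟩, ?_⟩
  · positivity
  · nlinarith
  · positivity
  · nlinarith
  · simp only [Complex.real_smul]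
    have : (r : ℂ) + s = 1 := by exact_mod_cast hrs
    push_cast
    linear_combination t.base * this

theorem Tile.HasEdge.mem {t : Tile n} {v : ℂ} {k : Fin n} (h : t.HasEdge ξ v k) {a : ℝ}
    (h₀ : 0 ≤ a) (h₁ : a ≤ 1) : v + a * ξ k ∈ t.body ξ := by
  rcases h with ⟨rfl, rfl | rfl⟩ | ⟨rfl, rfl | rfl⟩
  · exact ⟨a, 0, ⟨h₀, h₁⟩, ⟨le_rfl, zero_le_one⟩, by push_cast; ring⟩
  · exact ⟨a, 1, ⟨h₀, h₁⟩, ⟨zero_le_one, le_rfl⟩, by push_cast; ring⟩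
  · exact ⟨0, a, ⟨le_rfl, zero_le_one⟩, ⟨h₀, h₁⟩, by push_cast; ring⟩
  · exact ⟨1, a, ⟨zero_le_one, le_rfl⟩, ⟨h₀, h₁⟩, by push_cast; ring⟩

theorem Tile.HasEdge.start_mem {t : Tile n} {v : ℂ} {k : Fin n} (h : t.HasEdge ξ v k) :
    v ∈ t.body ξ := by
  simpa using h.mem le_rfl zero_le_one

theorem Tile.HasEdge.end_mem {t : Tile n} {v : ℂ} {k : Fin n} (h : t.HasEdge ξ v k) :
    v + ξ k ∈ t.body ξ := by
  simpa using h.mem zero_le_one le_rfl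

theorem Tile.HasEdge.hasVertex {t : Tile n} {v : ℂ} {k : Fin n} (h : t.HasEdge ξ v k) :
    t.HasVertex ξ v ∧ t.HasVertex ξ (v + ξ k) := by
  unfold Tile.HasVertex
  rcases h with ⟨rfl, rfl | rfl⟩ | ⟨rfl, rfl | rfl⟩
  · exact ⟨Or.inl rfl, Or.inr (Or.inl rfl)⟩
  · exact ⟨Or.inr (Or.inr (Or.inl rfl)), Or.inr (Or.inr (Or.inr (by ring)))⟩
  · exact ⟨Or.inl rfl, Or.inr (Or.inr (Or.inl rfl))⟩
  · exact ⟨Or.inr (Or.inl rfl), Or.inr (Or.inr (Or.inr rfl))⟩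

theorem Tile.HasVertex.mem {t : Tile n} {v : ℂ} (h : t.HasVertex ξ v) : v ∈ t.body ξ := by
  have h0 : t.HasEdge ξ t.base t.i := Or.inl ⟨rfl, Or.inl rfl⟩
  have h1 : t.HasEdge ξ (t.base + ξ t.i) t.j := Or.inr ⟨rfl, Or.inr rfl⟩
  have h2 : t.HasEdge ξ t.base t.j := Or.inr ⟨rfl, Or.inl rfl⟩
  rcases h with rfl | rfl | rfl | rfl
  · exact h0.start_mem
  · exact h0.end_mem
  · exact h2.end_mem
  · exact h1.end_mem

theorem IsStepTile.hasEdge {σ : Equiv.Perm (Fin n)} {k : Fin (n - 1)} {t : Tile n}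
    (h : IsStepTile ξ σ k t) {p : Fin n} (hp : p = lo k ∨ p = hi k) :
    t.HasEdge ξ (vertexAt ξ σ p.val) (σ p) ∧
      t.HasEdge ξ (vertexAt ξ (σ * adjSwap k) p.val) ((σ * adjSwap k) p) := by
  obtain ⟨h₁, h₂, h₃⟩ := h
  rcases hp with rfl | rfl
  · rw [lo_val, vertexAt_mul_adjSwap σ (by omega), Equiv.Perm.mul_apply, adjSwap_lo, ← h₁, ← h₂,
      ← h₃]
    exact ⟨Or.inl ⟨rfl, Or.inl rfl⟩, Or.inr ⟨rfl, Or.inl rfl⟩⟩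
  · rw [hi_val, vertexAt_mul_adjSwap_lo, vertexAt_lo, Equiv.Perm.mul_apply, adjSwap_hi, ← h₁, ← h₂,
      ← h₃]
    exact ⟨Or.inr ⟨rfl, Or.inr rfl⟩, Or.inl ⟨rfl, Or.inr rfl⟩⟩

theorem eq_or_prefix_mul_adjSwap (σ : Equiv.Perm (Fin n)) (k : Fin (n - 1)) (p : Fin n) :
    (p = lo k ∨ p = hi k) ∨
      (prefixSet (σ * adjSwap k) p.val = prefixSet σ p.val ∧ (σ * adjSwap k) p = σ p) := by
  by_cases h₁ : p.val = k.val
  · exact Or.inl (Or.inl (Fin.ext h₁))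
  by_cases h₂ : p.val = k.val + 1
  · exact Or.inl (Or.inr (Fin.ext h₂))
  · exact Or.inr ⟨prefixSet_mul_adjSwap σ h₂, by rw [Equiv.Perm.mul_apply, adjSwap_of_ne h₁ h₂]⟩

theorem IsEdgeOf.mono {T T' : Set (Tile n)} (h : T ⊆ T') {v : ℂ} {k : Fin n}
    (he : IsEdgeOf ξ T v k) : IsEdgeOf ξ T' v k := by
  obtain ⟨t, ht, he⟩ := he; exact ⟨t, h ht, he⟩

/-- The first exchange that moves the edge with number `p` sweeps a tile having this edge on its
left; if no exchange moves it, the path ends with the same edge. -/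
theorem edge_forward {σ : Equiv.Perm (Fin n)} {w : List (Fin (n - 1))}
    (h : AscendsIn Set.univ σ w) (p : Fin n) :
    IsEdgeOf ξ (tilesOf ξ σ w) (vertexAt ξ σ p.val) (σ p) ∨
      (prefixSet (σ * wordProd w) p.val = prefixSet σ p.val ∧ (σ * wordProd w) p = σ p) := by
  induction w generalizing σ with
  | nil => right; simp [wordProd_nil]
  | cons k w ih =>
    rcases eq_or_prefix_mul_adjSwap σ k p with hp | ⟨hp, hp'⟩
    · obtain ⟨t, ht⟩ := exists_isStepTile (ξ := ξ) h.2.1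
      exact Or.inl ⟨t, Or.inl ht, (ht.hasEdge hp).1⟩
    · rw [mul_wordProd_cons, vertexAt, ← hp, ← hp']
      exact (ih h.2.2).imp_left fun he => he.mono Set.subset_union_right

/-- The counterpart for the final path: the last exchange that moves the edge with number `p` sweeps
a tile having the resulting edge on its right. -/
theorem edge_backward {σ : Equiv.Perm (Fin n)} {w : List (Fin (n - 1))}
    (h : AscendsIn Set.univ σ w) (p : Fin n) :
    IsEdgeOf ξ (tilesOf ξ σ w) (vertexAt ξ (σ * wordProd w) p.val) ((σ * wordProd w) p) ∨
      (prefixSet (σ * wordProd w) p.val = prefixSet σ p.val ∧ (σ * wordProd w) p = σ p) := by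
  induction w generalizing σ with
  | nil => right; simp [wordProd_nil]
  | cons k w ih =>
    rw [mul_wordProd_cons]
    rcases ih h.2.2 with he | ⟨h₁, h₂⟩
    · exact Or.inl (he.mono Set.subset_union_right)
    · rcases eq_or_prefix_mul_adjSwap σ k p with hp | ⟨hp, hp'⟩
      · obtain ⟨t, ht⟩ := exists_isStepTile (ξ := ξ) h.2.1
        rw [vertexAt, h₁, h₂]
        exact Or.inl ⟨t, Or.inl ht, (ht.hasEdge hp).2⟩
      · exact Or.inr ⟨h₁.trans hp, h₂.trans hp'⟩

/-- All edges of the paths along a reduced word are edges of the swept tiles. -/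
theorem isEdgeOf_tilesOf (hn : 2 ≤ n) {u v : List (Fin (n - 1))}
    (h : AscendsIn Set.univ (1 : Equiv.Perm (Fin n)) (u ++ v))
    (hω : wordProd (u ++ v) = omegaOrder n) (p : Fin n) :
    IsEdgeOf ξ (tilesOf ξ 1 (u ++ v)) (vertexAt ξ (wordProd u) p.val) (wordProd u p) := by
  rw [ascendsIn_append, one_mul] at h
  rw [tilesOf_append, one_mul]
  rw [wordProd_append] at hω
  have hb := edge_backward (ξ := ξ) h.1 p
  have hf := edge_forward (ξ := ξ) h.2 p
  rw [one_mul] at hb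
  rw [hω] at hf
  rcases hb with hb | ⟨hb, hb'⟩
  · exact hb.mono Set.subset_union_left
  rcases hf with hf | ⟨hf, hf'⟩
  · exact hf.mono Set.subset_union_right
  -- An edge moved neither before nor after would be common to the paths of `1` and `ω`. Equality of
  -- the letters gives n = 2p + 1, and the alternative 0, last in `ω`, forces p = 0; this
  -- contradicts 2 ≤ n.
  exfalso
  have e := hf.trans hb
  have e' := congrArg Fin.val (hf'.trans hb')
  rw [omegaOrder_val] at e'
  change _ = p.val at e'
  have e'' := Finset.ext_iff.1 e ⟨0, by omega⟩
  rw [mem_prefixSet_one, mem_prefixSet_omega] at e''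
  simp only at e''
  omega

/-! ### Steps of the paths -/

theorem pathX_step_outside (hξ : IsConfiguration ξ) {σ : Equiv.Perm (Fin n)} {k : Fin (n - 1)}
    {h : ℝ} (hh : h ≤ (vertexAt ξ σ k.val).im ∨ (vertexAt ξ σ (k.val + 2)).im ≤ h) :
    pathX ξ (σ * adjSwap k) h = pathX ξ σ h := by
  refine Finset.sum_congr rfl fun x _ => ?_
  congr 1
  have e₁ := vertexAt_mul_adjSwap (ξ := ξ) σ (k := k) (m := k.val) (by omega)
  have e₂ := vertexAt_mul_adjSwap (ξ := ξ) σ (k := k) (m := k.val + 2) (by omega)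
  rcases hh with hh | hh
  · by_cases hx : x ∈ prefixSet σ k.val
    · rw [mul_adjSwap_symm_apply]
      rw [mem_prefixSet] at hx
      rw [adjSwap_of_ne (by omega) (by omega), vertexAt_mul_adjSwap σ (by omega)]
    · rw [clip_of_notMem_prefixSet hξ hh hx, clip_of_notMem_prefixSet hξ (m := k.val) (by rwa [e₁])
        (by rwa [prefixSet_mul_adjSwap σ (by omega)])]
  · by_cases hx : x ∈ prefixSet σ (k.val + 2)
    · rw [clip_of_mem_prefixSet hξ hh hx, clip_of_mem_prefixSet hξ (m := k.val + 2) (by rwa [e₂])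
        (by rwa [prefixSet_mul_adjSwap σ (by omega)])]
    · rw [mul_adjSwap_symm_apply]
      rw [mem_prefixSet] at hx
      rw [adjSwap_of_ne (by omega) (by omega), vertexAt_mul_adjSwap σ (by omega)]

theorem IsStepTile.top {σ : Equiv.Perm (Fin n)} {k : Fin (n - 1)} {t : Tile n}
    (h : IsStepTile ξ σ k t) :
    t.base.im + (ξ t.i).im + (ξ t.j).im = (vertexAt ξ σ (k.val + 2)).im := by
  obtain ⟨h₁, h₂, h₃⟩ := h
  rw [vertexAt_hi, h₁, h₂, h₃, Complex.add_im, Complex.add_im]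

theorem IsStepTile.tileL_eq (hξ : IsConfiguration ξ) {σ : Equiv.Perm (Fin n)} {k : Fin (n - 1)}
    {t : Tile n} (ht : IsStepTile ξ σ k t) {h : ℝ} (h₁ : t.base.im ≤ h)
    (h₂ : h ≤ t.base.im + (ξ t.i).im + (ξ t.j).im) : tileL ξ t h = pathX ξ σ h := by
  have htop := ht.top
  obtain ⟨e₁, e₂, e₃⟩ := ht
  have hlo := vertexAt_lo (ξ := ξ) σ k
  have him := congrArg Complex.im hlo
  rw [Complex.add_im, ← e₁, ← e₂] at him
  rcases le_total h (t.base.im + (ξ t.i).im) with hc | hc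
  · rw [tileL_of_le t h₁ hc, pathX_of_mem hξ σ (lo k) (by rw [lo_val, ← e₁]; exact h₁)
      (by rw [lo_val, him]; exact hc), lo_val, ← e₁, ← e₂]
  · rw [tileL_of_ge hξ t hc h₂, pathX_of_mem hξ σ (hi k) (by rw [hi_val, him]; exact hc)
      (by rw [hi_val]; change h ≤ (vertexAt ξ σ (k.val + 2)).im; rw [← htop]; exact h₂), hi_val, hlo,
      ← e₁, ← e₂, ← e₃]

theorem IsStepTile.tileR_eq (hξ : IsConfiguration ξ) {σ : Equiv.Perm (Fin n)} {k : Fin (n - 1)}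
    {t : Tile n} (ht : IsStepTile ξ σ k t) {h : ℝ} (h₁ : t.base.im ≤ h)
    (h₂ : h ≤ t.base.im + (ξ t.i).im + (ξ t.j).im) :
    tileR ξ t h = pathX ξ (σ * adjSwap k) h := by
  have htop := ht.top
  obtain ⟨e₁, e₂, e₃⟩ := ht
  have h0 := vertexAt_mul_adjSwap (ξ := ξ) σ (k := k) (m := k.val) (by omega)
  have h2 := vertexAt_mul_adjSwap (ξ := ξ) σ (k := k) (m := k.val + 2) (by omega)
  have hlo := vertexAt_mul_adjSwap_lo (ξ := ξ) σ k
  have him := congrArg Complex.im hlo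
  rw [Complex.add_im, ← e₁, ← e₃] at him
  rcases le_total h (t.base.im + (ξ t.j).im) with hc | hc
  · rw [tileR_of_le t h₁ hc, pathX_of_mem hξ _ (lo k) (by rw [lo_val, h0, ← e₁]; exact h₁)
      (by rw [lo_val, him]; exact hc), lo_val, h0, Equiv.Perm.mul_apply, adjSwap_lo, ← e₁, ← e₃]
  · rw [tileR_of_ge hξ t hc h₂, pathX_of_mem hξ _ (hi k) (by rw [hi_val, him]; exact hc)
      (by rw [hi_val]; change h ≤ (vertexAt ξ _ (k.val + 2)).im; rw [h2, ← htop]; exact h₂), hi_val,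
      hlo, Equiv.Perm.mul_apply, adjSwap_hi, ← e₁, ← e₂, ← e₃]

theorem pathX_lt_step (hξ : IsConfiguration ξ) {σ : Equiv.Perm (Fin n)} {k : Fin (n - 1)}
    (hk : σ (lo k) < σ (hi k)) {h : ℝ} (h₁ : (vertexAt ξ σ k.val).im < h)
    (h₂ : h < (vertexAt ξ σ (k.val + 2)).im) : pathX ξ σ h < pathX ξ (σ * adjSwap k) h := by
  obtain ⟨t, ht⟩ := exists_isStepTile (ξ := ξ) hk
  rw [← ht.1] at h₁
  rw [← ht.top] at h₂
  rw [← ht.tileL_eq hξ h₁.le h₂.le, ← ht.tileR_eq hξ h₁.le h₂.le]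
  exact tileL_lt_tileR hξ t h₁ h₂

theorem pathX_le_step (hξ : IsConfiguration ξ) {σ : Equiv.Perm (Fin n)} {k : Fin (n - 1)}
    (hk : σ (lo k) < σ (hi k)) (h : ℝ) : pathX ξ σ h ≤ pathX ξ (σ * adjSwap k) h := by
  by_cases h₁ : (vertexAt ξ σ k.val).im < h
  · by_cases h₂ : h < (vertexAt ξ σ (k.val + 2)).im
    · exact (pathX_lt_step hξ hk h₁ h₂).le
    · exact (pathX_step_outside hξ (Or.inr (not_lt.1 h₂))).ge
  · exact (pathX_step_outside hξ (Or.inl (not_lt.1 h₁))).ge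

/-- The section of the tile of a step. -/
theorem IsStepTile.mem_body_iff (hξ : IsConfiguration ξ) {σ : Equiv.Perm (Fin n)}
    {k : Fin (n - 1)} {t : Tile n} (ht : IsStepTile ξ σ k t) {z : ℂ} :
    z ∈ t.body ξ ↔ ((vertexAt ξ σ k.val).im ≤ z.im ∧ z.im ≤ (vertexAt ξ σ (k.val + 2)).im) ∧
      pathX ξ σ z.im ≤ z.re ∧ z.re ≤ pathX ξ (σ * adjSwap k) z.im := by
  rw [FishburnTiling.mem_body_iff hξ, ← ht.top, ← ht.1]
  refine and_congr_right fun h => ?_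
  rw [ht.tileL_eq hξ h.1 h.2, ht.tileR_eq hξ h.1 h.2]

theorem vertexAt_im_lt (hξ : IsConfiguration ξ) (σ : Equiv.Perm (Fin n)) {l m : ℕ}
    (h : l < m) (hm : m ≤ n) : (vertexAt ξ σ l).im < (vertexAt ξ σ m).im := by
  have h₁ := vertexAt_im_mono hξ σ (show l + 1 ≤ m from h)
  have h₂ := congrArg Complex.im (vertexAt_succ (ξ := ξ) σ ⟨l, by omega⟩)
  rw [Complex.add_im] at h₂
  have h₃ := hξ.im_pos (σ ⟨l, by omega⟩)
  simp only at h₂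
  linarith

/-- The points of an edge lie on the path. -/
theorem pathX_edge (hξ : IsConfiguration ξ) (σ : Equiv.Perm (Fin n)) (p : Fin n) {a : ℝ}
    (h₀ : 0 ≤ a) (h₁ : a ≤ 1) :
    pathX ξ σ (vertexAt ξ σ p.val + a * ξ (σ p)).im =
      (vertexAt ξ σ p.val + a * ξ (σ p)).re := by
  have hp := hξ.im_pos (σ p)
  rw [pathX_of_mem hξ σ p, Complex.add_im, Complex.add_re, (hξ.ofReal_mul_eq _ _).1,
    (hξ.ofReal_mul_eq _ _).2]
  · ring
  · rw [Complex.add_im, (hξ.ofReal_mul_eq _ _).2]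
    linarith [mul_nonneg h₀ hp.le]
  · rw [vertexAt_succ, Complex.add_im, Complex.add_im, (hξ.ofReal_mul_eq _ _).2]
    linarith [mul_le_of_le_one_left hp.le h₁]

theorem pathX_vertexAt (hξ : IsConfiguration ξ) (hn : 0 < n) (σ : Equiv.Perm (Fin n)) {m : ℕ}
    (hm : m ≤ n) : pathX ξ σ (vertexAt ξ σ m).im = (vertexAt ξ σ m).re := by
  rcases Nat.lt_or_ge m n with h | h
  · simpa using pathX_edge hξ σ ⟨m, h⟩ le_rfl zero_le_one
  · obtain rfl := le_antisymm hm h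
    have := pathX_edge hξ σ ⟨m - 1, by omega⟩ zero_le_one le_rfl
    rw [Complex.ofReal_one, one_mul, ← vertexAt_succ] at this
    simpa [Nat.sub_add_cancel hn] using this

/-- A point on the path at the height of an edge belongs to this edge. -/
theorem exists_of_pathX_eq (hξ : IsConfiguration ξ) (σ : Equiv.Perm (Fin n)) (p : Fin n) {z : ℂ}
    (hz : pathX ξ σ z.im = z.re) (h₁ : (vertexAt ξ σ p.val).im ≤ z.im)
    (h₂ : z.im ≤ (vertexAt ξ σ (p.val + 1)).im) :
    ∃ a : ℝ, 0 ≤ a ∧ a ≤ 1 ∧ z = vertexAt ξ σ p.val + a * ξ (σ p) := by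
  have hp := hξ.im_pos (σ p)
  rw [pathX_of_mem hξ σ p h₁ h₂] at hz
  rw [vertexAt_succ, Complex.add_im] at h₂
  refine ⟨(z.im - (vertexAt ξ σ p.val).im) / (ξ (σ p)).im, div_nonneg (by linarith) hp.le,
    div_le_one_of_le₀ (by linarith) hp.le, ?_⟩
  apply Complex.ext
  · rw [Complex.add_re, (hξ.ofReal_mul_eq _ _).1, div_mul_cancel₀ _ hp.ne', hz]
  · rw [Complex.add_im, (hξ.ofReal_mul_eq _ _).2, div_mul_cancel₀ _ hp.ne']; ring

theorem IsConfiguration.eq_zero_of_add (hξ : IsConfiguration ξ) {x y : Fin n} (hxy : x ≠ y)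
    {a b : ℝ} (h : (a : ℂ) * ξ x + b * ξ y = 0) : a = 0 ∧ b = 0 := by
  have h₁ := congrArg Complex.re h
  have h₂ := congrArg Complex.im h
  rw [Complex.add_re, (hξ.ofReal_mul_eq _ _).1, (hξ.ofReal_mul_eq _ _).1, Complex.zero_re] at h₁
  rw [Complex.add_im, (hξ.ofReal_mul_eq _ _).2, (hξ.ofReal_mul_eq _ _).2, Complex.zero_im] at h₂
  have hs : slope ξ x - slope ξ y ≠ 0 := sub_ne_zero.2 (hξ.slope_strictMono.injective.ne hxy)
  have hx := (hξ.im_pos x).ne'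
  have hy := (hξ.im_pos y).ne'
  have e : (slope ξ x - slope ξ y) * (a * (ξ x).im) = 0 := by linear_combination h₁ - slope ξ y * h₂
  have ha : a = 0 := by simpa [hs, hx] using e
  subst ha
  refine ⟨rfl, ?_⟩
  simpa [hy] using h₂

/-! ### The swept tiles form a tiling -/

theorem pathX_le_of_mem_tilesOf (hξ : IsConfiguration ξ) {σ : Equiv.Perm (Fin n)}
    {w : List (Fin (n - 1))} (h : AscendsIn Set.univ σ w) {t : Tile n} (ht : t ∈ tilesOf ξ σ w)
    {z : ℂ} (hz : z ∈ t.body ξ) : pathX ξ σ z.im ≤ z.re := by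
  induction w generalizing σ with
  | nil => exact absurd ht (Set.notMem_empty _)
  | cons k w ih =>
    rcases ht with ht | ht
    · exact ((IsStepTile.mem_body_iff hξ ht).1 hz).2.1
    · exact (pathX_le_step hξ h.2.1 _).trans (ih h.2.2 ht)

/-- The tiles to the right of a path meet it in vertices and edges. -/
theorem tilesOf_meets_path (hξ : IsConfiguration ξ) {σ : Equiv.Perm (Fin n)}
    {w : List (Fin (n - 1))} (h : AscendsIn Set.univ σ w) {t : Tile n} (ht : t ∈ tilesOf ξ σ w) :
    (∀ m ≤ n, vertexAt ξ σ m ∈ t.body ξ → t.HasVertex ξ (vertexAt ξ σ m)) ∧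
    ∀ (p : Fin n) (a : ℝ), 0 < a → a < 1 → vertexAt ξ σ p.val + a * ξ (σ p) ∈ t.body ξ →
      t.HasEdge ξ (vertexAt ξ σ p.val) (σ p) := by
  induction w generalizing σ with
  | nil => exact absurd ht (Set.notMem_empty _)
  | cons k w ih =>
    have hn : 0 < n := by have := k.isLt; omega
    have hin : ∀ (p : Fin n) (a : ℝ), 0 < a → a < 1 →
        (vertexAt ξ σ p.val).im < (vertexAt ξ σ p.val + a * ξ (σ p)).im ∧
        (vertexAt ξ σ p.val + a * ξ (σ p)).im < (vertexAt ξ σ (p.val + 1)).im := by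
      intro p a h₀ h₁
      have hp := hξ.im_pos (σ p)
      rw [vertexAt_succ, Complex.add_im, Complex.add_im, (hξ.ofReal_mul_eq _ _).2]
      constructor <;> nlinarith
    rcases ht with ht | ht
    · constructor
      · intro m hm hz
        obtain ⟨⟨h₁, h₂⟩, -⟩ := (IsStepTile.mem_body_iff hξ ht).1 hz
        have hm₁ : k.val ≤ m := by
          by_contra hc
          exact absurd (vertexAt_im_lt hξ σ (not_le.1 hc) (by omega)) (not_lt.2 h₁)
        have hm₂ : m ≤ k.val + 2 := by
          by_contra hc
          exact absurd (vertexAt_im_lt hξ σ (not_le.1 hc) hm) (not_lt.2 h₂)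
        have e₁ := (ht.hasEdge (Or.inl rfl)).1.hasVertex
        have e₂ := (ht.hasEdge (Or.inr rfl)).1.hasVertex
        rw [← vertexAt_succ] at e₁ e₂
        obtain rfl | rfl | rfl : m = k.val ∨ m = k.val + 1 ∨ m = k.val + 2 := by omega
        · exact e₁.1
        · exact e₁.2
        · exact e₂.2
      · intro p a h₀ h₁ hz
        obtain ⟨⟨h₂, h₃⟩, -⟩ := (IsStepTile.mem_body_iff hξ ht).1 hz
        obtain ⟨h₄, h₅⟩ := hin p a h₀ h₁
        have hm₁ : k.val ≤ p.val := by
          by_contra hc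
          have := vertexAt_im_mono hξ σ (show p.val + 1 ≤ k.val by omega)
          linarith
        have hm₂ : p.val ≤ k.val + 1 := by
          by_contra hc
          have := vertexAt_im_mono hξ σ (show k.val + 2 ≤ p.val by omega)
          linarith
        refine (ht.hasEdge ?_).1
        simp only [Fin.ext_iff, lo_val, hi_val]
        omega
    · obtain ⟨ih₁, ih₂⟩ := ih h.2.2 ht
      constructor
      · intro m hm hz
        -- Only this vertex is moved by the exchange. It lies strictly to the left of the next path,
        -- which the remaining tiles do not cross.
        by_cases hmk : m = k.val + 1
        · exfalso
          subst hmk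
          have h₁ := pathX_le_of_mem_tilesOf hξ h.2.2 ht hz
          have h₂ := pathX_lt_step hξ h.2.1 (vertexAt_im_lt hξ σ (Nat.lt_succ_self k.val) hm)
            (vertexAt_im_lt hξ σ (Nat.lt_succ_self _) (by omega))
          rw [pathX_vertexAt hξ hn σ hm] at h₂
          linarith
        · rw [← vertexAt_mul_adjSwap σ hmk] at hz ⊢
          exact ih₁ m hm hz
      · intro p a h₀ h₁ hz
        rcases eq_or_prefix_mul_adjSwap σ k p with hp | ⟨hp, hp'⟩
        · exfalso
          obtain ⟨h₄, h₅⟩ := hin p a h₀ h₁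
          have hpv : p.val = k.val ∨ p.val = k.val + 1 := by
            simpa only [Fin.ext_iff, lo_val, hi_val] using hp
          have hlo := vertexAt_im_mono hξ σ (show k.val ≤ p.val by omega)
          have hhi := vertexAt_im_mono hξ σ (show p.val + 1 ≤ k.val + 2 by omega)
          have h₂ := pathX_lt_step hξ h.2.1 (hlo.trans_lt h₄) (h₅.trans_le hhi)
          rw [pathX_edge hξ σ p h₀.le h₁.le] at h₂
          have h₁ := pathX_le_of_mem_tilesOf hξ h.2.2 ht hz
          linarith
        · have := ih₂ p a h₀ h₁
          rw [vertexAt, hp, hp'] at this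
          exact this hz

theorem mem_of_convex_edge {t : Tile n} {v : ℂ} {k : Fin n} (h₁ : v ∈ t.body ξ)
    (h₂ : v + ξ k ∈ t.body ξ) {a : ℝ} (ha₀ : 0 ≤ a) (ha₁ : a ≤ 1) :
    v + a * ξ k ∈ t.body ξ :=
  t.convex_body.segment_subset h₁ h₂ ((mem_segment_iff v k _).2 ⟨a, ha₀, ha₁, rfl⟩)

/-- The alternatives for two distinct tiles of a tiling. -/
def MeetProperly (ξ : Fin n → ℂ) (s t : Tile n) : Prop :=
  s.body ξ ∩ t.body ξ = ∅ ∨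
    (∃ v, s.HasVertex ξ v ∧ t.HasVertex ξ v ∧ s.body ξ ∩ t.body ξ = {v}) ∨
    (∃ v k, s.HasEdge ξ v k ∧ t.HasEdge ξ v k ∧ s.body ξ ∩ t.body ξ = segment ℝ v (v + ξ k))

theorem MeetProperly.symm {s t : Tile n} (h : MeetProperly ξ s t) : MeetProperly ξ t s := by
  unfold MeetProperly at h ⊢
  rw [Set.inter_comm]
  rcases h with h | ⟨v, h₁, h₂, h⟩ | ⟨v, k, h₁, h₂, h⟩
  · exact Or.inl h
  · exact Or.inr (Or.inl ⟨v, h₂, h₁, h⟩)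
  · exact Or.inr (Or.inr ⟨v, k, h₂, h₁, h⟩)

/-- The path of `τ = σ * adjSwap k` separates `t` on its left from `s` on its right, so common
points lie on the two right edges AB and BC of `t`. By `tilesOf_meets_path`, a common interior point
of one of these edges makes it an edge of `s`, and a common vertex is a vertex of `s`. Since A and C
cannot both belong to `s`, the intersection is empty, one vertex or one edge. -/
theorem meetProperly_step (hξ : IsConfiguration ξ) {σ : Equiv.Perm (Fin n)} {k : Fin (n - 1)}
    {w : List (Fin (n - 1))} (h : AscendsIn Set.univ σ (k :: w)) {s t : Tile n}
    (ht : IsStepTile ξ σ k t) (hs : s ∈ tilesOf ξ (σ * adjSwap k) w) : MeetProperly ξ t s := by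
  have hkn := k.isLt
  obtain ⟨hsv, hse⟩ := tilesOf_meets_path hξ h.2.2 hs
  set τ := σ * adjSwap k with hτ
  have he₁ := (ht.hasEdge (Or.inl rfl)).2
  have he₂ := (ht.hasEdge (Or.inr rfl)).2
  rw [← hτ] at he₁ he₂
  set A := vertexAt ξ τ k.val with hA
  set B := vertexAt ξ τ (k.val + 1) with hB
  set C := vertexAt ξ τ (k.val + 2) with hC
  have hAB : B = A + ξ (τ (lo k)) := vertexAt_succ τ (lo k)
  have hBC : C = B + ξ (τ (hi k)) := vertexAt_succ τ (hi k)
  have hne : τ (lo k) ≠ τ (hi k) := fun e => lo_ne_hi k (τ.injective e)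
  have hv₁ := hsv k.val (by omega)
  have hv₂ := hsv (k.val + 1) (by omega)
  have hv₃ := hsv (k.val + 2) (by omega)
  have hs₁ := hse (lo k)
  have hs₂ := hse (hi k)
  rw [lo_val, ← hA] at hs₁ he₁
  rw [hi_val, ← hB] at hs₂ he₂
  rw [← hA] at hv₁
  rw [← hB] at hv₂
  rw [← hC] at hv₃
  -- common points lie on the two right edges
  have hpt : ∀ z, z ∈ t.body ξ → z ∈ s.body ξ →
      (∃ a : ℝ, 0 ≤ a ∧ a ≤ 1 ∧ z = A + a * ξ (τ (lo k))) ∨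
      (∃ a : ℝ, 0 ≤ a ∧ a ≤ 1 ∧ z = B + a * ξ (τ (hi k))) := by
    intro z hz hz'
    obtain ⟨⟨h₁, h₂⟩, -, h₃⟩ := (ht.mem_body_iff hξ).1 hz
    have h₄ := pathX_le_of_mem_tilesOf hξ h.2.2 hs hz'
    have e := le_antisymm h₄ h₃
    rw [← vertexAt_mul_adjSwap (k := k) σ (by omega)] at h₁ h₂
    rcases le_total z.im B.im with hc | hc
    · exact Or.inl (exists_of_pathX_eq hξ τ (lo k) e h₁ hc)
    · exact Or.inr (exists_of_pathX_eq hξ τ (hi k) e hc h₂)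
  -- By convexity the midpoint of A and C would be common to both tiles, but it lies on neither of
  -- the edges AB and BC.
  have hAC : ¬ (A ∈ s.body ξ ∧ C ∈ s.body ξ) := by
    rintro ⟨hAs, hCs⟩
    have hM : ∀ r : Tile n, A ∈ r.body ξ → C ∈ r.body ξ →
        A + ((1 / 2 : ℝ) : ℂ) * ξ (τ (lo k)) + ((1 / 2 : ℝ) : ℂ) * ξ (τ (hi k)) ∈ r.body ξ := by
      intro r h₁ h₂
      have := r.convex_body h₁ h₂ (show (0 : ℝ) ≤ 1 / 2 by norm_num)
        (show (0 : ℝ) ≤ 1 / 2 by norm_num) (by norm_num)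
      convert this using 1
      rw [hBC, hAB, Complex.real_smul, Complex.real_smul]
      push_cast
      ring
    rcases hpt _ (hM t he₁.start_mem (by rw [hBC]; exact he₂.end_mem)) (hM s hAs hCs) with
      ⟨a, -, -, e⟩ | ⟨a, -, -, e⟩
    · have := (hξ.eq_zero_of_add hne (a := 1 / 2 - a) (b := 1 / 2) (by
        push_cast at e ⊢; linear_combination e)).2
      norm_num at this
    · rw [hAB] at e
      have := (hξ.eq_zero_of_add hne (a := -(1 / 2)) (b := 1 / 2 - a) (by
        push_cast at e ⊢; linear_combination e)).1
      norm_num at this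
  have hABs : A ∈ s.body ξ → B ∈ s.body ξ → s.HasEdge ξ A (τ (lo k)) := fun h₁ h₂ =>
    hs₁ (1 / 2) (by norm_num) (by norm_num)
      (mem_of_convex_edge h₁ (by rwa [← hAB]) (by norm_num) (by norm_num))
  have hBCs : B ∈ s.body ξ → C ∈ s.body ξ → s.HasEdge ξ B (τ (hi k)) := fun h₁ h₂ =>
    hs₂ (1 / 2) (by norm_num) (by norm_num)
      (mem_of_convex_edge h₁ (by rwa [← hBC]) (by norm_num) (by norm_num))
  have hpt' : ∀ z, z ∈ t.body ξ → z ∈ s.body ξ →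
      z = A ∨ z = B ∨ z = C ∨
      (s.HasEdge ξ A (τ (lo k)) ∧ z ∈ segment ℝ A (A + ξ (τ (lo k)))) ∨
      (s.HasEdge ξ B (τ (hi k)) ∧ z ∈ segment ℝ B (B + ξ (τ (hi k)))) := by
    intro z hz hz'
    rcases hpt z hz hz' with ⟨a, h₀, h₁, rfl⟩ | ⟨a, h₀, h₁, rfl⟩
    · rcases eq_or_lt_of_le h₀ with rfl | h₀
      · left; simp
      rcases eq_or_lt_of_le h₁ with rfl | h₁
      · right; left; rw [hAB]; simp
      · exact Or.inr (Or.inr (Or.inr (Or.inl ⟨hs₁ a h₀ h₁ hz',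
          (mem_segment_iff _ _ _).2 ⟨a, h₀.le, h₁.le, rfl⟩⟩)))
    · rcases eq_or_lt_of_le h₀ with rfl | h₀
      · right; left; simp
      rcases eq_or_lt_of_le h₁ with rfl | h₁
      · right; right; left; rw [hBC]; simp
      · exact Or.inr (Or.inr (Or.inr (Or.inr ⟨hs₂ a h₀ h₁ hz',
          (mem_segment_iff _ _ _).2 ⟨a, h₀.le, h₁.le, rfl⟩⟩)))
  by_cases hE₁ : s.HasEdge ξ A (τ (lo k))
  · have hAs := hE₁.start_mem
    have hBs := hE₁.end_mem
    rw [← hAB] at hBs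
    have hCs : C ∉ s.body ξ := fun hc => hAC ⟨hAs, hc⟩
    refine Or.inr (Or.inr ⟨A, τ (lo k), he₁, hE₁, Set.Subset.antisymm ?_ ?_⟩)
    · rintro z ⟨hz, hz'⟩
      rcases hpt' z hz hz' with rfl | rfl | rfl | h | h
      · exact left_mem_segment _ _ _
      · rw [hAB]; exact right_mem_segment _ _ _
      · exact absurd hz' hCs
      · exact h.2
      · exact absurd (by rw [hBC]; exact h.1.end_mem) hCs
    · intro z hz
      obtain ⟨a, h₀, h₁, rfl⟩ := (mem_segment_iff _ _ _).1 hz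
      exact ⟨he₁.mem h₀ h₁, hE₁.mem h₀ h₁⟩
  by_cases hE₂ : s.HasEdge ξ B (τ (hi k))
  · have hBs := hE₂.start_mem
    have hCs := hE₂.end_mem
    rw [← hBC] at hCs
    have hAs : A ∉ s.body ξ := fun hc => hAC ⟨hc, hCs⟩
    refine Or.inr (Or.inr ⟨B, τ (hi k), he₂, hE₂, Set.Subset.antisymm ?_ ?_⟩)
    · rintro z ⟨hz, hz'⟩
      rcases hpt' z hz hz' with rfl | rfl | rfl | h | h
      · exact absurd hz' hAs
      · exact left_mem_segment _ _ _
      · rw [hBC]; exact right_mem_segment _ _ _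
      · exact absurd h.1 hE₁
      · exact h.2
    · intro z hz
      obtain ⟨a, h₀, h₁, rfl⟩ := (mem_segment_iff _ _ _).1 hz
      exact ⟨he₂.mem h₀ h₁, hE₂.mem h₀ h₁⟩
  have single : ∀ v, v ∈ s.body ξ → v = A ∨ v = B ∨ v = C →
      s.body ξ ∩ t.body ξ ⊆ {v} := by
    rintro v hv hv' z ⟨hz', hz⟩
    rw [Set.mem_singleton_iff]
    have hz3 : z = A ∨ z = B ∨ z = C := by
      rcases hpt' z hz hz' with h | h | h | h | h
      · exact Or.inl h
      · exact Or.inr (Or.inl h)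
      · exact Or.inr (Or.inr h)
      · exact absurd h.1 hE₁
      · exact absurd h.1 hE₂
    rcases hv' with rfl | rfl | rfl <;> rcases hz3 with rfl | rfl | rfl
    · rfl
    · exact absurd (hABs hv hz') hE₁
    · exact absurd ⟨hv, hz'⟩ hAC
    · exact absurd (hABs hz' hv) hE₁
    · rfl
    · exact absurd (hBCs hv hz') hE₂
    · exact absurd ⟨hz', hv⟩ hAC
    · exact absurd (hBCs hz' hv) hE₂
    · rfl
  have fin : ∀ v, v ∈ s.body ξ → v = A ∨ v = B ∨ v = C → t.HasVertex ξ v → s.HasVertex ξ v →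
      MeetProperly ξ t s := by
    intro v hv hv' h₁ h₂
    refine Or.inr (Or.inl ⟨v, h₁, h₂, ?_⟩)
    rw [Set.inter_comm]
    exact Set.Subset.antisymm (single v hv hv') (Set.singleton_subset_iff.2 ⟨hv, h₁.mem⟩)
  by_cases hAs : A ∈ s.body ξ
  · exact fin A hAs (Or.inl rfl) he₁.hasVertex.1 (hv₁ hAs)
  by_cases hBs : B ∈ s.body ξ
  · exact fin B hBs (Or.inr (Or.inl rfl)) he₂.hasVertex.1 (hv₂ hBs)
  by_cases hCs : C ∈ s.body ξ
  · exact fin C hCs (Or.inr (Or.inr rfl)) (by rw [hBC]; exact he₂.hasVertex.2) (hv₃ hCs)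
  left
  rw [Set.eq_empty_iff_forall_notMem]
  rintro z ⟨hz, hz'⟩
  rcases hpt' z hz hz' with rfl | rfl | rfl | h | h
  · exact hAs hz'
  · exact hBs hz'
  · exact hCs hz'
  · exact hE₁ h.1
  · exact hE₂ h.1

theorem meetProperly_tilesOf (hξ : IsConfiguration ξ) {σ : Equiv.Perm (Fin n)}
    {w : List (Fin (n - 1))} (h : AscendsIn Set.univ σ w) {s t : Tile n}
    (hs : s ∈ tilesOf ξ σ w) (ht : t ∈ tilesOf ξ σ w) (hne : s ≠ t) : MeetProperly ξ s t := by
  induction w generalizing σ with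
  | nil => exact absurd ht (Set.notMem_empty _)
  | cons k w ih =>
    rcases hs with hs | hs <;> rcases ht with ht | ht
    · exact absurd (hs.eq ht) hne
    · exact meetProperly_step hξ h hs ht
    · exact (meetProperly_step hξ h ht hs).symm
    · exact ih h.2.2 hs ht

theorem body_subset_zonogon_of_tilesOf (hξ : IsConfiguration ξ) {σ : Equiv.Perm (Fin n)}
    {w : List (Fin (n - 1))} {t : Tile n} (ht : t ∈ tilesOf ξ σ w) :
    t.body ξ ⊆ zonogon ξ := by
  induction w generalizing σ with
  | nil => exact absurd ht (Set.notMem_empty _)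
  | cons k w ih =>
    rcases ht with ht | ht
    · intro z hz
      have hk := k.isLt
      obtain ⟨⟨h₁, h₂⟩, h₃, h₄⟩ := (IsStepTile.mem_body_iff hξ ht).1 hz
      have h₀ := vertexAt_im_mono hξ σ (Nat.zero_le k.val)
      have hH := vertexAt_im_mono hξ σ (show k.val + 2 ≤ n by omega)
      rw [vertexAt_zero, Complex.zero_im] at h₀
      rw [vertexAt_of_le σ le_rfl] at hH
      have h₅ := h₀.trans h₁
      have h₆ := h₂.trans hH
      exact (mem_zonogon_iff hξ (by omega)).2 ⟨⟨h₅, h₆⟩,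
        (pathX_bounds hξ (by omega) _ h₅ h₆).1.trans h₃,
        h₄.trans (pathX_bounds hξ (by omega) _ h₅ h₆).2⟩
    · exact ih ht

/-- The paths move to the right from step to step; the tile of the first step whose path reaches `z`
contains it. -/
theorem exists_mem_tilesOf (hξ : IsConfiguration ξ) {σ : Equiv.Perm (Fin n)}
    {w : List (Fin (n - 1))} (h : AscendsIn Set.univ σ w) {z : ℂ} (h₁ : pathX ξ σ z.im < z.re)
    (h₂ : z.re ≤ pathX ξ (σ * wordProd w) z.im) : ∃ t ∈ tilesOf ξ σ w, z ∈ t.body ξ := by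
  induction w generalizing σ with
  | nil => rw [wordProd_nil, mul_one] at h₂; linarith
  | cons k w ih =>
    rw [mul_wordProd_cons] at h₂
    by_cases hc : z.re ≤ pathX ξ (σ * adjSwap k) z.im
    · obtain ⟨t, ht⟩ := exists_isStepTile (ξ := ξ) h.2.1
      refine ⟨t, Or.inl ht, (ht.mem_body_iff hξ).2 ⟨?_, h₁.le, hc⟩⟩
      by_contra hout
      rw [not_and_or, not_le, not_le] at hout
      rw [pathX_step_outside hξ (hout.imp le_of_lt le_of_lt)] at hc
      linarith
    · obtain ⟨t, ht, hz⟩ := ih h.2.2 (not_le.1 hc) h₂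
      exact ⟨t, Or.inr ht, hz⟩

/-- The tiles swept by a reduced word form a rhombus tiling. -/
theorem isTiling_tilesOf (hξ : IsConfiguration ξ) (hn : 2 ≤ n) {w : List (Fin (n - 1))}
    (h : AscendsIn Set.univ (1 : Equiv.Perm (Fin n)) w) (hω : wordProd w = omegaOrder n) :
    IsTiling ξ (tilesOf ξ 1 w) := by
  refine ⟨Set.Subset.antisymm (Set.iUnion₂_subset fun t ht =>
    body_subset_zonogon_of_tilesOf hξ ht) fun z hz => ?_, fun s hs t ht hne =>
    meetProperly_tilesOf hξ h hs ht hne⟩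
  rw [Set.mem_iUnion₂]
  simp only [exists_prop]
  obtain ⟨⟨h₁, h₂⟩, h₃, h₄⟩ := (mem_zonogon_iff hξ (by omega)).1 hz
  -- A point of the left border lies strictly to the right of no path, so it is covered through an
  -- edge of the path of `1`, which belongs to some tile.
  rcases eq_or_lt_of_le h₃ with he | hlt
  · obtain ⟨p, hp, hp'⟩ := exists_level (ξ := ξ) (by omega) (1 : Equiv.Perm (Fin n)) h₁ h₂
    obtain ⟨a, ha₀, ha₁, e⟩ := exists_of_pathX_eq hξ 1 p he hp hp'
    obtain ⟨t, ht, hedge⟩ := isEdgeOf_tilesOf (ξ := ξ) hn (u := []) h hω p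
    exact ⟨t, ht, by rw [e]; exact hedge.mem ha₀ ha₁⟩
  · exact exists_mem_tilesOf hξ h hlt (by rwa [one_mul, hω])

end Tiles

section Sweep

variable {n : ℕ} {ξ : Fin n → ℂ}

open Filter Topology

/-! ### General facts on tilings -/

theorem IsTiling.body_subset {T : Set (Tile n)} (hT : IsTiling ξ T) {t : Tile n} (ht : t ∈ T) :
    t.body ξ ⊆ zonogon ξ := by
  rw [← hT.1]; exact Set.subset_biUnion_of_mem ht

/-- A tile needs two colours, and the zonogon always contains 0, so some tile exists. -/
theorem IsTiling.two_le {T : Set (Tile n)} (hT : IsTiling ξ T) : 2 ≤ n := by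
  have h0 : (0 : ℂ) ∈ zonogon ξ := ⟨fun _ => 0, fun _ => ⟨le_rfl, zero_le_one⟩, by simp⟩
  rw [← hT.1, Set.mem_iUnion₂] at h0
  obtain ⟨t, -, -⟩ := h0
  have h₁ := t.lt
  have h₂ := t.j.isLt
  rw [Fin.lt_def] at h₁
  omega

/-- Two tiles of a tiling that have two points at the same height in common are equal. -/
theorem IsTiling.eq_of_mem (hξ : IsConfiguration ξ) {T : Set (Tile n)} (hT : IsTiling ξ T)
    {s t : Tile n} (hs : s ∈ T) (ht : t ∈ T) {z z' : ℂ} (hzs : z ∈ s.body ξ) (hzt : z ∈ t.body ξ)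
    (hzs' : z' ∈ s.body ξ) (hzt' : z' ∈ t.body ξ) (him : z.im = z'.im) (hne : z ≠ z') : s = t := by
  by_contra hst
  have h₁ : z ∈ s.body ξ ∩ t.body ξ := ⟨hzs, hzt⟩
  have h₂ : z' ∈ s.body ξ ∩ t.body ξ := ⟨hzs', hzt'⟩
  rcases hT.2 s hs t ht hst with h | ⟨v, -, -, h⟩ | ⟨v, k, -, -, h⟩
  · rw [h] at h₁; exact h₁
  · rw [h, Set.mem_singleton_iff] at h₁ h₂
    exact hne (h₁.trans h₂.symm)
  · rw [h, mem_segment_iff] at h₁ h₂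
    obtain ⟨a, -, -, rfl⟩ := h₁
    obtain ⟨b, -, -, rfl⟩ := h₂
    rw [Complex.add_im, Complex.add_im, (hξ.ofReal_mul_eq _ _).2, (hξ.ofReal_mul_eq _ _).2] at him
    have : a = b := mul_right_cancel₀ (hξ.im_pos k).ne' (add_left_cancel him)
    exact hne (by rw [this])

theorem exists_bound_zonogon (ξ : Fin n → ℂ) (p q : ℝ) :
    ∃ M : ℝ, ∀ z ∈ zonogon ξ, |p * z.re + q * z.im| ≤ M := by
  refine ⟨∑ i, |p * (ξ i).re + q * (ξ i).im|, ?_⟩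
  rintro _ ⟨a, ha, rfl⟩
  have : p * (∑ i, (a i : ℂ) * ξ i).re + q * (∑ i, (a i : ℂ) * ξ i).im =
      ∑ i, a i * (p * (ξ i).re + q * (ξ i).im) := by
    rw [Complex.re_sum, Complex.im_sum, Finset.mul_sum, Finset.mul_sum, ← Finset.sum_add_distrib]
    refine Finset.sum_congr rfl fun i _ => ?_
    rw [Complex.re_ofReal_mul, Complex.im_ofReal_mul]; ring
  rw [this]
  refine (Finset.abs_sum_le_sum_abs _ _).trans (Finset.sum_le_sum fun i _ => ?_)
  rw [abs_mul, abs_of_nonneg (ha i).1]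
  exact mul_le_of_le_one_left (abs_nonneg _) (ha i).2

/-- Tiles of the same colours with close bottom vertices are equal. -/
theorem IsTiling.eq_of_close (hξ : IsConfiguration ξ) {T : Set (Tile n)} (hT : IsTiling ξ T)
    {s t : Tile n} (hs : s ∈ T) (ht : t ∈ T) (hi : s.i = t.i) (hj : s.j = t.j) {a b : ℝ}
    (hab : s.base = t.base + a * ξ t.i + b * ξ t.j) (ha : |a| ≤ 1 / 4) (hb : |b| ≤ 1 / 4) :
    s = t := by
  have hyi := hξ.im_pos t.i
  have hyj := hξ.im_pos t.j
  rw [abs_le] at ha hb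
  -- The second common point is the centre of `s` shifted by η(`(ξ t.j).im`, −`(ξ t.i).im`) in the
  -- coordinates of the tile, which keeps the height. The factor 1/8 leaves the coordinates in [1/4,
  -- 3/4], and a displacement of at most 1/4 keeps them in [0, 1].
  set η : ℝ := 1 / (8 * ((ξ t.i).im + (ξ t.j).im)) with hη
  have hη0 : 0 < η := by positivity
  have h₁ : η * (ξ t.j).im ≤ 1 / 8 ∧ η * (ξ t.i).im ≤ 1 / 8 := by
    have e : η * ((ξ t.i).im + (ξ t.j).im) = 1 / 8 := by
      rw [hη]; field_simp
    constructor <;> nlinarith [mul_pos hη0 hyi, mul_pos hη0 hyj]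
  have h₂ := mul_pos hη0 hyi
  have h₃ := mul_pos hη0 hyj
  have key : ∀ c d : ℝ, 1 / 4 ≤ c → c ≤ 3 / 4 → 1 / 4 ≤ d → d ≤ 3 / 4 →
      s.base + c * ξ t.i + d * ξ t.j ∈ s.body ξ ∧ s.base + c * ξ t.i + d * ξ t.j ∈ t.body ξ := by
    intro c d hc hc' hd hd'
    constructor
    · exact ⟨c, d, ⟨by linarith, by linarith⟩, ⟨by linarith, by linarith⟩, by rw [hi, hj]⟩
    · refine ⟨a + c, b + d, ⟨by linarith, by linarith⟩, ⟨by linarith, by linarith⟩, ?_⟩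
      rw [hab]; push_cast; ring
  have k₁ := key (1 / 2) (1 / 2) (by norm_num) (by norm_num) (by norm_num) (by norm_num)
  have k₂ := key (1 / 2 + η * (ξ t.j).im) (1 / 2 - η * (ξ t.i).im) (by linarith) (by linarith)
    (by linarith) (by linarith)
  refine hT.eq_of_mem hξ hs ht k₁.1 k₁.2 k₂.1 k₂.2 ?_ ?_
  · simp only [Complex.add_im, (hξ.ofReal_mul_eq _ _).2]; ring
  · intro e
    have := (hξ.eq_zero_of_add t.lt.ne (a := η * (ξ t.j).im) (b := -(η * (ξ t.i).im)) (by
      push_cast at e ⊢; linear_combination -e)).1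
    linarith

/-- For two fixed colours, tiles whose bottom vertices lie in the same cell of a sufficiently fine
grid coincide by `eq_of_close`, and the bounded zonogon meets finitely many cells. -/
theorem IsTiling.finite (hξ : IsConfiguration ξ) {T : Set (Tile n)} (hT : IsTiling ξ T) :
    T.Finite := by
  have key : ∀ i j : Fin n, i < j → {t ∈ T | t.i = i ∧ t.j = j}.Finite := by
    intro i j hij
    have hyi := hξ.im_pos i
    have hyj := hξ.im_pos j
    have hd : 0 < slope ξ j - slope ξ i := sub_pos.2 (hξ.slope_strictMono hij)
    set D := slope ξ j - slope ξ i with hD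
    -- `α` and `β` are four times the coordinates in the basis `ξ i`, `ξ j`, so equal floors mean
    -- coordinates less than 1/4 apart.
    set α : ℂ → ℝ := fun z => -(4 / (D * (ξ i).im)) * z.re + 4 * slope ξ j / (D * (ξ i).im) * z.im
    set β : ℂ → ℝ := fun z => 4 / (D * (ξ j).im) * z.re + -(4 * slope ξ i / (D * (ξ j).im)) * z.im
    obtain ⟨M, hM⟩ := exists_bound_zonogon ξ (-(4 / (D * (ξ i).im))) (4 * slope ξ j / (D * (ξ i).im))
    obtain ⟨N, hN⟩ := exists_bound_zonogon ξ (4 / (D * (ξ j).im)) (-(4 * slope ξ i / (D * (ξ j).im)))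
    have hcoord : ∀ z z' : ℂ, z = z' + ((1 / 4 * (α z - α z') : ℝ) : ℂ) * ξ i +
        ((1 / 4 * (β z - β z') : ℝ) : ℂ) * ξ j := by
      intro z z'
      apply Complex.ext
      · rw [Complex.add_re, Complex.add_re, (hξ.ofReal_mul_eq _ _).1, (hξ.ofReal_mul_eq _ _).1]
        simp only [α, β]
        field_simp
        rw [hD]; ring
      · rw [Complex.add_im, Complex.add_im, (hξ.ofReal_mul_eq _ _).2, (hξ.ofReal_mul_eq _ _).2]
        simp only [α, β]
        field_simp
        rw [hD]; ring
    have hbase : ∀ t ∈ T, t.base ∈ zonogon ξ := fun t ht =>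
      hT.body_subset ht (Tile.HasVertex.mem (Or.inl rfl))
    refine Set.Finite.of_injOn (f := fun t : Tile n => (⌊α t.base⌋, ⌊β t.base⌋))
      (t := Set.Icc ⌊-M⌋ ⌊M⌋ ×ˢ Set.Icc ⌊-N⌋ ⌊N⌋) ?_ ?_
      ((Set.finite_Icc _ _).prod (Set.finite_Icc _ _))
    · rintro t ⟨ht, -⟩
      have h₁ := abs_le.1 (hM _ (hbase t ht))
      have h₂ := abs_le.1 (hN _ (hbase t ht))
      exact ⟨⟨Int.floor_le_floor h₁.1, Int.floor_le_floor h₁.2⟩,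
        ⟨Int.floor_le_floor h₂.1, Int.floor_le_floor h₂.2⟩⟩
    · rintro s ⟨hs, rfl, rfl⟩ t ⟨ht, hi, hj⟩ he
      simp only [Prod.mk.injEq] at he
      have h₁ := Int.abs_sub_lt_one_of_floor_eq_floor he.1
      have h₂ := Int.abs_sub_lt_one_of_floor_eq_floor he.2
      refine hT.eq_of_close hξ hs ht hi.symm hj.symm (a := 1 / 4 * (α s.base - α t.base))
        (b := 1 / 4 * (β s.base - β t.base)) ?_ ?_ ?_
      · rw [hi, hj]; exact hcoord _ _
      · rw [abs_mul, abs_of_pos (by norm_num : (0 : ℝ) < 1 / 4)]; linarith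
      · rw [abs_mul, abs_of_pos (by norm_num : (0 : ℝ) < 1 / 4)]; linarith
  have : T ⊆ ⋃ i : Fin n, ⋃ j : Fin n, {t ∈ T | t.i = i ∧ t.j = j} := by
    intro t ht
    simp only [Set.mem_iUnion]
    exact ⟨t.i, t.j, ht, rfl, rfl⟩
  refine Set.Finite.subset (Set.finite_iUnion fun i => Set.finite_iUnion fun j => ?_) this
  by_cases hij : i < j
  · exact key i j hij
  · convert Set.finite_empty
    rw [Set.eq_empty_iff_forall_notMem]
    rintro t ⟨-, rfl, rfl⟩
    exact hij t.lt

/-- Two different edges of the same colour of a tile differ by the other vector of the tile, which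
is not parallel to them. -/
theorem Tile.HasEdge.unique (hξ : IsConfiguration ξ) {t : Tile n} {v : ℂ} {k : Fin n} {r : ℝ}
    (h : t.HasEdge ξ v k) (h' : t.HasEdge ξ (v + r * ξ k) k) : r = 0 := by
  have hne := t.lt.ne
  rcases h with ⟨rfl, hv⟩ | ⟨rfl, hv⟩ <;> rcases h' with ⟨hk, hv'⟩ | ⟨hk, hv'⟩
  · rcases hv with rfl | rfl <;> rcases hv' with e | e
    · exact (hξ.eq_zero_of_add hne (a := r) (b := 0) (by push_cast; linear_combination e)).1
    · exact (hξ.eq_zero_of_add hne (a := r) (b := -1) (by push_cast; linear_combination e)).1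
    · exact (hξ.eq_zero_of_add hne (a := r) (b := 1) (by push_cast; linear_combination e)).1
    · exact (hξ.eq_zero_of_add hne (a := r) (b := 0) (by push_cast; linear_combination e)).1
  · exact absurd hk hne
  · exact absurd hk.symm hne
  · rcases hv with rfl | rfl <;> rcases hv' with e | e
    · exact (hξ.eq_zero_of_add hne (a := 0) (b := r) (by push_cast; linear_combination e)).2
    · exact (hξ.eq_zero_of_add hne (a := -1) (b := r) (by push_cast; linear_combination e)).2
    · exact (hξ.eq_zero_of_add hne (a := 1) (b := r) (by push_cast; linear_combination e)).2
    · exact (hξ.eq_zero_of_add hne (a := 0) (b := r) (by push_cast; linear_combination e)).2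

/-! ### Sweeping a tiling from the left to the right -/

/-- The tiles of `T` to the left of the path of `σ` are those of `W`. -/
structure Swept (ξ : Fin n → ℂ) (T : Set (Tile n)) (σ : Equiv.Perm (Fin n))
    (W : Set (Tile n)) : Prop where
  subset : W ⊆ T
  right : ∀ t ∈ T, t ∉ W → ∀ h, t.base.im < h → h < t.base.im + (ξ t.i).im + (ξ t.j).im →
    pathX ξ σ h ≤ tileL ξ t h
  cover : ∀ z ∈ zonogon ξ, pathX ξ σ z.im < z.re → ∃ t ∈ T, t ∉ W ∧ z ∈ t.body ξ
  -- Each edge of the path is an edge of a swept tile or lies on the left border: in the second case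
  -- its lower end is the border vertex at which the colour `σ p` starts.
  edge : ∀ p : Fin n, (∃ s ∈ W, s.HasEdge ξ (vertexAt ξ σ p.val) (σ p)) ∨
    prefixSet σ p.val = prefixSet 1 (σ p).val

theorem tileL_mem (hξ : IsConfiguration ξ) (t : Tile n) {h : ℝ} (h₁ : t.base.im < h)
    (h₂ : h < t.base.im + (ξ t.i).im + (ξ t.j).im) :
    (⟨tileL ξ t h, h⟩ : ℂ) ∈ t.body ξ ∧ (⟨tileR ξ t h, h⟩ : ℂ) ∈ t.body ξ := by
  have := tileL_lt_tileR hξ t h₁ h₂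
  exact ⟨(mem_body_iff hξ t).2 ⟨⟨h₁.le, h₂.le⟩, le_rfl, this.le⟩,
    (mem_body_iff hξ t).2 ⟨⟨h₁.le, h₂.le⟩, this.le, le_rfl⟩⟩

theorem swept_one (hξ : IsConfiguration ξ) {T : Set (Tile n)} (hT : IsTiling ξ T) :
    Swept ξ T 1 ∅ := by
  have hn := hT.two_le
  refine ⟨Set.empty_subset _, fun t ht _ h h₁ h₂ => ?_, fun z hz _ => ?_, fun p => Or.inr rfl⟩
  · exact (re_of_mem_zonogon hξ (by omega) (hT.body_subset ht (tileL_mem hξ t h₁ h₂).1)).1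
  · rw [← hT.1, Set.mem_iUnion₂] at hz
    obtain ⟨t, ht, hz⟩ := hz
    exact ⟨t, ht, Set.notMem_empty _, hz⟩

/-- An unswept tile cannot have an edge that overlaps an edge of the path without being equal to it.
If the path edge belongs to a swept tile, the two tiles share more than a point, hence a full edge
of both, and `Tile.HasEdge.unique` identifies it. If the path edge lies on the left border, the line
through it meets the zonogon in this edge only, which leaves no room for a shift. -/
theorem Swept.edge_shift (hξ : IsConfiguration ξ) {T : Set (Tile n)} (hT : IsTiling ξ T)
    {σ : Equiv.Perm (Fin n)} {W : Set (Tile n)} (hS : Swept ξ T σ W) {t : Tile n} (ht : t ∈ T)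
    (htW : t ∉ W) (p : Fin n) {r : ℝ} (hr₁ : -1 < r) (hr₂ : r < 1)
    (he : t.HasEdge ξ (vertexAt ξ σ p.val + r * ξ (σ p)) (σ p)) : r = 0 := by
  set P := vertexAt ξ σ p.val with hP
  set k := σ p with hk
  rcases hS.edge p with ⟨s, hsW, hs⟩ | hpre
  · rw [← hP, ← hk] at hs
    have hst : s ≠ t := fun e => htW (e ▸ hsW)
    have hpt : ∀ a : ℝ, 0 ≤ a → r ≤ a → a ≤ 1 → a ≤ 1 + r →
        P + a * ξ k ∈ s.body ξ ∩ t.body ξ := by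
      intro a h₁ h₂ h₃ h₄
      refine ⟨hs.mem h₁ h₃, ?_⟩
      have := he.mem (a := a - r) (by linarith) (by linarith)
      convert this using 1
      push_cast; ring
    have hz := hpt (max 0 r) (le_max_left _ _) (le_max_right _ _) (max_le zero_le_one hr₂.le)
      (max_le (by linarith) (by linarith))
    have hz' := hpt (min 1 (1 + r)) (le_min zero_le_one (by linarith))
      (le_min hr₂.le (by linarith)) (min_le_left _ _) (min_le_right _ _)
    have hlt : max 0 r < min 1 (1 + r) :=
      max_lt (lt_min zero_lt_one (by linarith)) (lt_min hr₂ (by linarith))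
    generalize max 0 r = a at *
    generalize min 1 (1 + r) = b at *
    rcases hT.2 s (hS.subset hsW) t ht hst with h | ⟨v, -, -, h⟩ | ⟨v, l, hsv, htv, h⟩
    · rw [h] at hz; exact absurd hz (Set.notMem_empty _)
    · rw [h, Set.mem_singleton_iff] at hz hz'
      have e := hz.trans hz'.symm
      have : ((a - b : ℝ) : ℂ) * ξ k = 0 := by push_cast; linear_combination e
      rw [mul_eq_zero, Complex.ofReal_eq_zero] at this
      rcases this with h | h
      · linarith
      · have := hξ.im_pos k
        rw [h] at this
        exact absurd this (lt_irrefl _)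
    · rw [h, mem_segment_iff] at hz hz'
      obtain ⟨c, -, -, hc⟩ := hz
      obtain ⟨d, -, -, hd⟩ := hz'
      have hkl : l = k := by
        by_contra hkl
        have := (hξ.eq_zero_of_add (Ne.symm hkl) (a := a - b) (b := d - c) (by
          push_cast; linear_combination hc - hd)).1
        linarith
      rw [hkl] at hsv htv hc
      have hv : v = P + ((a - c : ℝ) : ℂ) * ξ k := by push_cast; linear_combination -hc
      rw [hv] at hsv htv
      have h₁ := hs.unique hξ hsv
      rw [h₁] at htv
      have h₂ := he.unique hξ (r := -r) (by convert htv using 1; push_cast; ring)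
      linarith
  · have hP' : P = vertexAt ξ 1 k.val := by rw [hP, vertexAt, hpre, vertexAt]
    have hline : ∀ a : ℝ, (P + a * ξ k).re - slope ξ k * (P + a * ξ k).im =
        (vertexAt ξ 1 k.val).re - slope ξ k * (vertexAt ξ 1 k.val).im := by
      intro a
      rw [hP', Complex.add_re, Complex.add_im, (hξ.ofReal_mul_eq _ _).1, (hξ.ofReal_mul_eq _ _).2]
      ring
    have hcan : ∀ a b : ℝ, P + a * ξ k = vertexAt ξ 1 k.val + b * ξ k → a = b := by
      intro a b e
      have := congrArg Complex.im e
      rw [hP', Complex.add_im, Complex.add_im, (hξ.ofReal_mul_eq _ _).2,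
        (hξ.ofReal_mul_eq _ _).2] at this
      exact mul_right_cancel₀ (hξ.im_pos k).ne' (add_left_cancel this)
    obtain ⟨a, ha₀, -, ha⟩ := mem_left_edge hξ (hT.body_subset ht he.start_mem) k (hline r)
    have h2 := hT.body_subset ht he.end_mem
    have e : P + r * ξ k + ξ k = P + ((r + 1 : ℝ) : ℂ) * ξ k := by push_cast; ring
    rw [e] at h2
    obtain ⟨b, -, hb₁, hb⟩ := mem_left_edge hξ h2 k (hline (r + 1))
    have h₁ := hcan _ _ ha
    have h₂ := hcan _ _ hb
    linarith

/-- To the right of an edge of the path that is not on the right border there is a tile that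
has it as its lower or upper left edge. -/
theorem Swept.exists_tile (hξ : IsConfiguration ξ) {T : Set (Tile n)} (hT : IsTiling ξ T)
    {σ : Equiv.Perm (Fin n)} {W : Set (Tile n)} (hS : Swept ξ T σ W) (p : Fin n) {h₁ : ℝ}
    (ha : (vertexAt ξ σ p.val).im ≤ h₁) (hb : h₁ ≤ (vertexAt ξ σ (p.val + 1)).im)
    (hlt : pathX ξ σ h₁ < pathX ξ (omegaOrder n) h₁) :
    ∃ t ∈ T, t ∉ W ∧ ((t.base = vertexAt ξ σ p.val ∧ t.i = σ p) ∨
      (t.base + ξ t.i = vertexAt ξ σ p.val ∧ t.j = σ p)) := by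
  have hn := hT.two_le
  have hfin := hT.finite hξ
  have hyp := hξ.im_pos (σ p)
  have hPab : (vertexAt ξ σ (p.val + 1)).im = (vertexAt ξ σ p.val).im + (ξ (σ p)).im := by
    rw [vertexAt_succ, Complex.add_im]
  set P := vertexAt ξ σ p.val with hP
  -- A generic height: inside the edge, where the path is still to the left of the right border, and
  -- different from the heights of the bottom, left and top vertices of all tiles. Finiteness of `T`
  -- makes the exceptions avoidable.
  obtain ⟨h₀, ⟨⟨hh₁, hh₂⟩, hh₃⟩, hgen⟩ : ∃ h₀, h₀ ∈ Set.Ioo P.im (vertexAt ξ σ (p.val + 1)).im ∩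
      {h | pathX ξ σ h < pathX ξ (omegaOrder n) h} ∧
      ∀ t ∈ T, h₀ ≠ t.base.im ∧ h₀ ≠ t.base.im + (ξ t.i).im ∧
        h₀ ≠ t.base.im + (ξ t.i).im + (ξ t.j).im := by
    have hopen : IsOpen {h | pathX ξ σ h < pathX ξ (omegaOrder n) h} :=
      isOpen_lt (continuous_pathX ξ σ) (continuous_pathX ξ _)
    have hne : (Set.Ioo P.im (vertexAt ξ σ (p.val + 1)).im ∩
        {h | pathX ξ σ h < pathX ξ (omegaOrder n) h}).Nonempty := by
      have hcl : h₁ ∈ closure (Set.Ioo P.im (vertexAt ξ σ (p.val + 1)).im) := by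
        rw [closure_Ioo (by linarith)]; exact ⟨ha, hb⟩
      rw [Set.inter_comm]
      exact mem_closure_iff.1 hcl _ hopen hlt
    have hbad : ((fun t : Tile n => t.base.im) '' T ∪
        (fun t : Tile n => t.base.im + (ξ t.i).im) '' T ∪
        (fun t : Tile n => t.base.im + (ξ t.i).im + (ξ t.j).im) '' T).Finite :=
      ((hfin.image _).union (hfin.image _)).union (hfin.image _)
    obtain ⟨h₀, hmem, hnot⟩ := (hbad.countable.dense_compl ℝ).inter_open_nonempty _
      (isOpen_Ioo.inter hopen) hne
    refine ⟨h₀, hmem, fun t ht => ⟨?_, ?_, ?_⟩⟩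
    · rintro rfl; exact hnot (Or.inl (Or.inl ⟨t, ht, rfl⟩))
    · rintro rfl; exact hnot (Or.inl (Or.inr ⟨t, ht, rfl⟩))
    · rintro rfl; exact hnot (Or.inr ⟨t, ht, rfl⟩)
  change pathX ξ σ h₀ < pathX ξ (omegaOrder n) h₀ at hh₃
  -- `ε` is so small that no left border of a tile lies strictly right of the path and within
  -- distance `ε` of it at this height. An unswept tile that covers the point at distance `ε` must
  -- then have its left border on the path.
  obtain ⟨ε, ⟨hε₁, hε₂⟩, hε₀⟩ : ∃ ε : ℝ, ((∀ t ∈ T, pathX ξ σ h₀ < tileL ξ t h₀ →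
      pathX ξ σ h₀ + ε < tileL ξ t h₀) ∧
      pathX ξ σ h₀ + ε < pathX ξ (omegaOrder n) h₀) ∧ 0 < ε := by
    have hsmall : ∀ c : ℝ, pathX ξ σ h₀ < c → ∀ᶠ ε in 𝓝[>] (0 : ℝ), pathX ξ σ h₀ + ε < c := by
      intro c hc
      have : ∀ᶠ ε in 𝓝[>] (0 : ℝ), ε < c - pathX ξ σ h₀ :=
        nhdsWithin_le_nhds (Iio_mem_nhds (by linarith))
      filter_upwards [this] with ε hε
      linarith
    have h₁ : ∀ᶠ ε in 𝓝[>] (0 : ℝ), ∀ t ∈ T, pathX ξ σ h₀ < tileL ξ t h₀ →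
        pathX ξ σ h₀ + ε < tileL ξ t h₀ :=
      (Filter.eventually_all_finite hfin).2 fun t _ => by
        by_cases hc : pathX ξ σ h₀ < tileL ξ t h₀
        · filter_upwards [hsmall _ hc] with ε hε _ using hε
        · exact Filter.Eventually.of_forall fun ε h => absurd h hc
    exact ((h₁.and (hsmall _ hh₃)).and self_mem_nhdsWithin).exists
  have hH₀ : 0 ≤ h₀ := by
    have := vertexAt_im_mono hξ σ (Nat.zero_le p.val)
    rw [vertexAt_zero, Complex.zero_im] at this
    linarith
  have hH₁ : h₀ ≤ (∑ x, ξ x).im := by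
    have := vertexAt_im_mono hξ σ (show p.val + 1 ≤ n from p.isLt)
    rw [vertexAt_of_le σ le_rfl] at this
    linarith
  obtain ⟨t, ht, htW, hzt⟩ := hS.cover ⟨pathX ξ σ h₀ + ε, h₀⟩
    ((mem_zonogon_iff hξ (by omega)).2 ⟨⟨hH₀, hH₁⟩,
      (pathX_bounds hξ (by omega) σ hH₀ hH₁).1.trans (by simp only; linarith), hε₂.le⟩)
    (by simp only; linarith)
  obtain ⟨⟨hr₁, hr₂⟩, hr₃, -⟩ := (mem_body_iff hξ t).1 hzt
  simp only at hr₁ hr₂ hr₃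
  obtain ⟨hg₁, hg₂, hg₃⟩ := hgen t ht
  have hr₁ := lt_of_le_of_ne hr₁ hg₁.symm
  have hr₂ := lt_of_le_of_ne hr₂ hg₃
  have hyi := hξ.im_pos t.i
  have hyj := hξ.im_pos t.j
  have heq : tileL ξ t h₀ = pathX ξ σ h₀ := by
    refine le_antisymm (not_lt.1 fun hc => ?_) (hS.right t ht htW h₀ hr₁ hr₂)
    have := hε₁ t ht hc
    linarith
  -- The left edge of `t` touches the path at height `h₀` and stays on its right at `h₀ ± η`, where
  -- both are still straight. So the slopes agree, hence the colours, and `edge_shift` makes the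
  -- edges equal.
  have key : ∀ (v : ℂ) (k : Fin n), t.HasEdge ξ v k → t.base.im ≤ v.im →
      v.im + (ξ k).im ≤ t.base.im + (ξ t.i).im + (ξ t.j).im → v.im < h₀ → h₀ < v.im + (ξ k).im →
      (∀ h, v.im ≤ h → h ≤ v.im + (ξ k).im → tileL ξ t h = v.re + slope ξ k * (h - v.im)) →
      k = σ p ∧ v = P := by
    intro v k he hv₁ hv₂ hv₃ hv₄ hlin
    have hyk := hξ.im_pos k
    have hX : ∀ h, P.im ≤ h → h ≤ P.im + (ξ (σ p)).im →
        pathX ξ σ h = P.re + slope ξ (σ p) * (h - P.im) := fun h ha hb =>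
      pathX_of_mem hξ σ p ha (by rw [hPab]; exact hb)
    rw [hPab] at hh₂
    have e₀ := heq
    rw [hlin h₀ hv₃.le hv₄.le, hX h₀ hh₁.le hh₂.le] at e₀
    obtain ⟨η, hη₀, hη₁, hη₂, hη₃, hη₄⟩ : ∃ η : ℝ, 0 < η ∧ η < h₀ - v.im ∧
        η < v.im + (ξ k).im - h₀ ∧ η < h₀ - P.im ∧ η < P.im + (ξ (σ p)).im - h₀ := by
      have : ∀ c : ℝ, 0 < c → ∀ᶠ η in 𝓝[>] (0 : ℝ), η < c := fun c hc =>
        nhdsWithin_le_nhds (Iio_mem_nhds hc)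
      exact ((eventually_mem_nhdsWithin).and ((this _ (by linarith)).and ((this _ (by linarith)).and
        ((this _ (by linarith)).and (this _ (by linarith)))))).exists
    have i₁ := hS.right t ht htW (h₀ + η) (by linarith) (by linarith)
    have i₂ := hS.right t ht htW (h₀ - η) (by linarith) (by linarith)
    rw [hlin _ (by linarith) (by linarith), hX _ (by linarith) (by linarith)] at i₁ i₂
    have hs₁ : 0 ≤ η * (slope ξ k - slope ξ (σ p)) := by linarith
    have hs₂ : η * (slope ξ k - slope ξ (σ p)) ≤ 0 := by linarith
    have hslope : slope ξ k = slope ξ (σ p) := by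
      have := le_antisymm hs₂ hs₁
      rw [mul_eq_zero] at this
      rcases this with h | h <;> linarith
    have hk : k = σ p := hξ.slope_strictMono.injective hslope
    refine ⟨hk, ?_⟩
    subst hk
    set r := (v.im - P.im) / (ξ (σ p)).im with hr
    have hrm : r * (ξ (σ p)).im = v.im - P.im := div_mul_cancel₀ _ hyp.ne'
    have hv : v = P + r * ξ (σ p) := by
      apply Complex.ext
      · rw [Complex.add_re, (hξ.ofReal_mul_eq _ _).1, hrm]; linarith
      · rw [Complex.add_im, (hξ.ofReal_mul_eq _ _).2, hrm]; linarith
    rw [hv] at he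
    have hr0 := hS.edge_shift hξ hT ht htW p (by nlinarith) (by nlinarith) he
    rw [hv, hr0]; simp
  refine ⟨t, ht, htW, ?_⟩
  rcases lt_or_gt_of_ne hg₂ with hc | hc
  · obtain ⟨h₁, h₂⟩ := key t.base t.i (Or.inl ⟨rfl, Or.inl rfl⟩) le_rfl (by linarith) hr₁ hc
      fun h h₁ h₂ => tileL_of_le t h₁ h₂
    exact Or.inl ⟨h₂, h₁⟩
  · have him : (t.base + ξ t.i).im = t.base.im + (ξ t.i).im := Complex.add_im _ _
    obtain ⟨h₁, h₂⟩ := key (t.base + ξ t.i) t.j (Or.inr ⟨rfl, Or.inr rfl⟩) (by rw [him]; linarith)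
      (by rw [him]) (by rw [him]; exact hc) (by rw [him]; exact hr₂)
      fun h h₁ h₂ => tileL_of_ge hξ t (by rwa [him] at h₁) (by rwa [him] at h₂)
    exact Or.inr ⟨h₂, h₁⟩

/-- The left corner of a tile. -/
theorem tileL_corner (hξ : IsConfiguration ξ) (t : Tile n) :
    tileL ξ t (t.base + ξ t.i).im = (t.base + ξ t.i).re ∧ t.base.im < (t.base + ξ t.i).im ∧
      (t.base + ξ t.i).im < t.base.im + (ξ t.i).im + (ξ t.j).im := by
  have hyi := hξ.im_pos t.i
  have hyj := hξ.im_pos t.j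
  rw [tileL_of_le t (by rw [Complex.add_im]; linarith) (by rw [Complex.add_im]), Complex.add_re,
    Complex.add_im, hξ.re_eq]
  exact ⟨by ring, by linarith, by linarith⟩

/-- To the right of its left corner, at the same height, a tile has further points, and they belong
to the zonogon. So the corner is not on the right border. -/
theorem IsTiling.path_lt_of_corner (hξ : IsConfiguration ξ) {T : Set (Tile n)}
    (hT : IsTiling ξ T) {σ : Equiv.Perm (Fin n)} {t : Tile n} (ht : t ∈ T) {m : ℕ} (hm : m ≤ n)
    (he : t.base + ξ t.i = vertexAt ξ σ m) :
    pathX ξ σ (vertexAt ξ σ m).im < pathX ξ (omegaOrder n) (vertexAt ξ σ m).im := by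
  have hn := hT.two_le
  obtain ⟨h₁, h₂, h₃⟩ := tileL_corner hξ t
  rw [he] at h₁ h₂ h₃
  rw [pathX_vertexAt hξ (by omega) σ hm, ← h₁]
  exact (tileL_lt_tileR hξ t h₂ h₃).trans_le
    (re_of_mem_zonogon hξ (by omega) (hT.body_subset ht (tileL_mem hξ t h₂ h₃).2)).2

/-- Two tiles with the same left corner share a horizontal segment starting there. -/
theorem IsTiling.eq_of_corner (hξ : IsConfiguration ξ) {T : Set (Tile n)} (hT : IsTiling ξ T)
    {s t : Tile n} (hs : s ∈ T) (ht : t ∈ T) (he : s.base + ξ s.i = t.base + ξ t.i) : s = t := by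
  obtain ⟨h₁, h₂, h₃⟩ := tileL_corner hξ s
  obtain ⟨h₁', h₂', h₃'⟩ := tileL_corner hξ t
  rw [← he] at h₁' h₂' h₃'
  have l₁ := tileL_lt_tileR hξ s h₂ h₃
  have l₂ := tileL_lt_tileR hξ t h₂' h₃'
  set v := s.base + ξ s.i
  refine hT.eq_of_mem hξ hs ht (z := v) (z' := ⟨min (tileR ξ s v.im) (tileR ξ t v.im), v.im⟩)
    ((mem_body_iff hξ s).2 ⟨⟨h₂.le, h₃.le⟩, h₁.le, by linarith⟩)
    ((mem_body_iff hξ t).2 ⟨⟨h₂'.le, h₃'.le⟩, h₁'.le, by linarith⟩)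
    ((mem_body_iff hξ s).2 ⟨⟨h₂.le, h₃.le⟩, le_min l₁.le (by linarith), min_le_left _ _⟩)
    ((mem_body_iff hξ t).2 ⟨⟨h₂'.le, h₃'.le⟩, le_min (by linarith) l₂.le, min_le_right _ _⟩) rfl ?_
  intro e
  have := congrArg Complex.re e
  have h := lt_min l₁ (show tileL ξ s v.im < tileR ξ t v.im by linarith)
  simp only at this
  linarith

/-- Some tile has two consecutive edges of the path as its left border. -/
theorem Swept.exists_isStepTile (hξ : IsConfiguration ξ) {T : Set (Tile n)} (hT : IsTiling ξ T)
    {σ : Equiv.Perm (Fin n)} {W : Set (Tile n)} (hS : Swept ξ T σ W) (hne : σ ≠ omegaOrder n) :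
    ∃ k : Fin (n - 1), ∃ t ∈ T, t ∉ W ∧ IsStepTile ξ σ k t := by
  have hn := hT.two_le
  -- `L p` and `U p` say that the edge with number `p` is the lower, respectively the upper, left
  -- edge of an unswept tile. An edge with an end off the right border has one of these properties.
  let L : Fin n → Prop := fun p => ∃ t ∈ T, t ∉ W ∧ t.base = vertexAt ξ σ p.val ∧ t.i = σ p
  let U : Fin n → Prop := fun p =>
    ∃ t ∈ T, t ∉ W ∧ t.base + ξ t.i = vertexAt ξ σ p.val ∧ t.j = σ p
  have hLU : ∀ (p : Fin n) (m : ℕ), (m = p.val ∨ m = p.val + 1) →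
      pathX ξ σ (vertexAt ξ σ m).im < pathX ξ (omegaOrder n) (vertexAt ξ σ m).im → L p ∨ U p := by
    intro p m hm hlt
    obtain ⟨t, ht, htW, h⟩ := hS.exists_tile hξ hT p
      (vertexAt_im_mono hξ σ (by omega)) (vertexAt_im_mono hξ σ (by omega)) hlt
    exact h.imp (fun h => ⟨t, ht, htW, h⟩) fun h => ⟨t, ht, htW, h⟩
  have hL : ∀ p, L p → p.val + 1 < n ∧ pathX ξ σ (vertexAt ξ σ (p.val + 1)).im <
      pathX ξ (omegaOrder n) (vertexAt ξ σ (p.val + 1)).im := by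
    rintro p ⟨t, ht, -, hb, hi⟩
    have he : t.base + ξ t.i = vertexAt ξ σ (p.val + 1) := by rw [vertexAt_succ, hb, hi]
    refine ⟨?_, hT.path_lt_of_corner hξ ht p.isLt he⟩
    by_contra hc
    have h₁ := (im_of_mem_zonogon hξ (hT.body_subset ht
      (Tile.HasVertex.mem (Or.inr (Or.inr (Or.inr rfl)))))).2
    have h₂ := hξ.im_pos t.j
    rw [he, vertexAt_of_le σ (not_lt.1 hc), Complex.add_im] at h₁
    linarith
  have hU : ∀ p, U p → 0 < p.val ∧ pathX ξ σ (vertexAt ξ σ p.val).im <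
      pathX ξ (omegaOrder n) (vertexAt ξ σ p.val).im := by
    rintro p ⟨t, ht, -, hb, hj⟩
    refine ⟨?_, hT.path_lt_of_corner hξ ht p.isLt.le hb⟩
    by_contra hc
    have h₁ := (im_of_mem_zonogon hξ (hT.body_subset ht (Tile.HasVertex.mem (Or.inl rfl)))).1
    have h₂ := hξ.im_pos t.i
    have h₃ := congrArg Complex.im hb
    rw [show p.val = 0 by omega, vertexAt_zero, Complex.add_im, Complex.zero_im] at h₃
    linarith
  -- Suppose that `L` never holds. If `U p`, the lower end of the edge is a left corner and hence
  -- off the right border, so the preceding edge satisfies `U` too; descending to the bottom is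
  -- impossible. But an ascent of `σ` provides a vertex off the right border.
  have hex : ∃ p, L p := by
    by_contra hno
    push Not at hno
    have hnoU : ∀ m, ∀ p : Fin n, p.val = m → ¬ U p := by
      intro m
      induction m with
      | zero => intro p hp hu; have := (hU p hu).1; omega
      | succ m ih =>
        intro p hp hu
        have hlt := (hU p hu).2
        have hm : m < n := by have := p.isLt; omega
        rcases hLU ⟨m, hm⟩ (m + 1) (Or.inr rfl) (by rwa [hp] at hlt) with h | h
        · exact hno _ h
        · exact ih _ rfl h
    obtain ⟨k, hk⟩ := exists_ascent hne
    have hk' := k.isLt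
    have h₁ := pathX_lt_step hξ hk (vertexAt_im_lt hξ σ (Nat.lt_succ_self k.val) (by omega))
      (vertexAt_im_lt hξ σ (Nat.lt_succ_self (k.val + 1)) (by omega))
    have h₀ := vertexAt_im_mono hξ σ (Nat.zero_le (k.val + 1))
    have h₂ := vertexAt_im_mono hξ σ (show k.val + 1 ≤ n by omega)
    rw [vertexAt_zero, Complex.zero_im] at h₀
    rw [vertexAt_of_le σ le_rfl] at h₂
    rcases hLU (lo k) (k.val + 1) (Or.inr rfl)
      (h₁.trans_le (pathX_bounds hξ (by omega) _ h₀ h₂).2) with h | h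
    · exact hno _ h
    · exact hnoU _ _ rfl h
  -- At the last `p` with `L p` the next edge satisfies `U`. The tiles of the two edges have the
  -- same left corner, so they are one tile with both edges as its left border.
  obtain ⟨p, hp, hmax⟩ := Set.exists_max_image {p | L p} id (Set.toFinite _) hex
  obtain ⟨hp₁, hp₂⟩ := hL p hp
  rcases hLU ⟨p.val + 1, hp₁⟩ (p.val + 1) (Or.inl rfl) hp₂ with h | h
  · have := hmax _ h
    rw [id, id, Fin.le_def] at this
    simp only at this
    omega
  · obtain ⟨t, ht, htW, hb, hi⟩ := hp
    obtain ⟨s, hs, -, hb', hj⟩ := h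
    have he : t.base + ξ t.i = s.base + ξ s.i := by rw [hb', hb, hi]; exact (vertexAt_succ σ p).symm
    obtain rfl := hT.eq_of_corner hξ ht hs he
    exact ⟨⟨p.val, by omega⟩, t, ht, htW, hb, hi, hj⟩

theorem Swept.step (hξ : IsConfiguration ξ) {T : Set (Tile n)} (hT : IsTiling ξ T)
    {σ : Equiv.Perm (Fin n)} {W : Set (Tile n)} (hS : Swept ξ T σ W) {k : Fin (n - 1)}
    {t : Tile n} (ht : t ∈ T) (hk : IsStepTile ξ σ k t) :
    Swept ξ T (σ * adjSwap k) (insert t W) := by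
  have hlt : σ (lo k) < σ (hi k) := by rw [← hk.2.1, ← hk.2.2]; exact t.lt
  refine ⟨Set.insert_subset ht hS.subset, fun s hs hsW h h₁ h₂ => ?_, fun z hz hlz => ?_,
    fun p => ?_⟩
  · rw [Set.mem_insert_iff, not_or] at hsW
    have hr := hS.right s hs hsW.2 h h₁ h₂
    by_cases hin : t.base.im < h ∧ h < t.base.im + (ξ t.i).im + (ξ t.j).im
    -- An unswept tile other than `t` that begins to the left of the new path would share a
    -- horizontal segment with `t`.
    · by_contra hc
      rw [not_le, ← hk.tileR_eq hξ hin.1.le hin.2.le] at hc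
      rw [← hk.tileL_eq hξ hin.1.le hin.2.le] at hr
      have hls := tileL_lt_tileR hξ s h₁ h₂
      refine hsW.1 (hT.eq_of_mem hξ hs ht (z := ⟨tileL ξ s h, h⟩)
        (z' := ⟨min (tileR ξ s h) (tileR ξ t h), h⟩)
        ((mem_body_iff hξ s).2 ⟨⟨h₁.le, h₂.le⟩, le_rfl, hls.le⟩)
        ((mem_body_iff hξ t).2 ⟨⟨hin.1.le, hin.2.le⟩, hr, hc.le⟩)
        ((mem_body_iff hξ s).2 ⟨⟨h₁.le, h₂.le⟩, (lt_min hls hc).le, min_le_left _ _⟩)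
        ((mem_body_iff hξ t).2 ⟨⟨hin.1.le, hin.2.le⟩, hr.trans (lt_min hls hc).le,
          min_le_right _ _⟩) rfl fun e => ?_)
      have := congrArg Complex.re e
      have h := lt_min hls hc
      simp only at this
      linarith
    · rw [pathX_step_outside hξ]
      · exact hr
      · rw [← hk.top, ← hk.1]
        rw [not_and_or, not_lt, not_lt] at hin
        exact hin
  · obtain ⟨s, hs, hsW, hzs⟩ := hS.cover z hz ((pathX_le_step hξ hlt _).trans_lt hlz)
    refine ⟨s, hs, ?_, hzs⟩
    rintro (rfl | h)
    · have := ((hk.mem_body_iff hξ).1 hzs).2.2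
      linarith
    · exact hsW h
  · rcases eq_or_prefix_mul_adjSwap σ k p with hp | ⟨hp, hp'⟩
    · exact Or.inl ⟨t, Set.mem_insert _ _, (hk.hasEdge hp).2⟩
    · rw [vertexAt, hp, hp']
      exact (hS.edge p).imp_left fun ⟨s, hs, h⟩ => ⟨s, Set.mem_insert_of_mem _ hs, h⟩

/-- The sweep continues until the path is that of `ω`. Then no tile is left, because an unswept one
would reach beyond the right border. -/
theorem Swept.exists_word (hξ : IsConfiguration ξ) {T : Set (Tile n)} (hT : IsTiling ξ T)
    {σ : Equiv.Perm (Fin n)} {W : Set (Tile n)} (hS : Swept ξ T σ W) :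
    ∃ w, AscendsIn Set.univ σ w ∧ σ * wordProd w = omegaOrder n ∧ T \ W = tilesOf ξ σ w := by
  have hn := hT.two_le
  have hend : ∀ {W}, Swept ξ T (omegaOrder n) W → T \ W = ∅ := by
    intro W hS
    rw [Set.eq_empty_iff_forall_notMem]
    rintro t ⟨ht, htW⟩
    obtain ⟨-, h₂, h₃⟩ := tileL_corner hξ t
    have h₁ := hS.right t ht htW _ h₂ h₃
    have h₄ := tileL_lt_tileR hξ t h₂ h₃
    have h₅ := (re_of_mem_zonogon hξ (by omega) (hT.body_subset ht (tileL_mem hξ t h₂ h₃).2)).2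
    simp only at h₅
    linarith
  obtain ⟨N, hN⟩ : ∃ N, (Inv (omegaOrder n)).ncard ≤ (Inv σ).ncard + N :=
    ⟨_, Nat.le_add_left _ _⟩
  induction N generalizing σ W with
  | zero =>
    by_cases hne : σ = omegaOrder n
    · subst hne
      exact ⟨[], trivial, by rw [wordProd_nil, mul_one], hend hS⟩
    · obtain ⟨k, hk⟩ := exists_ascent hne
      have h₁ := ncard_Inv_mul_adjSwap hk
      have h₂ := Set.ncard_le_ncard (Inv_subset_omega (σ * adjSwap k)) (Set.toFinite _)
      omega
  | succ N ih =>
    by_cases hne : σ = omegaOrder n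
    · subst hne
      exact ⟨[], trivial, by rw [wordProd_nil, mul_one], hend hS⟩
    · obtain ⟨k, t, ht, htW, hk⟩ := hS.exists_isStepTile hξ hT hne
      have hlt : σ (lo k) < σ (hi k) := by rw [← hk.2.1, ← hk.2.2]; exact t.lt
      obtain ⟨w, hw, hwω, he⟩ := ih (hS.step hξ hT ht hk)
        (by rw [ncard_Inv_mul_adjSwap hlt]; omega)
      refine ⟨k :: w, ⟨trivial, hlt, hw⟩, by rw [mul_wordProd_cons, hwω], ?_⟩
      rw [tilesOf, ← he]
      ext s
      simp only [Set.mem_sdiff, Set.mem_union, Set.mem_insert_iff, Set.mem_ofPred_eq, not_or]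
      constructor
      · rintro ⟨h₁, h₂⟩
        by_cases hst : s = t
        · exact Or.inl (hst ▸ hk)
        · exact Or.inr ⟨h₁, hst, h₂⟩
      · rintro (h | h)
        · obtain rfl := h.eq hk
          exact ⟨ht, htW⟩
        · exact ⟨h.1, h.2.2⟩

/-- Every rhombus tiling consists of the tiles swept by a reduced word. -/
theorem IsTiling.exists_word (hξ : IsConfiguration ξ) {T : Set (Tile n)} (hT : IsTiling ξ T) :
    ∃ w, IsReducedWordOfOmega w ∧ T = tilesOf ξ 1 w := by
  obtain ⟨w, hw, hwω, he⟩ := (swept_one hξ hT).exists_word hξ hT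
  rw [one_mul] at hwω
  rw [Set.sdiff_empty] at he
  exact ⟨w, isReducedWordOfOmega_iff.2 ⟨hw, hwω⟩, he⟩

end Sweep

section Snakes

variable {n : ℕ} {ξ : Fin n → ℂ}

/-! ### Snakes -/

theorem isDirectedPath_iff (T : Set (Tile n)) (v : ℂ) (l : List (Fin n)) :
    IsDirectedPath ξ T v l ↔
      (∀ (m : ℕ) (hm : m < l.length), IsEdgeOf ξ T (v + ((l.map ξ).take m).sum) l[m]) ∧
        IsVertexOf ξ T (v + (l.map ξ).sum) := by
  induction l generalizing v with
  | nil => simp [IsDirectedPath]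
  | cons k l ih =>
    rw [IsDirectedPath, ih, ← and_assoc]
    refine and_congr ⟨?_, ?_⟩ ?_
    · rintro ⟨h₀, h⟩ m hm
      cases m with
      | zero => simpa using h₀
      | succ m =>
        have := h m (by simpa using hm)
        simpa [add_assoc] using this
    · intro h
      have h₀ := h 0 (by simp)
      rw [List.getElem_cons_zero] at h₀
      refine ⟨by simpa using h₀, fun m hm => ?_⟩
      have := h (m + 1) (by simpa using hm)
      simpa [add_assoc] using this
    · simp [add_assoc]

theorem sum_take_ofFn (σ : Equiv.Perm (Fin n)) {m : ℕ} (hm : m ≤ n) :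
    (((List.ofFn σ).map ξ).take m).sum = vertexAt ξ σ m := by
  induction m with
  | zero => simp [vertexAt_zero]
  | succ m ih =>
    rw [List.sum_take_succ _ _ (by simpa using hm), ih (by omega)]
    have := vertexAt_succ (ξ := ξ) σ ⟨m, hm⟩
    simp only at this
    rw [this]
    simp

theorem sum_ofFn (σ : Equiv.Perm (Fin n)) : ((List.ofFn σ).map ξ).sum = ∑ x, ξ x := by
  rw [← vertexAt_of_le σ (le_refl n), ← sum_take_ofFn σ le_rfl, List.take_of_length_le]
  simp

theorem IsEdgeOf.mem_zonogon {T : Set (Tile n)} (hT : IsTiling ξ T) {v : ℂ} {k : Fin n}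
    (h : IsEdgeOf ξ T v k) : v ∈ zonogon ξ ∧ v + ξ k ∈ zonogon ξ := by
  obtain ⟨t, ht, he⟩ := h
  exact ⟨hT.body_subset ht he.start_mem, hT.body_subset ht he.end_mem⟩

/-- A linear order belongs to `Σ(T)` if and only if its path runs along edges of `T`. -/
theorem mem_snakeDomain_iff (hξ : IsConfiguration ξ) {T : Set (Tile n)} (hT : IsTiling ξ T)
    {σ : Equiv.Perm (Fin n)} :
    σ ∈ snakeDomain ξ T ↔ ∀ p : Fin n, IsEdgeOf ξ T (vertexAt ξ σ p.val) (σ p) := by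
  have hn := hT.two_le
  constructor
  · rintro ⟨v, hpath, -, -⟩ p
    rw [isDirectedPath_iff] at hpath
    obtain ⟨he, t, ht, hv⟩ := hpath
    rw [sum_ofFn] at hv
    have h0 := he 0 (by simp; omega)
    simp only [List.take_zero, List.sum_nil, add_zero] at h0
    have h₁ := im_of_mem_zonogon hξ (h0.mem_zonogon hT).1
    have h₂ := im_of_mem_zonogon hξ (hT.body_subset ht hv.mem)
    rw [Complex.add_im] at h₂
    -- The vectors of a snake with this colour sequence add up to the full height of the zonogon, so
    -- it has to start at height 0, where the bottom vertex is the only point.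
    have hv0 : v = 0 :=
      eq_zero_of_mem_zonogon hξ (by omega) (h0.mem_zonogon hT).1 (by linarith)
    have := he p.val (by simp)
    rw [sum_take_ofFn σ p.isLt.le, hv0, zero_add] at this
    simpa using this
  · intro h
    have hlast := h ⟨n - 1, by omega⟩
    refine ⟨0, (isDirectedPath_iff _ _ _).2 ⟨fun m hm => ?_, ?_⟩, fun u k hu e => ?_, fun k hk => ?_⟩
    · have hm' : m < n := by simpa using hm
      rw [sum_take_ofFn σ hm'.le, zero_add]
      simpa using h ⟨m, hm'⟩
    · obtain ⟨t, ht, he⟩ := hlast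
      refine ⟨t, ht, ?_⟩
      have := he.hasVertex.2
      rw [← vertexAt_succ, vertexAt_of_le σ (by simp only; omega)] at this
      rwa [zero_add, sum_ofFn]
    · have h₁ := (im_of_mem_zonogon hξ (hu.mem_zonogon hT).1).1
      have h₂ := hξ.im_pos k
      have := congrArg Complex.im e
      rw [Complex.add_im, Complex.zero_im] at this
      linarith
    · have h₁ := (im_of_mem_zonogon hξ (hk.mem_zonogon hT).2).2
      have h₂ := hξ.im_pos k
      rw [zero_add, sum_ofFn, Complex.add_im] at h₁
      linarith

/-- Sets of a separated system have different vertices. -/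
theorem eq_of_sum_eq (hξ : IsConfiguration ξ) {A B : Finset (Fin n)} (h₁ : ¬ Crosses A B)
    (h₂ : ¬ Crosses B A) (h : ∑ x ∈ A, ξ x = ∑ x ∈ B, ξ x) : A = B := by
  -- Suppose that x = max (A \ B) is less than some u in B \ A. Without crossings all of B \ A
  -- exceeds x, and the functional z ↦ re z − `slope ξ x` · im z is nonpositive on the sum over A \
  -- B but positive on the sum over B \ A, although these sums agree.
  have key : ∀ A B : Finset (Fin n), ¬ Crosses A B → ∑ x ∈ A, ξ x = ∑ x ∈ B, ξ x →
      ∀ x ∈ A \ B, ∀ u ∈ B \ A, (∀ y ∈ A \ B, y ≤ x) → x < u → False := by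
    intro A B hc h x hx u hu hmax hxu
    have e : ∑ y ∈ A \ B, ξ y = ∑ y ∈ B \ A, ξ y := Finset.sum_sdiff_eq_sum_sdiff_iff.2 h
    have hlt : ∀ b ∈ B \ A, x < b := by
      intro b hb
      rw [Finset.mem_sdiff] at hx hu hb
      by_contra hbx
      have hne : b ≠ x := by rintro rfl; exact hb.2 hx.1
      exact hc ⟨b, x, u, lt_of_le_of_ne (not_lt.1 hbx) hne, hxu, hx, hb.symm, hu.symm⟩
    have hval : ∀ C : Finset (Fin n), (∑ y ∈ C, ξ y).re - slope ξ x * (∑ y ∈ C, ξ y).im =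
        ∑ y ∈ C, (slope ξ y - slope ξ x) * (ξ y).im := by
      intro C
      rw [Complex.re_sum, Complex.im_sum, Finset.mul_sum, ← Finset.sum_sub_distrib]
      refine Finset.sum_congr rfl fun y _ => ?_
      rw [hξ.re_eq]; ring
    have hA : ∑ y ∈ A \ B, (slope ξ y - slope ξ x) * (ξ y).im ≤ 0 := by
      refine Finset.sum_nonpos fun y hy => ?_
      have := hξ.slope_strictMono.monotone (hmax y hy)
      exact mul_nonpos_of_nonpos_of_nonneg (by linarith) (hξ.im_pos y).le
    have hB : 0 < ∑ y ∈ B \ A, (slope ξ y - slope ξ x) * (ξ y).im := by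
      refine Finset.sum_pos (fun y hy => ?_) ⟨u, hu⟩
      have := hξ.slope_strictMono (hlt y hy)
      exact mul_pos (by linarith) (hξ.im_pos y)
    rw [← hval, e, hval] at hA
    linarith
  have hpos : ∀ C : Finset (Fin n), C.Nonempty → 0 < (∑ y ∈ C, ξ y).im := by
    intro C hC
    rw [Complex.im_sum]
    exact Finset.sum_pos (fun y _ => hξ.im_pos y) hC
  by_contra hne
  have e : ∑ y ∈ A \ B, ξ y = ∑ y ∈ B \ A, ξ y := Finset.sum_sdiff_eq_sum_sdiff_iff.2 h
  have hnA : (A \ B).Nonempty := by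
    rw [Finset.nonempty_iff_ne_empty]
    intro hA
    rw [hA, Finset.sum_empty] at e
    have hB : B \ A = ∅ := by
      by_contra hB
      have := hpos _ (Finset.nonempty_iff_ne_empty.2 hB)
      rw [← e, Complex.zero_im] at this
      exact lt_irrefl _ this
    exact hne (Finset.Subset.antisymm (Finset.sdiff_eq_empty_iff_subset.1 hA)
      (Finset.sdiff_eq_empty_iff_subset.1 hB))
  have hnB : (B \ A).Nonempty := by
    rw [Finset.nonempty_iff_ne_empty]
    intro hB
    rw [hB, Finset.sum_empty] at e
    have := hpos _ hnA
    rw [e, Complex.zero_im] at this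
    exact lt_irrefl _ this
  have hx := Finset.max'_mem _ hnA
  have hu := Finset.max'_mem _ hnB
  rcases lt_trichotomy ((A \ B).max' hnA) ((B \ A).max' hnB) with hlt | heq | hlt
  · exact key A B h₁ h _ hx _ hu (fun y hy => Finset.le_max' _ y hy) hlt
  · rw [heq, Finset.mem_sdiff] at hx
    rw [Finset.mem_sdiff] at hu
    exact hx.2 hu.1
  · exact key B A h₂ h.symm _ hu _ hx (fun y hy => Finset.le_max' _ y hy) hlt

/-- An edge of a swept tile lies on the path just before or just after the exchange, and both paths
belong to orders of `chainDomain S`; so its two ends are vertices of members of `S`. -/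
theorem edge_of_tilesOf {S : Set (Finset (Fin n))} {σ : Equiv.Perm (Fin n)}
    {w : List (Fin (n - 1))} (h : AscendsIn (chainDomain S) σ w) {v : ℂ} {k : Fin n}
    (he : IsEdgeOf ξ (tilesOf ξ σ w) v k) :
    ∃ A ∈ S, insert k A ∈ S ∧ v = ∑ x ∈ A, ξ x := by
  induction w generalizing σ with
  | nil => obtain ⟨t, ht, -⟩ := he; exact absurd ht (Set.notMem_empty _)
  | cons a w ih =>
    obtain ⟨t, ht | ht, he⟩ := he
    · have hpt : ∀ τ ∈ chainDomain S, ∀ p : Fin n, ∃ A ∈ S, insert (τ p) A ∈ S ∧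
          vertexAt ξ τ p.val = ∑ x ∈ A, ξ x := fun τ hτ p =>
        ⟨prefixSet τ p.val, hτ _, by rw [← prefixSet_succ]; exact hτ _, rfl⟩
      have h₁ := hpt σ h.1
      have h₂ := hpt _ h.2.2.mem
      obtain ⟨e₁, e₂, e₃⟩ := ht
      rcases he with ⟨rfl, rfl | rfl⟩ | ⟨rfl, rfl | rfl⟩
      · simpa only [e₁, e₂, lo_val] using h₁ (lo a)
      · have := h₂ (hi a)
        rw [hi_val, vertexAt_mul_adjSwap_lo, Equiv.Perm.mul_apply, adjSwap_hi] at this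
        simpa only [e₁, e₂, e₃] using this
      · have := h₂ (lo a)
        rw [lo_val, vertexAt_mul_adjSwap _ (by omega), Equiv.Perm.mul_apply, adjSwap_lo] at this
        simpa only [e₁, e₃] using this
      · have := h₁ (hi a)
        rw [hi_val, vertexAt_lo] at this
        simpa only [e₁, e₂, e₃] using this
    · exact ih h.2.2 ⟨t, ht, he⟩

/-- Domains of tiling type are peak-pit domains. -/
theorem isPeakPit_snakeDomain (hξ : IsConfiguration ξ) {T : Set (Tile n)} (hT : IsTiling ξ T) :
    IsPeakPit (snakeDomain ξ T) := by
  obtain ⟨w, hw, rfl⟩ := hT.exists_word hξ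
  obtain ⟨S, hS, hwS⟩ := hw.exists_separated
  refine (isPeakPit_chainDomain hS).mono fun σ hσ => ?_
  rw [mem_snakeDomain_iff hξ hT] at hσ
  have h0 : ∅ ∈ S := by rw [← prefixSet_zero (1 : Equiv.Perm (Fin n))]; exact hwS.mem 0
  have key : ∀ m ≤ n, prefixSet σ m ∈ S := by
    intro m hm
    induction m with
    | zero => rwa [prefixSet_zero]
    | succ m ih =>
      have ih := ih (by omega)
      obtain ⟨A, hA, hA', e⟩ := edge_of_tilesOf hwS (hσ ⟨m, hm⟩)
      -- The initial segment of the snake and the set supplied by the edge have the same vertex and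
      -- both belong to `S`, so they are equal. Only this turns a path of vertices into a chain of
      -- members of `S`.
      have : prefixSet σ m = A :=
        eq_of_sum_eq hξ (hS _ ih _ hA) (hS _ hA _ ih) e
      rw [← this] at hA'
      exact (prefixSet_succ σ ⟨m, hm⟩).symm ▸ hA'
  intro m
  rcases le_total m n with hm | hm
  · exact key m hm
  · rw [prefixSet_of_le σ hm, ← prefixSet_of_le σ (le_refl n)]
    exact key n le_rfl

/-- Every peak-pit domain is contained in a domain of tiling type. -/
theorem IsPeakPit.exists_tiling (hξ : IsConfiguration ξ) (hn : 2 ≤ n)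
    {D : Set (Equiv.Perm (Fin n))} (h : IsPeakPit D) :
    ∃ T, IsTiling ξ T ∧ D ⊆ snakeDomain ξ T := by
  -- `D` need not contain `α`, where the words start, so it is adjoined first.
  obtain ⟨w, hw, hall⟩ := h.union_extremes.exists_word (Or.inr (Or.inl rfl))
  obtain ⟨S, hS, hwS⟩ := hw.exists_separated
  obtain ⟨hw₁, hw₂⟩ := isReducedWordOfOmega_iff.1 hw
  have hT := isTiling_tilesOf hξ hn hw₁ hw₂
  refine ⟨_, hT, fun σ hσ => ?_⟩
  obtain ⟨u, v, huv, rfl⟩ := hall σ (Or.inl hσ)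
  obtain ⟨h₁, h₂⟩ := hwS.commutation huv
  rw [mem_snakeDomain_iff hξ hT, tilesOf_commutation huv]
  exact isEdgeOf_tilesOf hn (h₁.mono (Set.subset_univ _)) (h₂.trans hw₂)

/-! ### The maximum size of a tiling domain -/

theorem tilingSizes_nonempty (hξ : IsConfiguration ξ) (hn : 2 ≤ n) : (tilingSizes ξ).Nonempty := by
  have h : IsPeakPit (∅ : Set (Equiv.Perm (Fin n))) := fun _ _ _ _ _ => Or.inl fun _ h => h.elim
  obtain ⟨T, hT, -⟩ := h.exists_tiling hξ hn
  exact ⟨_, _, ⟨T, hT, rfl⟩, rfl⟩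

theorem tilingSizes_bddAbove (ξ : Fin n → ℂ) : BddAbove (tilingSizes ξ) := by
  refine ⟨(Set.univ : Set (Equiv.Perm (Fin n))).ncard, ?_⟩
  rintro _ ⟨D, -, rfl⟩
  exact Set.ncard_le_ncard (Set.subset_univ _) (Set.toFinite _)

theorem isGreatest_tilingGamma (hξ : IsConfiguration ξ) (hn : 2 ≤ n) :
    IsGreatest (tilingSizes ξ) (tilingGamma ξ) :=
  ⟨Nat.sSup_mem (tilingSizes_nonempty hξ hn) (tilingSizes_bddAbove ξ),
    fun _ h => le_csSup (tilingSizes_bddAbove ξ) h⟩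

theorem IsPeakPit.ncard_le_tilingGamma (hξ : IsConfiguration ξ) (hn : 2 ≤ n)
    {D : Set (Equiv.Perm (Fin n))} (h : IsPeakPit D) : D.ncard ≤ tilingGamma ξ := by
  obtain ⟨T, hT, hD⟩ := h.exists_tiling hξ hn
  exact (Set.ncard_le_ncard hD (Set.toFinite _)).trans
    ((isGreatest_tilingGamma hξ hn).2 ⟨_, ⟨T, hT, rfl⟩, rfl⟩)

/-- `α` and `ω` are adjoined to a largest tiling domain, which costs nothing since the inequality
suffices. Together with `ncard_le_tilingGamma` this identifies γ with the maximum size of a peak-pit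
domain. -/
theorem exists_isPeakPit_ncard_ge (hξ : IsConfiguration ξ) (hn : 2 ≤ n) :
    ∃ D : Set (Equiv.Perm (Fin n)), IsCondorcetDomain D ∧ IsPeakPit D ∧
      tilingGamma ξ ≤ D.ncard := by
  obtain ⟨D, ⟨T, hT, rfl⟩, hD⟩ := (isGreatest_tilingGamma hξ hn).1
  have h := (isPeakPit_snakeDomain hξ hT).union_extremes
  refine ⟨_, h.isCondorcetDomain (Or.inr (Or.inl rfl)) (Or.inr (Or.inr rfl)), h, ?_⟩
  rw [← hD]
  exact Set.ncard_le_ncard Set.subset_union_left (Set.toFinite _)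

theorem isPeakPit_fishburnDomain (n : ℕ) : IsPeakPit (fishburnDomain n) := by
  intro i j k hij hjk
  rcases Nat.even_or_odd (j.val + 1) with h | h
  · exact Or.inl fun σ hσ => (hσ i j k hij hjk).1 h
  · exact Or.inr fun σ hσ => (hσ i j k hij hjk).2 h

theorem fishburnPhi_le_tilingGamma (hξ : IsConfiguration ξ) (hn : 2 ≤ n) :
    fishburnPhi n ≤ tilingGamma ξ := (isPeakPit_fishburnDomain n).ncard_le_tilingGamma hξ hn

theorem fishburn_iff_tilingGamma (hξ : IsConfiguration ξ) (hn : 2 ≤ n) :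
    FishburnConjecture n ↔ tilingGamma ξ = fishburnPhi n := by
  constructor
  · intro h
    obtain ⟨D, hD, hD', hle⟩ := exists_isPeakPit_ncard_ge hξ hn
    exact le_antisymm (hle.trans (h D hD hD')) (fishburnPhi_le_tilingGamma hξ hn)
  · intro h D _ hD
    exact (hD.ncard_le_tilingGamma hξ hn).trans h.le

end Snakes

/-! ### Concatenation -/

section Concatenation

variable {n n' : ℕ}

theorem concatOrder_castAdd (σ : Equiv.Perm (Fin n)) (σ' : Equiv.Perm (Fin n')) (x : Fin n) :
    concatOrder σ σ' (Fin.castAdd n' x) = Fin.castAdd n' (σ x) := by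
  simp [concatOrder, Equiv.permCongr_apply]

theorem concatOrder_natAdd (σ : Equiv.Perm (Fin n)) (σ' : Equiv.Perm (Fin n')) (x : Fin n') :
    concatOrder σ σ' (Fin.natAdd n x) = Fin.natAdd n (σ' x) := by
  simp [concatOrder, Equiv.permCongr_apply]

theorem concatOrder_symm_castAdd (σ : Equiv.Perm (Fin n)) (σ' : Equiv.Perm (Fin n')) (x : Fin n) :
    (concatOrder σ σ').symm (Fin.castAdd n' x) = Fin.castAdd n' (σ.symm x) := by
  rw [Equiv.symm_apply_eq, concatOrder_castAdd, Equiv.apply_symm_apply]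

theorem concatOrder_symm_natAdd (σ : Equiv.Perm (Fin n)) (σ' : Equiv.Perm (Fin n'))
    (x : Fin n') : (concatOrder σ σ').symm (Fin.natAdd n x) = Fin.natAdd n (σ'.symm x) := by
  rw [Equiv.symm_apply_eq, concatOrder_natAdd, Equiv.apply_symm_apply]

theorem concatOrder_one : concatOrder (1 : Equiv.Perm (Fin n)) (1 : Equiv.Perm (Fin n')) = 1 := by
  ext x
  refine Fin.addCases (fun x => ?_) (fun x => ?_) x
  · rw [concatOrder_castAdd]; rfl
  · rw [concatOrder_natAdd]; rfl

theorem concatOrder_injective :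
    Function.Injective fun p : Equiv.Perm (Fin n) × Equiv.Perm (Fin n') =>
      concatOrder p.1 p.2 := by
  rintro ⟨σ, σ'⟩ ⟨τ, τ'⟩ h
  simp only at h
  have h₁ : σ = τ := by
    ext x
    have := congrArg (fun ρ => (ρ (Fin.castAdd n' x)).val) h
    simpa [concatOrder_castAdd] using this
  have h₂ : σ' = τ' := by
    ext x
    have := congrArg (fun ρ => (ρ (Fin.natAdd n x)).val) h
    simpa [concatOrder_natAdd] using this
  rw [h₁, h₂]

theorem below_castAdd {σ : Equiv.Perm (Fin n)} {σ' : Equiv.Perm (Fin n')} {x y : Fin n} :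
    Below (concatOrder σ σ') (Fin.castAdd n' x) (Fin.castAdd n' y) ↔ Below σ x y := by
  rw [Below, concatOrder_symm_castAdd, concatOrder_symm_castAdd]; rfl

theorem below_natAdd {σ : Equiv.Perm (Fin n)} {σ' : Equiv.Perm (Fin n')} {x y : Fin n'} :
    Below (concatOrder σ σ') (Fin.natAdd n x) (Fin.natAdd n y) ↔ Below σ' x y := by
  rw [Below, concatOrder_symm_natAdd, concatOrder_symm_natAdd, Fin.lt_def, Fin.val_natAdd,
    Fin.val_natAdd, Below, Fin.lt_def]
  omega

theorem not_below_natAdd_castAdd {σ : Equiv.Perm (Fin n)} {σ' : Equiv.Perm (Fin n')} {x : Fin n'}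
    {y : Fin n} : ¬ Below (concatOrder σ σ') (Fin.natAdd n x) (Fin.castAdd n' y) := by
  rw [Below, concatOrder_symm_natAdd, concatOrder_symm_castAdd, Fin.lt_def, Fin.val_natAdd,
    Fin.val_castAdd]
  omega

/-- A triple inside one block inherits its condition. If `i`, `j` are in the first block and `k` in
the second, `j` is below `k` and never best; if only `i` is in the first block, `j` is above `i` and
never worst. -/
theorem isPeakPit_concatDomain {D : Set (Equiv.Perm (Fin n))} {D' : Set (Equiv.Perm (Fin n'))}
    (h : IsPeakPit D) (h' : IsPeakPit D') : IsPeakPit (concatDomain D D') := by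
  intro i j k
  refine Fin.addCases (fun i => ?_) (fun i => ?_) i <;>
    refine Fin.addCases (fun j => ?_) (fun j => ?_) j <;>
    refine Fin.addCases (fun k => ?_) (fun k => ?_) k <;> intro hij hjk
  · refine (h i j k hij hjk).imp (fun h => ?_) fun h => ?_ <;>
    · rintro _ ⟨σ, hσ, σ', -, rfl⟩
      first | rw [Peak, below_castAdd, below_castAdd] | rw [Pit, below_castAdd, below_castAdd]
      exact h σ hσ
  · right
    rintro _ ⟨σ, hσ, σ', -, rfl⟩ ⟨-, h⟩
    exact not_below_natAdd_castAdd h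
  · rw [Fin.lt_def, Fin.val_natAdd, Fin.val_castAdd] at hjk; omega
  · left
    rintro _ ⟨σ, hσ, σ', -, rfl⟩ ⟨h, -⟩
    exact not_below_natAdd_castAdd h
  · rw [Fin.lt_def, Fin.val_natAdd, Fin.val_castAdd] at hij; omega
  · rw [Fin.lt_def, Fin.val_natAdd, Fin.val_castAdd] at hij; omega
  · rw [Fin.lt_def, Fin.val_natAdd, Fin.val_castAdd] at hjk; omega
  · rw [Fin.lt_def, Fin.val_natAdd, Fin.val_natAdd] at hij hjk
    refine (h' i j k (by rw [Fin.lt_def]; omega) (by rw [Fin.lt_def]; omega)).imp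
      (fun h => ?_) fun h => ?_ <;>
    · rintro _ ⟨σ, -, σ', hσ', rfl⟩
      first | rw [Peak, below_natAdd, below_natAdd] | rw [Pit, below_natAdd, below_natAdd]
      exact h σ' hσ'

theorem ncard_concatDomain (D : Set (Equiv.Perm (Fin n))) (D' : Set (Equiv.Perm (Fin n'))) :
    (concatDomain D D').ncard = D.ncard * D'.ncard := by
  have e : concatDomain D D' = (fun p : Equiv.Perm (Fin n) × Equiv.Perm (Fin n') =>
      concatOrder p.1 p.2) '' (D ×ˢ D') := by
    ext ρ
    constructor
    · rintro ⟨σ, hσ, σ', hσ', rfl⟩; exact ⟨(σ, σ'), ⟨hσ, hσ'⟩, rfl⟩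
    · rintro ⟨⟨σ, σ'⟩, ⟨hσ, hσ'⟩, rfl⟩; exact ⟨σ, hσ, σ', hσ', rfl⟩
  rw [e, Set.ncard_image_of_injective _ concatOrder_injective, Set.ncard_prod]

theorem concat_isCondorcetDomain {D : Set (Equiv.Perm (Fin n))}
    {D' : Set (Equiv.Perm (Fin n'))} (hD : IsCondorcetDomain D) (h : IsPeakPit D)
    (hD' : IsCondorcetDomain D') (h' : IsPeakPit D') :
    IsCondorcetDomain (concatDomain D D' ∪ {omegaOrder (n + n')}) ∧
      IsPeakPit (concatDomain D D' ∪ {omegaOrder (n + n')}) := by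
  have hp : IsPeakPit (concatDomain D D' ∪ {omegaOrder (n + n')}) :=
    (isPeakPit_concatDomain h h').union_extremes.mono
      (Set.union_subset_union_right _ (by simp))
  exact ⟨hp.isCondorcetDomain (Or.inl ⟨_, hD.1, _, hD'.1, concatOrder_one.symm⟩) (Or.inr rfl), hp⟩

/-- The three configurations are unrelated: the argument runs through sizes of peak-pit sets, which
do not involve the vectors. -/
theorem tilingGamma_mul_le {ξ : Fin n → ℂ} {ξ' : Fin n' → ℂ} {η : Fin (n + n') → ℂ}
    (hξ : IsConfiguration ξ) (hξ' : IsConfiguration ξ') (hη : IsConfiguration η) (hn : 2 ≤ n)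
    (hn' : 2 ≤ n') : tilingGamma ξ * tilingGamma ξ' ≤ tilingGamma η := by
  obtain ⟨D, -, hD, hle⟩ := exists_isPeakPit_ncard_ge hξ hn
  obtain ⟨D', -, hD', hle'⟩ := exists_isPeakPit_ncard_ge hξ' hn'
  refine (Nat.mul_le_mul hle hle').trans ?_
  rw [← ncard_concatDomain]
  exact (isPeakPit_concatDomain hD hD').ncard_le_tilingGamma hη (by omega)

/-! ### Stacking -/

/-- The positions of the first block. -/
def castPos (n' : ℕ) (k : Fin (n - 1)) : Fin (n + n' - 1) := ⟨k.val, by omega⟩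

/-- The positions of the second block. -/
def shiftPos (n : ℕ) (k : Fin (n' - 1)) : Fin (n + n' - 1) := ⟨n + k.val, by omega⟩

theorem lo_castPos (k : Fin (n - 1)) : lo (castPos n' k) = Fin.castAdd n' (lo k) := rfl
theorem hi_castPos (k : Fin (n - 1)) : hi (castPos n' k) = Fin.castAdd n' (hi k) := rfl
theorem lo_shiftPos (k : Fin (n' - 1)) : lo (shiftPos n k) = Fin.natAdd n (lo k) := rfl
theorem hi_shiftPos (k : Fin (n' - 1)) : hi (shiftPos n k) = Fin.natAdd n (hi k) := rfl

theorem concatOrder_mul_castPos (σ : Equiv.Perm (Fin n)) (σ' : Equiv.Perm (Fin n'))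
    (k : Fin (n - 1)) :
    concatOrder σ σ' * adjSwap (castPos n' k) = concatOrder (σ * adjSwap k) σ' := by
  refine Equiv.ext fun x => ?_
  refine Fin.addCases (fun x => ?_) (fun x => ?_) x
  · have : adjSwap (castPos n' k) (Fin.castAdd n' x) = Fin.castAdd n' (adjSwap k x) := by
      apply Fin.ext
      simp only [adjSwap_val, Fin.val_castAdd, castPos]
    rw [Equiv.Perm.mul_apply, this, concatOrder_castAdd, concatOrder_castAdd, Equiv.Perm.mul_apply]
  · have := k.isLt
    rw [Equiv.Perm.mul_apply, adjSwap_of_ne, concatOrder_natAdd, concatOrder_natAdd] <;>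
      simp only [Fin.val_natAdd, castPos] <;> omega

theorem concatOrder_mul_shiftPos (σ : Equiv.Perm (Fin n)) (σ' : Equiv.Perm (Fin n'))
    (k : Fin (n' - 1)) :
    concatOrder σ σ' * adjSwap (shiftPos n k) = concatOrder σ (σ' * adjSwap k) := by
  refine Equiv.ext fun x => ?_
  refine Fin.addCases (fun x => ?_) (fun x => ?_) x
  · have := x.isLt
    rw [Equiv.Perm.mul_apply, adjSwap_of_ne, concatOrder_castAdd, concatOrder_castAdd] <;>
      simp only [Fin.val_castAdd, shiftPos] <;> omega
  · have : adjSwap (shiftPos n k) (Fin.natAdd n x) = Fin.natAdd n (adjSwap k x) := by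
      apply Fin.ext
      simp only [adjSwap_val, Fin.val_natAdd, shiftPos]
      split_ifs <;> omega
    rw [Equiv.Perm.mul_apply, this, concatOrder_natAdd, concatOrder_natAdd, Equiv.Perm.mul_apply]

theorem vertexAt_eq_sum_ite (ξ : Fin n → ℂ) (σ : Equiv.Perm (Fin n)) (m : ℕ) :
    vertexAt ξ σ m = ∑ x, if (σ.symm x).val < m then ξ x else 0 := by
  rw [vertexAt, prefixSet, Finset.sum_filter]

theorem vertexAt_concatOrder (η : Fin (n + n') → ℂ) (σ : Equiv.Perm (Fin n))
    (σ' : Equiv.Perm (Fin n')) {m : ℕ} (hm : m ≤ n) :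
    vertexAt η (concatOrder σ σ') m = vertexAt (fun i => η (Fin.castAdd n' i)) σ m := by
  rw [vertexAt_eq_sum_ite, vertexAt_eq_sum_ite, Fin.sum_univ_add]
  simp only [concatOrder_symm_castAdd, concatOrder_symm_natAdd, Fin.val_castAdd, Fin.val_natAdd]
  rw [add_eq_left]
  exact Finset.sum_eq_zero fun x _ => if_neg (by omega)

theorem vertexAt_concatOrder_add (η : Fin (n + n') → ℂ) (σ : Equiv.Perm (Fin n))
    (σ' : Equiv.Perm (Fin n')) (m : ℕ) :
    vertexAt η (concatOrder σ σ') (n + m) =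
      ∑ i, η (Fin.castAdd n' i) + vertexAt (fun i => η (Fin.natAdd n i)) σ' m := by
  rw [vertexAt_eq_sum_ite, vertexAt_eq_sum_ite, Fin.sum_univ_add]
  simp only [concatOrder_symm_castAdd, concatOrder_symm_natAdd, Fin.val_castAdd, Fin.val_natAdd,
    Nat.add_lt_add_iff_left]
  congr 1
  exact Finset.sum_congr rfl fun x _ => if_pos (by omega)

theorem ascendsIn_castPos {σ : Equiv.Perm (Fin n)} {w : List (Fin (n - 1))}
    (h : AscendsIn Set.univ σ w) (σ' : Equiv.Perm (Fin n')) :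
    AscendsIn Set.univ (concatOrder σ σ') (w.map (castPos n')) ∧
      concatOrder σ σ' * wordProd (w.map (castPos n')) = concatOrder (σ * wordProd w) σ' := by
  induction w generalizing σ with
  | nil => exact ⟨trivial, by simp [wordProd_nil]⟩
  | cons k w ih =>
    rw [List.map_cons, mul_wordProd_cons, mul_wordProd_cons, AscendsIn, concatOrder_mul_castPos]
    refine ⟨⟨trivial, ?_, (ih h.2.2).1⟩, (ih h.2.2).2⟩
    rw [lo_castPos, hi_castPos, concatOrder_castAdd, concatOrder_castAdd]
    exact h.2.1

theorem ascendsIn_shiftPos {σ' : Equiv.Perm (Fin n')} {w : List (Fin (n' - 1))}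
    (h : AscendsIn Set.univ σ' w) (σ : Equiv.Perm (Fin n)) :
    AscendsIn Set.univ (concatOrder σ σ') (w.map (shiftPos n)) ∧
      concatOrder σ σ' * wordProd (w.map (shiftPos n)) = concatOrder σ (σ' * wordProd w) := by
  induction w generalizing σ' with
  | nil => exact ⟨trivial, by simp [wordProd_nil]⟩
  | cons k w ih =>
    rw [List.map_cons, mul_wordProd_cons, mul_wordProd_cons, AscendsIn, concatOrder_mul_shiftPos]
    refine ⟨⟨trivial, ?_, (ih h.2.2).1⟩, (ih h.2.2).2⟩
    rw [lo_shiftPos, hi_shiftPos, concatOrder_natAdd, concatOrder_natAdd]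
    exact Nat.add_lt_add_left h.2.1 n

theorem lower_mem_tilesOf (η : Fin (n + n') → ℂ) {σ : Equiv.Perm (Fin n)}
    (σ' : Equiv.Perm (Fin n')) {w : List (Fin (n - 1))} {t : Tile n}
    (ht : t ∈ tilesOf (fun i => η (Fin.castAdd n' i)) σ w) :
    t.lower n' ∈ tilesOf η (concatOrder σ σ') (w.map (castPos n')) := by
  induction w generalizing σ with
  | nil => exact ht
  | cons k w ih =>
    rw [List.map_cons, tilesOf, concatOrder_mul_castPos]
    rcases ht with ⟨h₁, h₂, h₃⟩ | ht
    · left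
      have := k.isLt
      refine ⟨?_, ?_, ?_⟩
      · change t.base = vertexAt η (concatOrder σ σ') k.val
        rw [h₁, vertexAt_concatOrder _ _ _ (by omega)]
      · rw [lo_castPos, concatOrder_castAdd, ← h₂]; rfl
      · rw [hi_castPos, concatOrder_castAdd, ← h₃]; rfl
    · exact Or.inr (ih ht)

theorem upper_mem_tilesOf (η : Fin (n + n') → ℂ) (σ : Equiv.Perm (Fin n))
    {σ' : Equiv.Perm (Fin n')} {w : List (Fin (n' - 1))} {t : Tile n'}
    (ht : t ∈ tilesOf (fun i => η (Fin.natAdd n i)) σ' w) :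
    t.upper n (∑ i, η (Fin.castAdd n' i)) ∈
      tilesOf η (concatOrder σ σ') (w.map (shiftPos n)) := by
  induction w generalizing σ' with
  | nil => exact ht
  | cons k w ih =>
    rw [List.map_cons, tilesOf, concatOrder_mul_shiftPos]
    rcases ht with ⟨h₁, h₂, h₃⟩ | ht
    · left
      refine ⟨?_, ?_, ?_⟩
      · change _ + t.base = vertexAt η (concatOrder σ σ') (n + k.val)
        rw [h₁, vertexAt_concatOrder_add]
      · rw [lo_shiftPos, concatOrder_natAdd, ← h₂]; rfl
      · rw [hi_shiftPos, concatOrder_natAdd, ← h₃]; rfl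
    · exact Or.inr (ih ht)

theorem Tile.HasEdge.lower {η : Fin (n + n') → ℂ} {t : Tile n} {v : ℂ} {k : Fin n}
    (h : t.HasEdge (fun i => η (Fin.castAdd n' i)) v k) :
    (t.lower n').HasEdge η v (Fin.castAdd n' k) := by
  rcases h with ⟨rfl, h⟩ | ⟨rfl, h⟩
  · exact Or.inl ⟨rfl, h⟩
  · exact Or.inr ⟨rfl, h⟩

theorem Tile.HasEdge.upper {η : Fin (n + n') → ℂ} {t : Tile n'} {v : ℂ} {k : Fin n'} (p : ℂ)
    (h : t.HasEdge (fun i => η (Fin.natAdd n i)) v k) :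
    (t.upper n p).HasEdge η (p + v) (Fin.natAdd n k) := by
  rcases h with ⟨rfl, rfl | rfl⟩ | ⟨rfl, rfl | rfl⟩
  · exact Or.inl ⟨rfl, Or.inl rfl⟩
  · exact Or.inl ⟨rfl, Or.inr (add_assoc _ _ _).symm⟩
  · exact Or.inr ⟨rfl, Or.inl rfl⟩
  · exact Or.inr ⟨rfl, Or.inr (add_assoc _ _ _).symm⟩

/-- Two tilings put on each other extend to a tiling of the zonogon of all vectors. -/
theorem exists_tiling_of_stack {η : Fin (n + n') → ℂ} (hη : IsConfiguration η)
    {T : Set (Tile n)} {T' : Set (Tile n')} (hT : IsTiling (fun i => η (Fin.castAdd n' i)) T)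
    (hT' : IsTiling (fun i => η (Fin.natAdd n i)) T') :
    ∃ U : Set (Tile (n + n')), IsTiling η U ∧ stack η T T' ⊆ U ∧
      ∀ σ ∈ snakeDomain (fun i => η (Fin.castAdd n' i)) T,
        ∀ σ' ∈ snakeDomain (fun i => η (Fin.natAdd n i)) T',
          concatOrder σ σ' ∈ snakeDomain η U := by
  have hn := hT.two_le
  have hξ : IsConfiguration fun i => η (Fin.castAdd n' i) :=
    ⟨fun i => hη.im_pos _, fun i j => hη.norm_eq _ _, fun i j hij => hη.clockwise _ _ hij⟩
  have hξ' : IsConfiguration fun i => η (Fin.natAdd n i) :=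
    ⟨fun i => hη.im_pos _, fun i j => hη.norm_eq _ _, fun i j hij => hη.clockwise _ _
      (Nat.add_lt_add_left hij n)⟩
  obtain ⟨w, hw, hTw⟩ := hT.exists_word hξ
  obtain ⟨w', hw', hTw'⟩ := hT'.exists_word hξ'
  rw [isReducedWordOfOmega_iff] at hw hw'
  have a₁ := ascendsIn_castPos hw.1 (1 : Equiv.Perm (Fin n'))
  have a₂ := ascendsIn_shiftPos hw'.1 (omegaOrder n)
  rw [one_mul, hw.2, concatOrder_one, one_mul] at a₁
  rw [one_mul, hw'.2] at a₂
  -- The words of the two tilings, the second shifted to the last positions, lead from α to the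
  -- concatenation of the two reversed orders. Any ascending word `u` from there to `ω` sweeps the
  -- remaining tiles.
  obtain ⟨u, hu, hu'⟩ := exists_ascendsIn_to_omega (D := Set.univ)
    (fun σ _ hne => (exists_ascent hne).imp fun k hk => ⟨hk, trivial⟩)
    (Set.mem_univ (concatOrder (omegaOrder n) (omegaOrder n')))
  have hasc : AscendsIn Set.univ (1 : Equiv.Perm (Fin (n + n')))
      (w.map (castPos n') ++ (w'.map (shiftPos n) ++ u)) := by
    rw [ascendsIn_append, ascendsIn_append, one_mul, a₁.2, a₂.2]
    exact ⟨a₁.1, a₂.1, hu⟩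
  have hprod : wordProd (w.map (castPos n') ++ (w'.map (shiftPos n) ++ u)) =
      omegaOrder (n + n') := by
    rw [wordProd_append, wordProd_append, a₁.2, ← mul_assoc, a₂.2, hu']
  have hU := isTiling_tilesOf hη (by omega) hasc hprod
  have hstack : stack η T T' ⊆
      tilesOf η 1 (w.map (castPos n') ++ (w'.map (shiftPos n) ++ u)) := by
    rw [tilesOf_append, tilesOf_append, one_mul, a₁.2]
    rintro _ (⟨t, ht, rfl⟩ | ⟨t, ht, rfl⟩)
    · rw [hTw] at ht
      left
      rw [← concatOrder_one]
      exact lower_mem_tilesOf η 1 ht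
    · rw [hTw'] at ht
      exact Or.inr (Or.inl (upper_mem_tilesOf η (omegaOrder n) ht))
  refine ⟨_, hU, hstack, fun σ hσ σ' hσ' => ?_⟩
  rw [mem_snakeDomain_iff hξ hT] at hσ
  rw [mem_snakeDomain_iff hξ' hT'] at hσ'
  rw [mem_snakeDomain_iff hη hU]
  intro p
  -- The path of the concatenation runs along the stacked tiles alone, whatever the completing tiles
  -- are.
  refine IsEdgeOf.mono hstack ?_
  refine Fin.addCases (fun p => ?_) (fun p => ?_) p
  · obtain ⟨t, ht, he⟩ := hσ p
    refine ⟨_, Or.inl ⟨t, ht, rfl⟩, ?_⟩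
    rw [concatOrder_castAdd, Fin.val_castAdd, vertexAt_concatOrder _ _ _ p.isLt.le]
    exact he.lower
  · obtain ⟨t, ht, he⟩ := hσ' p
    refine ⟨_, Or.inr ⟨t, ht, rfl⟩, ?_⟩
    rw [concatOrder_natAdd, Fin.val_natAdd, vertexAt_concatOrder_add]
    exact he.upper _

end Concatenation

/-! ### Fishburn's domain as a set of words -/

section Completions

variable {n : ℕ}

/-- In Fishburn's alternating scheme the alternative `x` may follow upon the prefix set `A`. -/
def Allows (A : Finset (Fin n)) (x : Fin n) : Prop :=
  x ∉ A ∧ ∀ i < x, ∀ k > x,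
    (Even (x.val + 1) → i ∈ A ∨ k ∈ A) ∧ (Odd (x.val + 1) → i ∉ A ∨ k ∉ A)

/-- When the letter `j` is appended, it is not the worst of i, j, k exactly if `i` or `k` is already
present, and not the best exactly if one of them is still missing. So the scheme only concerns the
set of earlier letters. -/
theorem mem_fishburnDomain_iff {σ : Equiv.Perm (Fin n)} :
    σ ∈ fishburnDomain n ↔ ∀ p : Fin n, Allows (prefixSet σ p.val) (σ p) := by
  have key : ∀ i j : Fin n, i ∈ prefixSet σ (σ.symm j).val ↔ Below σ i j := fun i j => by
    rw [mem_prefixSet]; rfl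
  have hne : ∀ i j : Fin n, i ≠ j → (¬ Below σ j i ↔ Below σ i j) := fun i j h => by
    have : σ.symm i ≠ σ.symm j := σ.symm.injective.ne h
    unfold Below
    omega
  rw [σ.forall_congr_left]
  simp only [Allows, Equiv.apply_symm_apply, key]
  constructor
  · intro h j
    refine ⟨lt_irrefl _, fun i hi k hk => ⟨fun he => ?_, fun ho => ?_⟩⟩
    · have := (h i j k hi hk).1 he
      rwa [Peak, not_and_or, hne _ _ hi.ne, hne _ _ hk.ne'] at this
    · have := (h i j k hi hk).2 ho
      rwa [Pit, not_and_or] at this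
  · intro h i j k hi hk
    obtain ⟨h₁, h₂⟩ := (h j).2 i hi k hk
    refine ⟨fun he => ?_, fun ho => ?_⟩
    · rw [Peak, not_and_or, hne _ _ hi.ne, hne _ _ hk.ne']
      exact h₁ he
    · rw [Pit, not_and_or]
      exact h₂ ho

/-- The word `l` continues a word with the letters `A` to an order of Fishburn's domain. -/
def IsCompletion : Finset (Fin n) → List (Fin n) → Prop
  | A, [] => A = Finset.univ
  | A, x :: l => Allows A x ∧ IsCompletion (insert x A) l

theorem IsCompletion.nodup {A : Finset (Fin n)} {l : List (Fin n)} (h : IsCompletion A l) :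
    l.Nodup ∧ ∀ x, x ∈ l ↔ x ∉ A := by
  induction l generalizing A with
  | nil => simp [show A = Finset.univ from h]
  | cons y l ih =>
    obtain ⟨h₁, h₂⟩ := ih h.2
    refine ⟨List.nodup_cons.2 ⟨by simp [h₂], h₁⟩, fun x => ?_⟩
    have := h.1.1
    rw [List.mem_cons, h₂, Finset.mem_insert]
    by_cases hx : x = y
    · simp [hx, this]
    · simp [hx]

theorem IsCompletion.length_eq {l : List (Fin n)} (h : IsCompletion ∅ l) : l.length = n := by
  obtain ⟨h₁, h₂⟩ := h.nodup
  simpa using Fintype.card_congr (h₁.getEquivOfForallMemList l (by simpa using h₂))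

theorem isCompletion_iff {A : Finset (Fin n)} {l : List (Fin n)} :
    IsCompletion A l ↔
      (∀ (m : ℕ) (hm : m < l.length), Allows (A ∪ (l.take m).toFinset) (l[m]'hm)) ∧
        A ∪ l.toFinset = Finset.univ := by
  induction l generalizing A with
  | nil => simp [IsCompletion]
  | cons y l ih =>
    rw [IsCompletion, ih, ← and_assoc]
    refine and_congr ⟨?_, fun h => ⟨?_, fun m hm => ?_⟩⟩ ?_
    · rintro ⟨h₀, h⟩ m hm
      cases m with
      | zero => simpa using h₀
      | succ m =>
        have := h m (by simpa using hm)
        simpa [Finset.insert_union, Finset.union_insert] using this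
    · have h₀ := h 0 (by simp)
      rw [List.getElem_cons_zero] at h₀
      simpa using h₀
    · have := h (m + 1) (by simpa using hm)
      simpa [Finset.insert_union, Finset.union_insert] using this
    · simp [Finset.insert_union, Finset.union_insert]

theorem toFinset_take_ofFn (σ : Equiv.Perm (Fin n)) (m : ℕ) :
    ((List.ofFn σ).take m).toFinset = prefixSet σ m := by
  ext x
  rw [List.mem_toFinset, mem_prefixSet, List.mem_take_iff_getElem]
  constructor
  · rintro ⟨i, hi, rfl⟩
    simp only [List.getElem_ofFn, Equiv.symm_apply_apply]
    omega
  · intro h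
    exact ⟨(σ.symm x).val, by simpa using h, by simp⟩

theorem isCompletion_ofFn (σ : Equiv.Perm (Fin n)) :
    IsCompletion ∅ (List.ofFn σ) ↔ σ ∈ fishburnDomain n := by
  rw [isCompletion_iff, mem_fishburnDomain_iff, and_iff_left]
  · constructor
    · intro h p
      simpa [toFinset_take_ofFn] using h p.val (by simp)
    · intro h m hm
      simpa [toFinset_take_ofFn] using h ⟨m, by simpa using hm⟩
  · ext x
    simpa using ⟨σ.symm x, by simp⟩

theorem fishburnPhi_eq_ncard (n : ℕ) :
    fishburnPhi n = {l : List (Fin n) | IsCompletion ∅ l}.ncard := by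
  have hinj : Function.Injective fun σ : Equiv.Perm (Fin n) => List.ofFn σ := fun σ τ h =>
    DFunLike.coe_injective (List.ofFn_injective h)
  rw [fishburnPhi, ← Set.ncard_image_of_injective _ hinj]
  congr 1
  ext l
  constructor
  · rintro ⟨σ, hσ, rfl⟩
    exact (isCompletion_ofFn σ).2 hσ
  · intro h
    have h₁ := (IsCompletion.nodup h).1
    have hlen := IsCompletion.length_eq h
    have hf : Function.Injective fun i : Fin n => l.get (i.cast hlen.symm) :=
      (List.nodup_iff_injective_get.1 h₁).comp (Fin.cast_injective _)
    have hl : List.ofFn (Equiv.ofBijective _ (Finite.injective_iff_bijective.1 hf)) = l :=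
      List.ext_getElem (by simp [hlen]) fun i _ _ => by simp
    exact ⟨_, (isCompletion_ofFn _).1 (hl.symm ▸ h : IsCompletion ∅ (List.ofFn _)), hl⟩

end Completions

/-! ### Counting with bit masks -/

/-- The set of the alternatives whose bit is set in `m` may be followed by `x`. -/
def CanAppend (n m x : ℕ) : Bool :=
  !m.testBit x &&
    -- Alternatives are numbered from 0 here, so an odd `x` carries the peak condition. Requiring
    -- `i` or `k` to be present for all i < x < k means that all smaller or all larger alternatives
    -- are present; for the pit condition, that all smaller or all larger ones are missing.
    bif x.testBit 0 then m % 2 ^ x == 2 ^ x - 1 || m >>> (x + 1) == 2 ^ (n - (x + 1)) - 1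
    else m % 2 ^ x == 0 || m >>> (x + 1) == 0

theorem mod_two_pow_eq_zero_iff {m x : ℕ} : m % 2 ^ x = 0 ↔ ∀ i < x, m.testBit i = false := by
  rw [Nat.eq_iff_testBit_eq]
  simp only [Nat.testBit_mod_two_pow, Nat.zero_testBit, Bool.and_eq_false_imp, decide_eq_true_eq]

theorem shiftRight_succ_eq_zero_iff {m x : ℕ} :
    m >>> (x + 1) = 0 ↔ ∀ k > x, m.testBit k = false := by
  rw [Nat.eq_iff_testBit_eq]
  simp only [Nat.testBit_shiftRight, Nat.zero_testBit]
  exact ⟨fun h k hk => by simpa [show x + 1 + (k - (x + 1)) = k by omega] using h (k - (x + 1)),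
    fun h i => h _ (by omega)⟩

theorem mod_two_pow_eq_iff {m x : ℕ} :
    m % 2 ^ x = 2 ^ x - 1 ↔ ∀ i < x, m.testBit i = true := by
  rw [Nat.eq_iff_testBit_eq]
  simp only [Nat.testBit_mod_two_pow, Nat.testBit_two_pow_sub_one]
  refine forall_congr' fun i => ?_
  by_cases h : i < x <;> simp [h]

theorem shiftRight_succ_eq_iff {n m x : ℕ} (hm : ∀ i, m.testBit i = true → i < n) :
    m >>> (x + 1) = 2 ^ (n - (x + 1)) - 1 ↔ ∀ k > x, k < n → m.testBit k = true := by
  rw [Nat.eq_iff_testBit_eq]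
  simp only [Nat.testBit_shiftRight, Nat.testBit_two_pow_sub_one]
  constructor
  · intro h k hk hn
    have := h (k - (x + 1))
    rw [show x + 1 + (k - (x + 1)) = k by omega] at this
    rw [this, decide_eq_true_eq]
    omega
  · intro h i
    by_cases hi : i < n - (x + 1)
    · simpa [hi] using h _ (by omega) (by omega)
    · have := hm (x + 1 + i)
      rw [decide_eq_false hi, Bool.eq_false_iff]
      exact fun h => by have := this h; omega

/-- The bits of `m` are the characteristic function of `A`. -/
def Represents {n : ℕ} (m : ℕ) (A : Finset (Fin n)) : Prop :=
  ∀ i : ℕ, m.testBit i = true ↔ ∃ h : i < n, ⟨i, h⟩ ∈ A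

theorem Represents.testBit {n m : ℕ} {A : Finset (Fin n)} (h : Represents m A) (x : Fin n) :
    m.testBit x.val = true ↔ x ∈ A := by
  simp [h x.val]

theorem Represents.testBit_eq_false {n m : ℕ} {A : Finset (Fin n)} (h : Represents m A)
    (x : Fin n) : m.testBit x.val = false ↔ x ∉ A := by
  rw [← h.testBit, Bool.not_eq_true]

theorem Represents.lor_two_pow {n m : ℕ} {A : Finset (Fin n)} (h : Represents m A) (x : Fin n) :
    Represents (m ||| 2 ^ x.val) (insert x A) := by
  intro i
  rw [Nat.testBit_or, Nat.testBit_two_pow, Bool.or_eq_true, decide_eq_true_eq, h i]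
  simp only [Finset.mem_insert, Fin.ext_iff]
  constructor
  · rintro (⟨h, hi⟩ | rfl)
    · exact ⟨h, Or.inr hi⟩
    · exact ⟨x.isLt, Or.inl rfl⟩
  · rintro ⟨h, rfl | hi⟩
    · exact Or.inr rfl
    · exact Or.inl ⟨h, hi⟩

theorem represents_zero {n : ℕ} : Represents 0 (∅ : Finset (Fin n)) := by
  intro i; simp

theorem Represents.eq_univ_iff {n m : ℕ} {A : Finset (Fin n)} (h : Represents m A) :
    m = 2 ^ n - 1 ↔ A = Finset.univ := by
  rw [Nat.eq_iff_testBit_eq, Finset.eq_univ_iff_forall]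
  simp only [Nat.testBit_two_pow_sub_one]
  constructor
  · intro h' x
    rw [← h.testBit, h', decide_eq_true x.isLt]
  · intro h' i
    rw [Bool.eq_iff_iff, h i, decide_eq_true_eq]
    exact ⟨fun ⟨h, _⟩ => h, fun h => ⟨h, h' _⟩⟩

theorem Represents.canAppend_iff {n m : ℕ} {A : Finset (Fin n)} (h : Represents m A)
    (x : Fin n) : CanAppend n m x.val = true ↔ Allows A x := by
  have hor : ∀ p q : Fin n → Prop, (∀ i < x, ∀ k > x, p i ∨ q k) ↔
      ((∀ i < x, p i) ∨ ∀ k > x, q k) := fun p q => by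
    constructor
    · intro h
      by_contra! hc
      obtain ⟨⟨i, hi, hp⟩, k, hk, hq⟩ := hc
      exact (h i hi k hk).elim hp hq
    · rintro (h | h) i hi k hk
      · exact Or.inl (h i hi)
      · exact Or.inr (h k hk)
  have hlow : ∀ b : Bool, (∀ i < x.val, m.testBit i = b) ↔ ∀ i < x, m.testBit i.val = b :=
    fun b => ⟨fun h i hi => h i.val hi, fun h i hi => h ⟨i, hi.trans x.isLt⟩ hi⟩
  have hup : (∀ k > x.val, k < n → m.testBit k = true) ↔ ∀ k > x, m.testBit k.val = true :=
    ⟨fun h k hk => h k.val hk k.isLt, fun h k hk hn => h ⟨k, hn⟩ hk⟩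
  have hup' : (∀ k > x.val, m.testBit k = false) ↔ ∀ k > x, m.testBit k.val = false :=
    ⟨fun h k hk => h k.val hk, fun h' k hk => by
      by_cases hn : k < n
      · exact h' ⟨k, hn⟩ hk
      · rw [Bool.eq_false_iff]
        exact fun hb => hn ((h k).1 hb).1⟩
  rw [CanAppend, Allows, Bool.and_eq_true, Bool.not_eq_true', h.testBit_eq_false]
  refine and_congr_right fun _ => ?_
  rcases Nat.even_or_odd x.val with he | ho
  · have hb : x.val.testBit 0 = false := by simpa using Nat.even_iff.1 he
    have h₁ : ¬ Even (x.val + 1) := by simpa [Nat.even_add_one] using he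
    have h₂ : Odd (x.val + 1) := he.add_one
    simp only [hb, cond_false, h₁, h₂, false_implies, true_implies, true_and, Bool.or_eq_true,
      beq_iff_eq, mod_two_pow_eq_zero_iff, shiftRight_succ_eq_zero_iff]
    rw [hlow, hup', hor]
    simp only [h.testBit_eq_false]
  · have hb : x.val.testBit 0 = true := by simpa using Nat.odd_iff.1 ho
    have h₁ : Even (x.val + 1) := ho.add_one
    have h₂ : ¬ Odd (x.val + 1) := by simpa using h₁
    simp only [hb, cond_true, h₁, h₂, false_implies, true_implies, and_true, Bool.or_eq_true,
      beq_iff_eq, mod_two_pow_eq_iff, shiftRight_succ_eq_iff fun i hi => ((h i).1 hi).1]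
    rw [hlow, hup, hor]
    simp only [h.testBit]

/-- The number of completions with `r` letters of the set with mask `m`. -/
def completions (n : ℕ) : ℕ → ℕ → ℕ
  | 0, m => if m = 2 ^ n - 1 then 1 else 0
  | r + 1, m => ∑ x ∈ Finset.range n, if CanAppend n m x then completions n r (m ||| 2 ^ x) else 0

theorem Represents.exists_finset {n : ℕ} (r : ℕ) {m : ℕ} {A : Finset (Fin n)}
    (h : Represents m A) : ∃ F : Finset (List (Fin n)),
      (∀ l, l ∈ F ↔ l.length = r ∧ IsCompletion A l) ∧ F.card = completions n r m := by
  induction r generalizing m A with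
  | zero =>
    refine ⟨if m = 2 ^ n - 1 then {[]} else ∅, fun l => ?_, ?_⟩
    · rw [List.length_eq_zero_iff]
      split_ifs with hm
      · rw [Finset.mem_singleton]
        exact ⟨fun hl => ⟨hl, by rw [hl]; exact h.eq_univ_iff.1 hm⟩, fun h => h.1⟩
      · refine ⟨fun h => absurd h (Finset.notMem_empty _), fun ⟨hl, hA⟩ => ?_⟩
        rw [hl] at hA
        exact (hm (h.eq_univ_iff.2 hA)).elim
    · rw [completions]
      split_ifs <;> simp
  | succ r ih =>
    choose F hF hcard using fun x => ih (h.lor_two_pow x)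
    refine ⟨(Finset.univ.filter fun x : Fin n => CanAppend n m x.val = true).biUnion fun x =>
      (F x).map ⟨List.cons x, List.cons_injective⟩, fun l => ?_, ?_⟩
    · simp only [Finset.mem_biUnion, Finset.mem_filter, Finset.mem_univ, true_and,
        Finset.mem_map, Function.Embedding.coeFn_mk, h.canAppend_iff, hF]
      constructor
      · rintro ⟨x, hx, l, ⟨rfl, hl⟩, rfl⟩
        exact ⟨rfl, hx, hl⟩
      · rintro ⟨hr, hl⟩
        cases l with
        | nil => cases hr
        | cons x l => exact ⟨x, hl.1, l, ⟨Nat.succ.inj hr, hl.2⟩, rfl⟩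
    · rw [Finset.card_biUnion, completions, Finset.sum_range, Finset.sum_filter]
      · exact Finset.sum_congr rfl fun x _ => by rw [Finset.card_map, hcard]
      · intro x _ y _ hxy
        rw [Function.onFun, Finset.disjoint_left]
        simp only [Finset.mem_map, Function.Embedding.coeFn_mk]
        rintro l ⟨l₁, -, rfl⟩ ⟨l₂, -, e⟩
        exact hxy (List.cons.inj e).1.symm

theorem fishburnPhi_eq_completions (n : ℕ) : fishburnPhi n = completions n n 0 := by
  obtain ⟨F, hF, hcard⟩ := (represents_zero (n := n)).exists_finset n
  rw [fishburnPhi_eq_ncard, ← hcard, ← Set.ncard_coe_finset]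
  congr 1
  ext l
  rw [Finset.mem_coe, hF]
  exact ⟨fun h => ⟨h.length_eq, h⟩, fun h => h.2⟩

/-- The alternative `j` lies between two alternatives of the set with mask `m` and may not be
above them. -/
def Doomed (n m j : ℕ) : Bool :=
  j.blt n && !j.testBit 0 && !m.testBit j && !(m % 2 ^ j == 0 || m >>> (j + 1) == 0)

theorem doomed_iff {n m j : ℕ} : Doomed n m j = true ↔ j < n ∧ j.testBit 0 = false ∧
    m.testBit j = false ∧ (∃ i < j, m.testBit i = true) ∧ ∃ k > j, m.testBit k = true := by
  have h₁ := mod_two_pow_eq_zero_iff (m := m) (x := j)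
  have h₂ := shiftRight_succ_eq_zero_iff (m := m) (x := j)
  simp only [← Bool.not_eq_true] at h₁ h₂ ⊢
  rw [← not_iff_not] at h₁ h₂
  push Not at h₁ h₂
  rw [← h₁, ← h₂, Doomed]
  simp [Nat.blt_eq, and_assoc]

/-- A doomed alternative stays forbidden when the set grows, so it is never added and the full set
is never reached. -/
theorem completions_of_doomed {n m j : ℕ} (h : Doomed n m j = true) (r : ℕ) :
    completions n r m = 0 := by
  induction r generalizing m with
  | zero =>
    rw [completions, if_neg]
    rintro rfl
    obtain ⟨hj, -, hb, -⟩ := doomed_iff.1 h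
    rw [Nat.testBit_two_pow_sub_one] at hb
    exact (decide_eq_false_iff_not.1 hb) hj
  | succ r ih =>
    rw [completions]
    refine Finset.sum_eq_zero fun x _ => ?_
    split_ifs with hx
    · refine ih ?_
      obtain ⟨hj, he, hb, ⟨i, hi, hbi⟩, k, hk, hbk⟩ := doomed_iff.1 h
      refine doomed_iff.2 ⟨hj, he, ?_, ⟨i, hi, by simp [hbi]⟩, k, hk, by simp [hbk]⟩
      rw [Nat.testBit_or, hb, Bool.false_or]
      refine Nat.testBit_two_pow_of_ne ?_
      rintro rfl
      rw [CanAppend, he, cond_false, Bool.and_eq_true, Bool.or_eq_true, beq_iff_eq, beq_iff_eq,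
        mod_two_pow_eq_zero_iff, shiftRight_succ_eq_zero_iff] at hx
      rcases hx.2 with hx | hx
      · rw [hx i hi] at hbi; cases hbi
      · rw [hx k hk] at hbk; cases hbk
    · rfl

/-! ### Evaluation layer by layer -/

/-- Evaluates the number before it is passed on. -/
def force {α : Type} : ℕ → (ℕ → α) → α
  | 0, k => k 0
  | m + 1, k => k (m + 1)

theorem force_eq {α : Type} (m : ℕ) (k : ℕ → α) : force m k = k m := by
  cases m <;> rfl

/-- Evaluates the list before it is passed on. -/
def forceList {α : Type} : List (ℕ × ℕ) → (List (ℕ × ℕ) → α) → α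
  | [], k => k []
  | (m, c) :: L, k => force m fun m => force c fun c => forceList L fun L => k ((m, c) :: L)

theorem forceList_eq {α : Type} (L : List (ℕ × ℕ)) (k : List (ℕ × ℕ) → α) :
    forceList L k = k L := by
  induction L generalizing k with
  | nil => rfl
  | cons s L ih => rw [forceList, force_eq, force_eq, ih]

/-- Adds `c` to the multiplicity of the mask `m`. -/
def addState (m c : ℕ) : List (ℕ × ℕ) → List (ℕ × ℕ)
  | [] => [(m, c)]
  | (m', c') :: L => bif m == m' then (m', c + c') :: L else (m', c') :: addState m c L

/-- Adds `c` to the multiplicities of the masks obtained from `m` by adding an alternative less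
than `x`, unless they have no completion. -/
def extendState (n m c : ℕ) : ℕ → List (ℕ × ℕ) → List (ℕ × ℕ)
  | 0, L => L
  | x + 1, L =>
    -- The positions tested are the nearest even ones on either side of `x`: at distance 2 for even
    -- `x`, 1 for odd `x`. For `x = 0` the truncated subtraction gives 0 itself, which is present
    -- and hence not doomed. Any choice of positions would be correct, since only masks without
    -- completions are dropped.
    bif CanAppend n m x && !Doomed n (m ||| 2 ^ x) (x - (2 - x % 2)) &&
        !Doomed n (m ||| 2 ^ x) (x + (2 - x % 2)) then
      forceList (addState (m ||| 2 ^ x) c L) fun L => extendState n m c x L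
    else extendState n m c x L

/-- The masks with one alternative more than those of the list. -/
def nextLayer (n : ℕ) : List (ℕ × ℕ) → List (ℕ × ℕ)
  | [] => []
  | (m, c) :: L => extendState n m c n (nextLayer n L)

/-- The masks with `r` alternatives, with multiplicities. -/
def layer (n : ℕ) : ℕ → List (ℕ × ℕ)
  | 0 => [(0, 1)]
  | r + 1 => forceList (layer n r) fun L => nextLayer n L

/-- The number of completions with `r` letters of the masks of the list. -/
def totalCompletions (n r : ℕ) (L : List (ℕ × ℕ)) : ℕ :=
  (L.map fun s => s.2 * completions n r s.1).sum

theorem totalCompletions_cons (n r : ℕ) (s : ℕ × ℕ) (L : List (ℕ × ℕ)) :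
    totalCompletions n r (s :: L) = s.2 * completions n r s.1 + totalCompletions n r L := by
  rw [totalCompletions, List.map_cons, List.sum_cons, totalCompletions]

theorem totalCompletions_addState (n r m c : ℕ) (L : List (ℕ × ℕ)) :
    totalCompletions n r (addState m c L) = c * completions n r m + totalCompletions n r L := by
  induction L with
  | nil => rw [addState, totalCompletions_cons]
  | cons s L ih =>
    rw [addState]
    by_cases h : m = s.1
    · rw [beq_iff_eq.2 h, cond_true, totalCompletions_cons, totalCompletions_cons, h]
      ring
    · rw [beq_eq_false_iff_ne.2 h, cond_false, totalCompletions_cons, ih, totalCompletions_cons]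
      ring

theorem totalCompletions_extendState (n r m c x : ℕ) (L : List (ℕ × ℕ)) :
    totalCompletions n r (extendState n m c x L) =
      c * (∑ y ∈ Finset.range x, if CanAppend n m y then completions n r (m ||| 2 ^ y) else 0) +
        totalCompletions n r L := by
  induction x generalizing L with
  | zero => simp [extendState]
  | succ x ih =>
    rw [extendState, Finset.sum_range_succ]
    cases h : CanAppend n m x
    · simp [ih]
    · cases h₁ : Doomed n (m ||| 2 ^ x) (x - (2 - x % 2))
      · cases h₂ : Doomed n (m ||| 2 ^ x) (x + (2 - x % 2))
        · simp only [Bool.not_false, Bool.and_true, cond_true, forceList_eq, ih,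
            totalCompletions_addState, if_true]
          ring
        · simp [ih, completions_of_doomed h₂]
      · simp [ih, completions_of_doomed h₁]

theorem totalCompletions_nextLayer (n r : ℕ) (L : List (ℕ × ℕ)) :
    totalCompletions n r (nextLayer n L) = totalCompletions n (r + 1) L := by
  induction L with
  | nil => rfl
  | cons s L ih =>
    rw [nextLayer, totalCompletions_extendState, ih, totalCompletions_cons, completions]

/-- The sum of multiplicity times number of completions is the same for all layers: merging equal
masks preserves it, and the masks dropped contribute zero. -/
theorem totalCompletions_layer (n r k : ℕ) :
    totalCompletions n k (layer n r) = completions n (r + k) 0 := by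
  induction r generalizing k with
  | zero => simp [layer, totalCompletions]
  | succ r ih =>
    rw [layer, forceList_eq, totalCompletions_nextLayer, ih, add_right_comm, add_assoc]

/-- Only the full mask survives in the last layer, and its multiplicity counts all orders of the
domain. -/
theorem fishburnPhi_of_layer {n c : ℕ} (h : layer n n = [(2 ^ n - 1, c)]) :
    fishburnPhi n = c := by
  have := totalCompletions_layer n n 0
  rw [add_zero, ← fishburnPhi_eq_completions] at this
  rw [← this, h, totalCompletions_cons, completions, if_pos rfl]
  simp [totalCompletions]

theorem fishburnPhi_twentyOne : fishburnPhi 21 = 4443896 :=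
  fishburnPhi_of_layer (by decide +kernel)

theorem fishburnPhi_fortyTwo : fishburnPhi 42 = 19156227207750 :=
  fishburnPhi_of_layer (by decide +kernel)

end FishburnTiling
-- The failure of the conjectures for 42 alternatives
theorem mainTheorem4 (ξ : ∀ n : ℕ, Fin n → ℂ) (hξ : ∀ n, IsConfiguration (ξ n)) :
    -- the maximum is attained
    (∀ n, 2 ≤ n → IsGreatest (tilingSizes (ξ n)) (tilingGamma (ξ n))) ∧
    -- stacking of tilings
    (∀ (n n' : ℕ) (η : Fin (n + n') → ℂ), IsConfiguration η →
      ∀ (T : Set (Tile n)) (T' : Set (Tile n')),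
        IsTiling (fun i => η (Fin.castAdd n' i)) T →
        IsTiling (fun i => η (Fin.natAdd n i)) T' →
        ∃ U : Set (Tile (n + n')), IsTiling η U ∧ stack η T T' ⊆ U ∧
          (∀ σ ∈ snakeDomain (fun i => η (Fin.castAdd n' i)) T,
            ∀ σ' ∈ snakeDomain (fun i => η (Fin.natAdd n i)) T',
              concatOrder σ σ' ∈ snakeDomain η U)) ∧
    -- concatenation of peak-pit domains
    (∀ (n n' : ℕ) (D : Set (Equiv.Perm (Fin n))) (D' : Set (Equiv.Perm (Fin n'))),
      IsCondorcetDomain D → IsPeakPit D → IsCondorcetDomain D' → IsPeakPit D' →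
        IsCondorcetDomain (concatDomain D D' ∪ {omegaOrder (n + n')}) ∧
        IsPeakPit (concatDomain D D' ∪ {omegaOrder (n + n')}) ∧
        (concatDomain D D').ncard = D.ncard * D'.ncard) ∧
    -- supermultiplicativity
    (∀ n n', 2 ≤ n → 2 ≤ n' →
      tilingGamma (ξ n) * tilingGamma (ξ n') ≤ tilingGamma (ξ (n + n'))) ∧
    -- the values of `Φ`
    fishburnPhi 21 = 4443896 ∧
    fishburnPhi 42 = 19156227207750 ∧
    fishburnPhi 21 ^ 2 = 19748211658816 ∧
    fishburnPhi 42 < fishburnPhi 21 ^ 2 ∧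
    fishburnPhi 42 < tilingGamma (ξ 42) ∧
    -- the conjectures are equivalent
    (∀ n, (FishburnConjecture n ↔ GalambosReinerConjecture n) ∧
      (FishburnConjecture n ↔ MonjardetConjecture n) ∧
      (2 ≤ n → (FishburnConjecture n ↔ tilingGamma (ξ n) = fishburnPhi n))) ∧
    -- and fail for `n = 42`
    ¬ FishburnConjecture 42 ∧
    ¬ GalambosReinerConjecture 42 ∧
    ¬ MonjardetConjecture 42 ∧
    tilingGamma (ξ 42) ≠ fishburnPhi 42 := by
  have hPhi : fishburnPhi 42 < fishburnPhi 21 ^ 2 := by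
    rw [fishburnPhi_twentyOne, fishburnPhi_fortyTwo]
    norm_num
  have hle := fishburnPhi_le_tilingGamma (hξ 21) (by norm_num)
  have hmul : tilingGamma (ξ 21) * tilingGamma (ξ 21) ≤ tilingGamma (ξ 42) :=
    tilingGamma_mul_le (hξ 21) (hξ 21) (hξ 42) (by norm_num) (by norm_num)
  -- Φ(42) < Φ(21)² ≤ γ_21² ≤ γ_42.
  have hgamma : fishburnPhi 42 < tilingGamma (ξ 42) := by
    rw [sq] at hPhi
    exact hPhi.trans_le ((Nat.mul_le_mul hle hle).trans hmul)
  have hF : ¬ FishburnConjecture 42 := by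
    rw [fishburn_iff_tilingGamma (hξ 42) (by norm_num)]
    exact hgamma.ne'
  exact ⟨fun n hn => isGreatest_tilingGamma (hξ n) hn,
    fun n n' η hη T T' hT hT' => exists_tiling_of_stack hη hT hT',
    fun n n' D D' hD h hD' h' => ⟨(concat_isCondorcetDomain hD h hD' h').1,
      (concat_isCondorcetDomain hD h hD' h').2, ncard_concatDomain D D'⟩,
    fun n n' hn hn' => tilingGamma_mul_le (hξ n) (hξ n') (hξ _) hn hn',
    fishburnPhi_twentyOne, fishburnPhi_fortyTwo, by rw [fishburnPhi_twentyOne]; norm_num, hPhi,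
    hgamma,
    fun n => ⟨fishburn_iff_galambosReiner n, fishburn_iff_monjardet n,
      fun hn => fishburn_iff_tilingGamma (hξ n) hn⟩,
    hF, fun h => hF ((fishburn_iff_galambosReiner 42).2 h),
    fun h => hF ((fishburn_iff_monjardet 42).2 h), hgamma.ne'⟩
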